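/- **Setting.** Let $\mathbb{K}$ be the field of real generalized Puiseux series $\sum_a x_a t^{a}$ (real exponents forming a decreasing sequence that is finite or tends to $-\infty$), ordered by $\mathbf x>0$ iff its leading coefficient (that of the largest exponent, the valuation) is positive. A tropical signed number is either $\mathbb 0$ (modulus $-\infty$, sign $0$) or a pair of a sign in $\{\pm1\}$ and a modulus in $\mathbb{R}$; products $\odot$ multiply signs and add moduli. The signed valuation $\mathrm{sval}$ maps $\mathbf x\in\mathbb{K}\setminus\{0\}$ to (sign, valuation) and $0$ to $\mathbb 0$; it is applied entrywise to matrices, and a lift of a tropical matrix $M$ is a matrix $\mathbf M$ over $\mathbb K$ with $\mathrm{sval}(\mathbf M)=M$. A square tropical matrix $B$ is generic if $\max_\sigma \sum_i |B_{i\sigma(i)}|$ is not $-\infty$ and is attained by a single permutation $\sigma$; a tropical matrix is strongly non-degenerate if all its square submatrices are generic. For a polynomial $P=\sum_{\alpha\in S}\mathbf c_\alpha X^\alpha$ over $\mathbb K$ with support $S$, the tropical polynomial $\mathrm{trop}(P)$ vanishes at $x$ if $\max_{\alpha\in S}\bigl(|\mathrm{sval}(\mathbf c_\alpha)|+\sum_i\alpha_i|x_i|\bigr)$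 is $-\infty$ or is attained at least twice; otherwise $\mathrm{trop}(P)(x):=\mathrm{sval}(\mathbf c_{\alpha^*})\odot x^{\odot\alpha^*}$ for the unique maximizer $\alpha^*$. Let $A$ be a tropical signed $m\times n$ matrix, $u,v$ tropical signed vectors of length $n$, and let $M$ be the $(m+2)\times n$ matrix with rows $A$, $u^{\mathsf T}$, $v^{\mathsf T}$. A basis is a pair $(I,J)$ with $I\subset[m]$, $J\subset[n]$ and $|I|+|J|=n$; put $\bar J=[n]\setminus J$. Let $P_{K\times L}$ be the $K\times L$ minor of the $(m+2)\times n$ matrix of variables. For $i\in I$ let $Q_i=P_{(I\setminus\{i\}\cup\{m+1\})\times\bar J}$, $R_i=P_{(I\setminus\{i\}\cup\{m+2\})\times\bar J}$ and $s_i=(-1)^{|\{i'\in I:\, i'>i\}|}$. For $j\in J$ let $Q_j=P_{(I\cup\{m+1\})\times(\bar J\cup\{j\})}$, $R_j=P_{(I\cup\{m+2\})\times(\bar J\cup\{j\})}$ and $s_j=(-1)^{|\{j'\in\bar J:\, j'>j\}|}$. Let $T_{kl}=Q_kR_l-Q_lR_k$. *Classical rule.* For $\mathbf A\in\mathbb K^{m\times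 n}$ and $\mathbf u,\mathbf v\in\mathbb K^n$, the reduced cost vectors $\mathbf y,\mathbf z\in\mathbb K^{I\uplus J}$ at $(I,J)$ are the solutions of $(\mathbf A'_{I\uplus J})^{\mathsf T}\mathbf y=\mathbf u$ and $(\mathbf A'_{I\uplus J})^{\mathsf T}\mathbf z=\mathbf v$, where $\mathbf A'_{I\uplus J}$ consists of the rows of $\mathbf A$ indexed by $I$ and the rows of the $n\times n$ identity matrix indexed by $J$. The rule $\rho_{\mathrm{sv}}(\mathbf A,\mathbf u,\mathbf v)(I,J)$ returns the $k\in I\uplus J$ that minimizes $\mathbf y_k/\mathbf z_k$ among those with $\mathbf y_k>0$ and $\mathbf z_k>0$, or $\mathsf{None}$ if there are none. *Tropical rule.* Let $\Lambda$ be the set of $l\in I\uplus J$ such that $\mathrm{sign}(\mathrm{trop}(Q_l)(M))=\mathrm{sign}(\mathrm{trop}(R_l)(M))=s_l\,\mathrm{sign}(\mathrm{trop}(P_{I\times\bar J})(M))$. The rule $\rho^{\mathrm{trop}}_{\mathrm{sv}}(A,u,v)(I,J)$ returns the $k\in\Lambda$ such that $\mathrm{sign}(\mathrm{trop}(T_{kl})(M))=-s_ks_l$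 for all $l\in\Lambda\setminus\{k\}$, or $\mathsf{None}$ if $\Lambda=\emptyset$. **Theorem.** Suppose that $M$ is strongly non-degenerate. Then, for every basis $(I,J)$: 1. The tropical rule is well defined: $\mathrm{trop}(P_{I\times\bar J})$, $\mathrm{trop}(Q_l)$, $\mathrm{trop}(R_l)$ ($l\in I\uplus J$) and $\mathrm{trop}(T_{kl})$ ($k\ne l$ in $I\uplus J$) do not vanish at $M$, and exactly one value (an element of $I\uplus J$ or $\mathsf{None}$) satisfies the definition of the rule. 2. For every lift $(\mathbf A,\mathbf u,\mathbf v)$ of $(A,u,v)$, the reduced cost vectors $\mathbf y,\mathbf z$ exist and are unique, and $\rho^{\mathrm{trop}}_{\mathrm{sv}}(A,u,v)(I,J)=\rho_{\mathrm{sv}}(\mathbf A,\mathbf u,\mathbf v)(I,J)$, this value being unique on both sides. Moreover, there is an algorithm that computes $\rho^{\mathrm{trop}}_{\mathrm{sv}}(A,u,v)(I,J)$ in time $O(n^4)$, uniformly in $m$, for all strongly non-degenerate $M$ and all bases $(I,J)$: there are a single program of a real random access machine and a constant $C$ such that, with random access to the signs and moduli of the entries of $M$ and with $I$ and $J$ given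 as sorted arrays together with $m,n,|I|,|J|$, the program halts with the correct output after at most $Cn^4+C$ steps. A step is a register or array access, an increment, decrement or comparison of natural numbers, an addition, subtraction or comparison of real numbers, or the loading of a constant. -/

import Mathlib

namespace TropShadow

noncomputable section

/-! ### Generalized Puiseux series

A Hahn series over `ℝᵒᵈ` is a formal series `∑ x_a t ^ a` with real exponents and real coefficients
whose set of exponents contains no infinite strictly increasing sequence.  Its `order`, taken in
`ℝᵒᵈ`, is the largest exponent. -/

/-- The exponents of the series form a decreasing sequence that is finite or tends to `-∞`. -/
def LocallyFinite (x : HahnSeries ℝᵒᵈ ℝ) : Prop :=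
  ∀ c : ℝ, {a : ℝ | c ≤ a ∧ x.coeff (OrderDual.toDual a) ≠ 0}.Finite

theorem LocallyFinite.add {x y : HahnSeries ℝᵒᵈ ℝ} (hx : LocallyFinite x)
    (hy : LocallyFinite y) : LocallyFinite (x + y) := by
  intro c
  refine ((hx c).union (hy c)).subset ?_
  rintro a ⟨hc, ha⟩
  by_cases h : x.coeff (OrderDual.toDual a) = 0
  · right
    refine ⟨hc, fun h2 => ha ?_⟩
    simp [h, h2]
  · exact Or.inl ⟨hc, h⟩

theorem LocallyFinite.neg {x : HahnSeries ℝᵒᵈ ℝ} (hx : LocallyFinite x) :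
    LocallyFinite (-x) := by
  intro c
  simpa using hx c

theorem LocallyFinite.single (a : ℝᵒᵈ) (r : ℝ) :
    LocallyFinite (HahnSeries.single a r) := by
  intro c
  refine (Set.finite_singleton (OrderDual.ofDual a)).subset ?_
  rintro b ⟨-, hb⟩
  by_contra h
  exact hb (HahnSeries.coeff_single_of_ne fun h2 => h (by rw [← h2]; rfl))

theorem LocallyFinite.mul {x y : HahnSeries ℝᵒᵈ ℝ} (hx : LocallyFinite x)
    (hy : LocallyFinite y) : LocallyFinite (x * y) := by
  intro c
  refine (((hx (c - OrderDual.ofDual y.order)).image2 (fun a b => a + b)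
    (hy (c - OrderDual.ofDual x.order)))).subset ?_
  rintro a ⟨hc, ha⟩
  obtain ⟨a1, h1, a2, h2, h12⟩ := Set.mem_add.1 (HahnSeries.support_mul_subset
    (show OrderDual.toDual a ∈ (x * y).support from ha))
  have l1 : OrderDual.ofDual a1 ≤ OrderDual.ofDual x.order :=
    HahnSeries.order_le_of_coeff_ne_zero h1
  have l2 : OrderDual.ofDual a2 ≤ OrderDual.ofDual y.order :=
    HahnSeries.order_le_of_coeff_ne_zero h2
  have e : OrderDual.ofDual a1 + OrderDual.ofDual a2 = a := congrArg OrderDual.ofDual h12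
  exact ⟨OrderDual.ofDual a1, ⟨by linarith, h1⟩, OrderDual.ofDual a2, ⟨by linarith, h2⟩, e⟩

/-- The locally finite series, as a ring. -/
def puiseuxSubring : Subring (HahnSeries ℝᵒᵈ ℝ) where
  carrier := {x | LocallyFinite x}
  zero_mem' := by intro c; simp
  one_mem' := LocallyFinite.single 0 1
  add_mem' := LocallyFinite.add
  mul_mem' := LocallyFinite.mul
  neg_mem' := LocallyFinite.neg

theorem LocallyFinite.inv_one_sub {e : HahnSeries ℝᵒᵈ ℝ} (he : LocallyFinite e)
    (hpos : 0 < e.orderTop) : LocallyFinite (1 - e)⁻¹ := by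
  by_cases h0 : e = 0
  · subst h0; simpa using LocallyFinite.single 0 1
  have hne : (1 - e) ≠ 0 := by
    intro h
    have : e = 1 := (sub_eq_zero.1 h).symm
    rw [this, HahnSeries.orderTop_one] at hpos
    exact lt_irrefl _ hpos
  have ho : e.orderTop = e.order := (HahnSeries.order_eq_orderTop_of_ne_zero h0).symm
  have hd : OrderDual.ofDual e.order < 0 := by
    have h : (0 : ℝᵒᵈ) < e.order := by rw [ho] at hpos; exact WithTop.coe_lt_coe.1 hpos
    exact h
  have hinv : (1 - e)⁻¹.order = 0 := by
    have h1 : (1 - e).order = 0 := by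
      have h2 : (1 - e).orderTop = (0 : ℝᵒᵈ) := by
        rw [HahnSeries.orderTop_sub]
        · exact HahnSeries.orderTop_one
        · rw [HahnSeries.orderTop_one]; exact hpos
      rw [← HahnSeries.order_eq_orderTop_of_ne_zero hne] at h2
      exact WithTop.coe_injective h2
    have h3 := HahnSeries.order_mul hne (inv_ne_zero hne)
    rw [mul_inv_cancel₀ hne, HahnSeries.order_one, h1, zero_add] at h3
    exact h3.symm
  intro c
  obtain ⟨N, hN⟩ := exists_nat_gt (c / OrderDual.ofDual e.order)
  have hN' : N * OrderDual.ofDual e.order < c := by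
    rw [div_lt_iff_of_neg hd] at hN; exact hN
  have hg : (1 - e)⁻¹ = (∑ i ∈ Finset.range N, e ^ i) + e ^ N * (1 - e)⁻¹ := by
    have := geom_sum_mul_neg e N
    field_simp
    rw [mul_comm (1 - e), this]; ring
  have hs : LocallyFinite (∑ i ∈ Finset.range N, e ^ i) :=
    puiseuxSubring.sum_mem fun i _ => puiseuxSubring.pow_mem (x := e) he i
  refine (hs c).subset ?_
  rintro a ⟨hc, ha⟩
  refine ⟨hc, fun h => ha ?_⟩
  rw [hg, HahnSeries.coeff_add, h, zero_add]
  apply HahnSeries.coeff_eq_zero_of_lt_order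
  rw [HahnSeries.order_mul (pow_ne_zero _ h0) (inv_ne_zero hne), hinv, add_zero,
    HahnSeries.order_pow]
  have e1 : OrderDual.ofDual (N • e.order) = N * OrderDual.ofDual e.order := by
    rw [← nsmul_eq_mul]; rfl
  show OrderDual.ofDual (N • e.order) < a
  rw [e1]; linarith

theorem LocallyFinite.inv {x : HahnSeries ℝᵒᵈ ℝ} (hx : LocallyFinite x) :
    LocallyFinite x⁻¹ := by
  by_cases h0 : x = 0
  · subst h0; rw [inv_zero]; exact hx
  have hr : x.leadingCoeff ≠ 0 := HahnSeries.leadingCoeff_ne_zero.2 h0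
  set w := HahnSeries.single (-x.order) (x.leadingCoeff)⁻¹ with hw
  have hw0 : w ≠ 0 := by simpa [hw] using hr
  have hlf : LocallyFinite w := LocallyFinite.single _ _
  have hone : LocallyFinite 1 := LocallyFinite.single 0 1
  have he : LocallyFinite (1 - w * x) := by
    rw [sub_eq_add_neg]; exact hone.add (hlf.mul hx).neg
  have hpos : 0 < (1 - w * x).orderTop := by
    rw [hw]
    exact HahnSeries.unit_aux x (inv_mul_cancel₀ hr) (-x.order) (neg_add_cancel _)
  have h1 := he.inv_one_sub hpos
  rw [sub_sub_cancel] at h1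
  have : x⁻¹ = w * (w * x)⁻¹ := by
    rw [mul_inv, ← mul_assoc, mul_inv_cancel₀ hw0, one_mul]
  rw [this]; exact hlf.mul h1

/-- The field of real generalized Puiseux series, as a subfield of the field of Hahn series. -/
def puiseuxSubfield : Subfield (HahnSeries ℝᵒᵈ ℝ) where
  toSubring := puiseuxSubring
  inv_mem' _ hx := LocallyFinite.inv hx

/-- The field `𝕂` of real generalized Puiseux series. -/
abbrev Puiseux : Type := puiseuxSubfield

/-- The total order of `𝕂`: `x < y` if and only if `y - x` has a positive leading coefficient. -/
instance : LinearOrder Puiseux :=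
  LinearOrder.lift' (fun x : Puiseux => toLex (x : HahnSeries ℝᵒᵈ ℝ))
    fun _ _ h => Subtype.ext (toLex.injective h)

theorem Puiseux.pos_iff (x : Puiseux) :
    0 < x ↔ 0 < (x : HahnSeries ℝᵒᵈ ℝ).leadingCoeff :=
  (HahnSeries.leadingCoeff_pos_iff (x := toLex (x : HahnSeries ℝᵒᵈ ℝ))).symm

theorem Puiseux.lt_iff (x y : Puiseux) :
    x < y ↔ 0 < ((y - x : Puiseux) : HahnSeries ℝᵒᵈ ℝ).leadingCoeff := by
  rw [← Puiseux.pos_iff]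
  exact (sub_pos (a := toLex (y : HahnSeries ℝᵒᵈ ℝ))
    (b := toLex (x : HahnSeries ℝᵒᵈ ℝ))).symm

instance : IsStrictOrderedRing Puiseux := by
  have hadd : ∀ a b : Puiseux, a ≤ b → ∀ c : Puiseux, a + c ≤ b + c := fun a b h c =>
    add_le_add_left (α := Lex (HahnSeries ℝᵒᵈ ℝ))
      (show toLex (a : HahnSeries ℝᵒᵈ ℝ) ≤ toLex (b : HahnSeries ℝᵒᵈ ℝ) from h) (toLex c.1)
  have : IsOrderedAddMonoid Puiseux := { add_le_add_left := hadd }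
  have : ZeroLEOneClass Puiseux :=
    ⟨zero_le_one (α := Lex (HahnSeries ℝᵒᵈ ℝ))⟩
  refine IsStrictOrderedRing.of_mul_pos fun a b ha hb => ?_
  exact mul_pos (α := Lex (HahnSeries ℝᵒᵈ ℝ))
    (show 0 < toLex (a : HahnSeries ℝᵒᵈ ℝ) from ha)
    (show 0 < toLex (b : HahnSeries ℝᵒᵈ ℝ) from hb)

/-! ### Tropical signed numbers -/

/-- The set `𝕋±` of tropical signed numbers: a nonzero element is a pair of a sign in `{1, -1}` and
a real modulus, and `0` is the tropical zero.  The product `x * y` is the tropical product: signs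
are multiplied and (real) moduli are added.  Likewise `x ^ k` is the tropical power, and `1` is the
tropical unit, that is the positive element of modulus `0`. -/
abbrev SignedTrop : Type := WithZero (ℤˣ × Multiplicative ℝ)

namespace SignedTrop

/-- The nonzero tropical signed number of sign `s` and modulus `a`. -/
def mk (s : ℤˣ) (a : ℝ) : SignedTrop :=
  ((s, Multiplicative.ofAdd a) : ℤˣ × Multiplicative ℝ)

/-- The modulus, in the tropical semiring `ℝ ∪ {-∞}`.  There, the tropical sum is `⊔`, and the
tropical product is `+`. -/
def modulus (x : SignedTrop) : WithBot ℝ :=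
  WithZero.recZeroCoe ⊥ (fun p => ((Multiplicative.toAdd p.2 : ℝ) : WithBot ℝ)) x

/-- The sign, which is `0` for the tropical zero. -/
def sign (x : SignedTrop) : SignType :=
  WithZero.recZeroCoe 0 (fun p => SignType.sign (p.1 : ℤ)) x

end SignedTrop

open Classical in
/-- The signed valuation of a Puiseux series. -/
def sval (x : Puiseux) : SignedTrop :=
  if x = 0 then 0
  else SignedTrop.mk (if 0 < x then 1 else -1)
    (OrderDual.ofDual (x : HahnSeries ℝᵒᵈ ℝ).order)

/-- The weight `|B_{1σ(1)}| ⊙ ⋯ ⊙ |B_{kσ(k)}|` of a permutation. -/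
def permWeight {k : ℕ} (B : Matrix (Fin k) (Fin k) SignedTrop) (σ : Equiv.Perm (Fin k)) :
    WithBot ℝ :=
  ∑ i, (B i (σ i)).modulus

/-- The maximal weight of a permutation is not `-∞`, and is attained only once. -/
def Generic {k : ℕ} (B : Matrix (Fin k) (Fin k) SignedTrop) : Prop :=
  Finset.univ.sup (permWeight B) ≠ ⊥ ∧
    ∃! σ : Equiv.Perm (Fin k), permWeight B σ = Finset.univ.sup (permWeight B)

/-- All square submatrices are generic. -/
def StronglyNonDegenerate {p q : ℕ} (M : Matrix (Fin p) (Fin q) SignedTrop) : Prop :=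
  ∀ (k : ℕ) (r : Fin k ↪o Fin p) (c : Fin k ↪o Fin q), Generic (M.submatrix r c)

/-! ### Tropical polynomials -/

section TropicalPolynomial

variable {ι : Type*} [Fintype ι]

/-- The signed tropical monomial `c_α ⊙ x^{⊙ α}` of the tropicalization of `P`. -/
def tropTerm (P : MvPolynomial ι Puiseux) (x : ι → SignedTrop) (α : ι →₀ ℕ) : SignedTrop :=
  sval (P.coeff α) * ∏ i, x i ^ α i

/-- `|c_α| ⊙ |x|^{⊙ α}` -/
def tropTermModulus (P : MvPolynomial ι Puiseux) (x : ι → SignedTrop) (α : ι →₀ ℕ) : WithBot ℝ :=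
  (sval (P.coeff α)).modulus + ∑ i, α i • (x i).modulus

/-- The largest modulus of a monomial. -/
def tropModulus (P : MvPolynomial ι Puiseux) (x : ι → SignedTrop) : WithBot ℝ :=
  P.support.sup (tropTermModulus P x)

/-- The tropicalization of `P` vanishes on `x`: the maximum of the moduli of its monomials is
attained at least twice, or is equal to `-∞`. -/
def TropVanishes (P : MvPolynomial ι Puiseux) (x : ι → SignedTrop) : Prop :=
  tropModulus P x = ⊥ ∨
    ∃ α ∈ P.support, ∃ β ∈ P.support, α ≠ β ∧
      tropTermModulus P x α = tropModulus P x ∧ tropTermModulus P x β = tropModulus P x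

theorem exists_max_of_not_tropVanishes {P : MvPolynomial ι Puiseux} {x : ι → SignedTrop}
    (h : ¬ TropVanishes P x) :
    ∃ α, α ∈ P.support ∧ tropTermModulus P x α = tropModulus P x := by
  have hne : P.support.Nonempty := by
    rw [Finset.nonempty_iff_ne_empty]
    intro h0
    exact h (Or.inl (by simp [tropModulus, h0]))
  obtain ⟨α, hα, h1⟩ := Finset.exists_mem_eq_sup P.support hne (tropTermModulus P x)
  exact ⟨α, hα, h1.symm⟩

open Classical in
/-- The value at `x` of the tropicalization of `P`, that is its unique monomial of maximal modulus.
If the tropicalization vanishes on `x`, there is no value, and we return `0`. -/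
def tropEval (P : MvPolynomial ι Puiseux) (x : ι → SignedTrop) : SignedTrop :=
  if h : TropVanishes P x then 0
  else tropTerm P x (Classical.choose (exists_max_of_not_tropVanishes h))

end TropicalPolynomial

/-! ### Bases and the polynomials of the shadow-vertex rule -/

/-- The matrix with rows `A`, then `uᵀ` (row `m`), then `vᵀ` (row `m + 1`); rows are numbered
from `0`. -/
def stack {R : Type*} {m n : ℕ} (A : Matrix (Fin m) (Fin n) R) (u v : Fin n → R) :
    Matrix (Fin (m + 2)) (Fin n) R :=
  Matrix.of (Fin.append (fun i => A i) ![u, v])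

/-- A matrix as a family of values for the variables `X_{ij}`. -/
def entries {R : Type*} {p q : ℕ} (M : Matrix (Fin p) (Fin q) R) : Fin p × Fin q → R :=
  fun ij => M ij.1 ij.2

/-- `(I, J)` is a basis. -/
def IsBasis {m n : ℕ} (I : Finset (Fin m)) (J : Finset (Fin n)) : Prop :=
  I.card + J.card = n

/-- The polynomial `P_{K × L}`: the `K × L` minor of the matrix of formal variables.  It is only
used when `K` and `L` have the same cardinality. -/
def minorPoly {p q : ℕ} (K : Finset (Fin p)) (L : Finset (Fin q)) :
    MvPolynomial (Fin p × Fin q) Puiseux :=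
  if h : K.card = L.card then
    (Matrix.of fun (a b : Fin L.card) =>
      (MvPolynomial.X (K.orderEmbOfFin h a, L.orderEmbOfFin rfl b) :
        MvPolynomial (Fin p × Fin q) Puiseux)).det
  else 0

section Rule

variable {m n : ℕ}

/-- A set of rows of `A` as a set of rows of the stacked matrix. -/
def liftRows (I : Finset (Fin m)) : Finset (Fin (m + 2)) :=
  I.map (Fin.castAddEmb 2)

/-- `P_{I × ([n] ∖ J)}` -/
def basisPoly (I : Finset (Fin m)) (J : Finset (Fin n)) :
    MvPolynomial (Fin (m + 2) × Fin n) Puiseux :=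
  minorPoly (liftRows I) Jᶜ

/-- With `r` the row of `uᵀ` or `vᵀ`, the polynomials `P_{(I ∖ {i} ∪ {r}) × ([n] ∖ J)}` for `i ∈ I`,
and `P_{(I ∪ {r}) × (([n] ∖ J) ∪ {j})}` for `j ∈ J`. -/
def costPoly (r : Fin 2) (I : Finset (Fin m)) (J : Finset (Fin n)) :
    Fin m ⊕ Fin n → MvPolynomial (Fin (m + 2) × Fin n) Puiseux
  | .inl i => minorPoly (insert (Fin.natAdd m r) (liftRows (I.erase i))) Jᶜ
  | .inr j => minorPoly (insert (Fin.natAdd m r) (liftRows I)) (insert j Jᶜ)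

/-- The polynomials `Q_l`, for `l ∈ I ⊎ J`. -/
def polyQ (I : Finset (Fin m)) (J : Finset (Fin n)) (l : Fin m ⊕ Fin n) :
    MvPolynomial (Fin (m + 2) × Fin n) Puiseux :=
  costPoly 0 I J l

/-- The polynomials `R_l`, for `l ∈ I ⊎ J`. -/
def polyR (I : Finset (Fin m)) (J : Finset (Fin n)) (l : Fin m ⊕ Fin n) :
    MvPolynomial (Fin (m + 2) × Fin n) Puiseux :=
  costPoly 1 I J l

/-- The comparison polynomials `T_{kl} = Q_k R_l - Q_l R_k`. -/
def polyT (I : Finset (Fin m)) (J : Finset (Fin n)) (k l : Fin m ⊕ Fin n) :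
    MvPolynomial (Fin (m + 2) × Fin n) Puiseux :=
  polyQ I J k * polyR I J l - polyQ I J l * polyR I J k

/-- The sign `s_l`, characterized by `y_l = s_l Q_l / P_{I × ([n] ∖ J)}`, where `y` is the reduced
cost vector.  If `i` is the `p`-th element of `I`, then `s_i = (-1)^(|I| - p)`.  If `j` is the
`p`-th element of `([n] ∖ J) ∪ {j}`, then `s_j = (-1)^(|I| + 1 - p)`. -/
def costSign (I : Finset (Fin m)) (J : Finset (Fin n)) : Fin m ⊕ Fin n → SignType
  | .inl i => (-1) ^ (I.filter fun a => i < a).card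
  | .inr j => (-1) ^ (Jᶜ.filter fun b => j < b).card

/-! ### The classical shadow-vertex rule -/

/-- `y`, indexed by `I ⊎ J`, solves `(A'_{I ⊎ J})ᵀ y = w`, where `A'` is made of the rows of `A`
and of those of the identity matrix. -/
def IsReducedCost (A : Matrix (Fin m) (Fin n) Puiseux) (w : Fin n → Puiseux)
    (I : Finset (Fin m)) (J : Finset (Fin n)) (y : (I.disjSum J) → Puiseux) : Prop :=
  ((Matrix.fromRows A (1 : Matrix (Fin n) (Fin n) Puiseux)).submatrix
    (Subtype.val : (I.disjSum J) → Fin m ⊕ Fin n) id).transpose.mulVec y = w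

/-- The outcome of the shadow-vertex rule on reduced cost vectors `y` and `z`: `none` if no
coordinate is positive in both, and otherwise a coordinate, positive in both, that has the smallest
ratio `y_l / z_l` among those. -/
def IsRatioChoice {I : Finset (Fin m)} {J : Finset (Fin n)} (y z : (I.disjSum J) → Puiseux) :
    Option (Fin m ⊕ Fin n) → Prop
  | none => ∀ l, ¬ (0 < y l ∧ 0 < z l)
  | some k => ∃ hk : k ∈ I.disjSum J, 0 < y ⟨k, hk⟩ ∧ 0 < z ⟨k, hk⟩ ∧
      ∀ l, 0 < y l → 0 < z l → y ⟨k, hk⟩ / z ⟨k, hk⟩ ≤ y l / z l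

/-- `o` is the value at the basis `(I, J)` of the classical shadow-vertex rule with objective
vector `u` and co-objective vector `v`. -/
def IsShadowVertexValue (A : Matrix (Fin m) (Fin n) Puiseux) (u v : Fin n → Puiseux)
    (I : Finset (Fin m)) (J : Finset (Fin n)) (o : Option (Fin m ⊕ Fin n)) : Prop :=
  ∃ y z : (I.disjSum J) → Puiseux,
    IsReducedCost A u I J y ∧ IsReducedCost A v I J z ∧ IsRatioChoice y z o

/-! ### The tropical shadow-vertex rule -/

/-- `l` belongs to the set `Λ`, for the stacked tropical matrix `M`. -/
def TropCandidate (M : Matrix (Fin (m + 2)) (Fin n) SignedTrop) (I : Finset (Fin m))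
    (J : Finset (Fin n)) (l : Fin m ⊕ Fin n) : Prop :=
  l ∈ I.disjSum J ∧
    (tropEval (polyQ I J l) (entries M)).sign =
      costSign I J l * (tropEval (basisPoly I J) (entries M)).sign ∧
    (tropEval (polyR I J l) (entries M)).sign =
      costSign I J l * (tropEval (basisPoly I J) (entries M)).sign

/-- `o` is the value at the basis `(I, J)` of the tropical shadow-vertex rule: `none` if `Λ` is
empty, and otherwise an element of `Λ` that wins all comparisons. -/
def IsTropShadowVertexValue (A : Matrix (Fin m) (Fin n) SignedTrop) (u v : Fin n → SignedTrop)
    (I : Finset (Fin m)) (J : Finset (Fin n)) : Option (Fin m ⊕ Fin n) → Prop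
  | none => ∀ l, ¬ TropCandidate (stack A u v) I J l
  | some k => TropCandidate (stack A u v) I J k ∧
      ∀ l, TropCandidate (stack A u v) I J l → l ≠ k →
        (tropEval (polyT I J k l) (entries (stack A u v))).sign = -(costSign I J k * costSign I J l)

/-- The tropical polynomials that the tropical rule evaluates at the basis `(I, J)` do not vanish
on the stacked matrix, and there is exactly one value that satisfies the definition of the rule. -/
def TropRuleWellDefined (A : Matrix (Fin m) (Fin n) SignedTrop) (u v : Fin n → SignedTrop)
    (I : Finset (Fin m)) (J : Finset (Fin n)) : Prop :=
  ¬ TropVanishes (basisPoly I J) (entries (stack A u v)) ∧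
  (∀ l ∈ I.disjSum J, ¬ TropVanishes (polyQ I J l) (entries (stack A u v)) ∧
    ¬ TropVanishes (polyR I J l) (entries (stack A u v))) ∧
  (∀ k ∈ I.disjSum J, ∀ l ∈ I.disjSum J, k ≠ l →
    ¬ TropVanishes (polyT I J k l) (entries (stack A u v))) ∧
  ∃! o, IsTropShadowVertexValue A u v I J o

end Rule

/-! ### A random access machine over the real numbers

Programs are structured programs over registers and two-dimensional arrays, which hold natural
numbers (used for indices, flags and signs) or real numbers.  On natural numbers, the machine can
only copy, load constants, increment, decrement and compare; on real numbers, it can only copy, load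
zero, add, subtract and compare.  Every instruction and every evaluation of a test takes one step.
-/

/-- The memory: registers and two-dimensional arrays, each numbered by a natural number. -/
structure Memory where
  nat : ℕ → ℕ
  real : ℕ → ℝ
  natArr : ℕ → ℕ → ℕ → ℕ
  realArr : ℕ → ℕ → ℕ → ℝ

/-- Instructions; the arguments are numbers of registers, except for the constant `c` and the
number `a` of an array. -/
inductive Instr where
  | natConst (d c : ℕ)
  | natCopy (d s : ℕ)
  | natSucc (d s : ℕ)
  | natPred (d s : ℕ)
  | natLoad (d a i j : ℕ)
  | natStore (a i j s : ℕ)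
  | realZero (d : ℕ)
  | realCopy (d s : ℕ)
  | realAdd (d s t : ℕ)
  | realSub (d s t : ℕ)
  | realLoad (d a i j : ℕ)
  | realStore (a i j s : ℕ)

namespace Memory

/-- Assignment to a register of natural numbers. -/
def setNat (M : Memory) (d x : ℕ) : Memory :=
  { M with nat := Function.update M.nat d x }

/-- Assignment to a register of real numbers. -/
def setReal (M : Memory) (d : ℕ) (x : ℝ) : Memory :=
  { M with real := Function.update M.real d x }

/-- Assignment to an entry of an array of natural numbers. -/
def setNatArr (M : Memory) (a i j x : ℕ) : Memory :=
  { M with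
    natArr := Function.update M.natArr a
      (Function.update (M.natArr a) i (Function.update (M.natArr a i) j x)) }

/-- Assignment to an entry of an array of real numbers. -/
def setRealArr (M : Memory) (a i j : ℕ) (x : ℝ) : Memory :=
  { M with
    realArr := Function.update M.realArr a
      (Function.update (M.realArr a) i (Function.update (M.realArr a i) j x)) }

end Memory

/-- The effect of an instruction. -/
def Instr.run : Instr → Memory → Memory
  | .natConst d c, M => M.setNat d c
  | .natCopy d s, M => M.setNat d (M.nat s)
  | .natSucc d s, M => M.setNat d (M.nat s + 1)
  | .natPred d s, M => M.setNat d (M.nat s - 1)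
  | .natLoad d a i j, M => M.setNat d (M.natArr a (M.nat i) (M.nat j))
  | .natStore a i j s, M => M.setNatArr a (M.nat i) (M.nat j) (M.nat s)
  | .realZero d, M => M.setReal d 0
  | .realCopy d s, M => M.setReal d (M.real s)
  | .realAdd d s t, M => M.setReal d (M.real s + M.real t)
  | .realSub d s t, M => M.setReal d (M.real s - M.real t)
  | .realLoad d a i j, M => M.setReal d (M.realArr a (M.nat i) (M.nat j))
  | .realStore a i j s, M => M.setRealArr a (M.nat i) (M.nat j) (M.real s)

/-- Tests on the contents of two registers. -/
inductive Test where
  | natEq (i j : ℕ)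
  | natLt (i j : ℕ)
  | realLt (i j : ℕ)

/-- The test succeeds. -/
def Test.Holds : Test → Memory → Prop
  | .natEq i j, M => M.nat i = M.nat j
  | .natLt i j, M => M.nat i < M.nat j
  | .realLt i j, M => M.real i < M.real j

/-- Programs. -/
inductive Program where
  | skip
  | instr (c : Instr)
  | seq (p q : Program)
  | ite (b : Test) (p q : Program)
  | loop (b : Test) (p : Program)

/-- `Exec p M t M'`: started on the memory `M`, the program `p` halts after exactly `t` steps, with
the memory `M'`.  The program `loop b p` repeats `p` as long as `b` succeeds. -/
inductive Exec : Program → Memory → ℕ → Memory → Prop where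
  | skip (M : Memory) : Exec .skip M 1 M
  | instr (c : Instr) (M : Memory) : Exec (.instr c) M 1 (c.run M)
  | seq {p q : Program} {M M' M'' : Memory} {t t' : ℕ} :
      Exec p M t M' → Exec q M' t' M'' → Exec (.seq p q) M (t + t') M''
  | ite_pos {b : Test} {p q : Program} {M M' : Memory} {t : ℕ} :
      b.Holds M → Exec p M t M' → Exec (.ite b p q) M (t + 1) M'
  | ite_neg {b : Test} {p q : Program} {M M' : Memory} {t : ℕ} :
      ¬ b.Holds M → Exec q M t M' → Exec (.ite b p q) M (t + 1) M'
  | loop_pos {b : Test} {p : Program} {M M' M'' : Memory} {t t' : ℕ} :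
      b.Holds M → Exec p M t M' → Exec (.loop b p) M' t' M'' →
        Exec (.loop b p) M (t + t' + 1) M''
  | loop_neg {b : Test} {p : Program} {M : Memory} :
      ¬ b.Holds M → Exec (.loop b p) M 1 M

/-- The code of a sign: `0` for the tropical zero, `1` for positive and `2` for negative. -/
def signCode : SignType → ℕ
  | 0 => 0
  | 1 => 1
  | -1 => 2

/-- The `a`-th element of a set in increasing order, for `a < |S|` numbered from `0`. -/
def nthElement {p : ℕ} (S : Finset (Fin p)) (a : ℕ) : ℕ :=
  (S.sort.map Fin.val).getD a 0

/-- The input: registers `0, 1, 2, 3` contain `m`, `n`, `|I|`, `|J|`; the real array `0` contains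
the moduli of the entries of `M`, and the arrays `0, 1, 2` of natural numbers contain the signs of
these entries, the elements of `I` in increasing order, and those of `J` in increasing order.
Everything else is `0`. -/
def inputMemory {m n : ℕ} (M : Matrix (Fin (m + 2)) (Fin n) SignedTrop) (I : Finset (Fin m))
    (J : Finset (Fin n)) : Memory where
  nat r := if r = 0 then m else if r = 1 then n else if r = 2 then I.card
    else if r = 3 then J.card else 0
  real _ := 0
  natArr a i j :=
    if a = 0 then
      if h : i < m + 2 ∧ j < n then signCode (M ⟨i, h.1⟩ ⟨j, h.2⟩).sign else 0
    else if a = 1 ∧ i = 0 then nthElement I j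
    else if a = 2 ∧ i = 0 then nthElement J j
    else 0
  realArr a i j :=
    if a = 0 then
      if h : i < m + 2 ∧ j < n then (M ⟨i, h.1⟩ ⟨j, h.2⟩).modulus.unbotD 0 else 0
    else 0

/-- The result is read in registers `0` and `1`: the former contains `0` for `none`, `1` for a row
`i` and `2` for a column `j`, and the latter then contains the index `i` or `j`. -/
def Encodes {m n : ℕ} (M : Memory) : Option (Fin m ⊕ Fin n) → Prop
  | none => M.nat 0 = 0
  | some (.inl i) => M.nat 0 = 1 ∧ M.nat 1 = i
  | some (.inr j) => M.nat 0 = 2 ∧ M.nat 1 = j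

end

end TropShadow

open TropShadow

/-!
The tropical rule is the shadow of the classical one, for three reasons.

*Cramer's rule.*  Number the elements of `I ⊎ J` by positions, and let `D` be the determinant of the
matrix of the rows of `A` and of the identity matrix selected by the basis.  Let `D(k, l)` be the
determinant in which the rows `u` and `v` replace those at the positions `k` and `l` (`basisDet`).
Up to the explicit signs `s_k`, the polynomials `P`, `Q_k` and `R_k` are `D`, `D(k, -)` and
`D(-, k)`, and the reduced costs are `y_k = D(k, -) / D` and `z_k = D(-, k) / D`
(`isReducedCost_iff_eq`).  A Plücker relation, `D * D(k, l) = D(k, -) D(-, l) - D(l, -) D(-, k)`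
(`basisDet_plucker`), turns the comparison polynomial `T_{kl}`, and the comparison of the two
ratios, into the sign of the single minor `D(k, l)`.

*Genericity.*  If a square submatrix is generic, then the expansion of the corresponding determinant
over a lift has a single term of maximal valuation.  Hence the tropicalization does not vanish, and
the sign of the determinant is the sign of this term, for every lift (`IsLift.sign_det`).  A product
of two polynomials with such a dominant term has a dominant term too (`Dominant.mul`), which
covers `T_{kl}` by the Plücker relation.  So the tropical signs are the signs over any lift, the
two rules agree (`classicalRule_eq_tropicalRule`), and the outcome is the candidate with the
smallest ratio, which is unique since `D(k, l) ≠ 0` forbids ties.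

*The algorithm.*  By the above, the sign of `D(k, l)` needs only an optimal permutation of a matrix
of order at most `n`.  It is found by the Hungarian method (`hungarian_spec`), which makes
`O(n ^ 3)` steps: rows are matched one after the other, each by the growth of an alternating
tree in which every new column costs `O(n)`.  The sign of the optimal term is then the product of
the signs of the entries and of the signs of the inversions (`permSign_spec`).  A scan of the `n`
positions that keeps the best candidate so far evaluates at most three such determinants per
position, whence `O(n ^ 4)` steps in total (`shadowProgram_spec`).  Only the rows selected by `I`
and the last two are read, so that `m` does not matter.

Programs are treated by a calculus of total correctness with time bounds, `Terminates`, together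
with the fact that an execution changes only what the program writes, `Exec.frame`.
-/

namespace TropShadow

/-! ### The signed valuation -/

/-- The valuation of a Puiseux series, that is the modulus of its signed valuation. -/
noncomputable def val (x : Puiseux) : WithBot ℝ := (sval x).modulus

theorem SignedTrop.modulus_zero : SignedTrop.modulus 0 = ⊥ := rfl

theorem SignedTrop.modulus_mk (s : ℤˣ) (a : ℝ) : (SignedTrop.mk s a).modulus = a := rfl

theorem SignedTrop.sign_zero : SignedTrop.sign 0 = 0 := rfl

theorem SignedTrop.sign_mk (s : ℤˣ) (a : ℝ) :
    (SignedTrop.mk s a).sign = SignType.sign (s : ℤ) := rfl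

theorem SignedTrop.mk_ne_zero (s : ℤˣ) (a : ℝ) : SignedTrop.mk s a ≠ 0 := WithZero.coe_ne_zero

theorem SignedTrop.mk_mul_mk (s t : ℤˣ) (a b : ℝ) :
    SignedTrop.mk s a * SignedTrop.mk t b = SignedTrop.mk (s * t) (a + b) := rfl

theorem SignedTrop.exists_mk {x : SignedTrop} (h : x ≠ 0) : ∃ s a, x = SignedTrop.mk s a := by
  obtain ⟨p, rfl⟩ := WithZero.ne_zero_iff_exists.1 h
  exact ⟨p.1, Multiplicative.toAdd p.2, rfl⟩

theorem SignedTrop.modulus_eq_bot {x : SignedTrop} : x.modulus = ⊥ ↔ x = 0 := by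
  refine ⟨fun h => ?_, fun h => h ▸ rfl⟩
  by_contra h0
  obtain ⟨s, a, rfl⟩ := exists_mk h0
  simp [modulus_mk] at h

theorem SignedTrop.modulus_mul (x y : SignedTrop) :
    (x * y).modulus = x.modulus + y.modulus := by
  by_cases hx : x = 0
  · simp [hx, modulus_zero]
  by_cases hy : y = 0
  · simp [hy, modulus_zero]
  obtain ⟨s, a, rfl⟩ := exists_mk hx
  obtain ⟨t, b, rfl⟩ := exists_mk hy
  simp [mk_mul_mk, modulus_mk]

theorem SignedTrop.modulus_one : SignedTrop.modulus 1 = 0 := rfl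

theorem SignedTrop.modulus_prod {ι : Type*} (s : Finset ι) (f : ι → SignedTrop) :
    (∏ i ∈ s, f i).modulus = ∑ i ∈ s, (f i).modulus := by
  classical
  induction s using Finset.induction_on with
  | empty => simp [modulus_one]
  | insert a s ha ih => rw [Finset.prod_insert ha, Finset.sum_insert ha, modulus_mul, ih]

theorem SignedTrop.modulus_pow (x : SignedTrop) (k : ℕ) : (x ^ k).modulus = k • x.modulus := by
  induction k with
  | zero => simp [modulus_one]
  | succ k ih => rw [pow_succ, modulus_mul, ih, succ_nsmul]

theorem Puiseux.leadingCoeff_ne_zero {x : Puiseux} (h : x ≠ 0) :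
    (x : HahnSeries ℝᵒᵈ ℝ).leadingCoeff ≠ 0 :=
  HahnSeries.leadingCoeff_ne_zero.2 fun h0 => h (Subtype.ext h0)

theorem sval_zero : sval 0 = 0 := by simp [sval]

theorem sval_of_pos {x : Puiseux} (h : 0 < x) :
    sval x = SignedTrop.mk 1 (OrderDual.ofDual (x : HahnSeries ℝᵒᵈ ℝ).order) := by
  rw [sval, if_neg h.ne', if_pos h]

theorem sval_of_neg {x : Puiseux} (h : x < 0) :
    sval x = SignedTrop.mk (-1) (OrderDual.ofDual (x : HahnSeries ℝᵒᵈ ℝ).order) := by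
  rw [sval, if_neg h.ne, if_neg h.not_gt]

theorem sval_eq_zero {x : Puiseux} : sval x = 0 ↔ x = 0 := by
  refine ⟨fun h => ?_, fun h => h ▸ sval_zero⟩
  by_contra h0
  rw [sval, if_neg h0] at h
  exact SignedTrop.mk_ne_zero _ _ h

theorem sign_sval (x : Puiseux) : (sval x).sign = SignType.sign x := by
  rcases lt_trichotomy x 0 with h | h | h
  · rw [sval_of_neg h, SignedTrop.sign_mk, sign_neg h]; rfl
  · rw [h, sval_zero, sign_zero]; rfl
  · rw [sval_of_pos h, SignedTrop.sign_mk, sign_pos h]; rfl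

theorem sval_mul (x y : Puiseux) : sval (x * y) = sval x * sval y := by
  by_cases hx : x = 0
  · simp [hx, sval_zero]
  by_cases hy : y = 0
  · simp [hy, sval_zero]
  have ho : ((x * y : Puiseux) : HahnSeries ℝᵒᵈ ℝ).order =
      (x : HahnSeries ℝᵒᵈ ℝ).order + (y : HahnSeries ℝᵒᵈ ℝ).order :=
    HahnSeries.order_mul (fun h => hx (Subtype.ext h)) (fun h => hy (Subtype.ext h))
  rcases lt_or_gt_of_ne hx with h | h <;> rcases lt_or_gt_of_ne hy with h' | h'
  · rw [sval_of_pos (mul_pos_of_neg_of_neg h h'), sval_of_neg h, sval_of_neg h',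
      SignedTrop.mk_mul_mk, ho]; simp
  · rw [sval_of_neg (mul_neg_of_neg_of_pos h h'), sval_of_neg h, sval_of_pos h',
      SignedTrop.mk_mul_mk, ho]; simp
  · rw [sval_of_neg (mul_neg_of_pos_of_neg h h'), sval_of_pos h, sval_of_neg h',
      SignedTrop.mk_mul_mk, ho]; simp
  · rw [sval_of_pos (mul_pos h h'), sval_of_pos h, sval_of_pos h',
      SignedTrop.mk_mul_mk, ho]; simp

theorem sval_one : sval 1 = 1 := by
  rw [sval_of_pos one_pos]
  show SignedTrop.mk 1 (OrderDual.ofDual (1 : HahnSeries ℝᵒᵈ ℝ).order) = 1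
  rw [HahnSeries.order_one]; rfl

theorem sval_prod {ι : Type*} (s : Finset ι) (f : ι → Puiseux) :
    sval (∏ i ∈ s, f i) = ∏ i ∈ s, sval (f i) := by
  classical
  induction s using Finset.induction_on with
  | empty => simp [sval_one]
  | insert a s ha ih => rw [Finset.prod_insert ha, Finset.prod_insert ha, sval_mul, ih]

theorem sval_pow (x : Puiseux) (k : ℕ) : sval (x ^ k) = sval x ^ k := by
  induction k with
  | zero => simp [sval_one]
  | succ k ih => rw [pow_succ, sval_mul, ih, pow_succ]

theorem exists_sval_eq (x : SignedTrop) : ∃ X : Puiseux, sval X = x := by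
  by_cases hx : x = 0
  · exact ⟨0, by rw [hx, sval_zero]⟩
  obtain ⟨s, a, rfl⟩ := SignedTrop.exists_mk hx
  have key : ∀ r : ℝ, r ≠ 0 → ∃ X : Puiseux,
      (X : HahnSeries ℝᵒᵈ ℝ) = HahnSeries.single (OrderDual.toDual a) r :=
    fun r _ => ⟨⟨_, LocallyFinite.single _ r⟩, rfl⟩
  rcases Int.units_eq_one_or s with rfl | rfl
  · obtain ⟨X, hX⟩ := key 1 one_ne_zero
    refine ⟨X, ?_⟩
    have : 0 < X := by rw [Puiseux.pos_iff, hX, HahnSeries.leadingCoeff_of_single]; exact one_pos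
    rw [sval_of_pos this, hX, HahnSeries.order_single one_ne_zero]; rfl
  · obtain ⟨X, hX⟩ := key (-1) (by norm_num)
    refine ⟨X, ?_⟩
    have : X < 0 := by
      rw [Puiseux.lt_iff, zero_sub]
      show 0 < (-(X : HahnSeries ℝᵒᵈ ℝ)).leadingCoeff
      rw [HahnSeries.leadingCoeff_neg, hX, HahnSeries.leadingCoeff_of_single]; norm_num
    rw [sval_of_neg this, hX, HahnSeries.order_single (by norm_num)]; rfl

theorem val_zero : val 0 = ⊥ := by rw [val, sval_zero]; rfl

theorem val_of_ne {x : Puiseux} (h : x ≠ 0) :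
    val x = (OrderDual.ofDual (x : HahnSeries ℝᵒᵈ ℝ).order : ℝ) := by
  rw [val, sval, if_neg h]; rfl

theorem val_eq_bot {x : Puiseux} : val x = ⊥ ↔ x = 0 :=
  SignedTrop.modulus_eq_bot.trans sval_eq_zero

theorem val_mul (x y : Puiseux) : val (x * y) = val x + val y := by
  rw [val, sval_mul, SignedTrop.modulus_mul]; rfl

theorem val_lt_val {x y : Puiseux} : val x < val y ↔
    (y : HahnSeries ℝᵒᵈ ℝ).orderTop < (x : HahnSeries ℝᵒᵈ ℝ).orderTop := by
  by_cases hx : x = 0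
  · subst hx
    by_cases hy : y = 0
    · subst hy; simp
    · rw [val_zero, val_of_ne hy]
      simp [hy, lt_top_iff_ne_top]
  by_cases hy : y = 0
  · subst hy
    rw [val_zero]; simp
  rw [val_of_ne hx, val_of_ne hy, WithBot.coe_lt_coe,
    ← HahnSeries.order_eq_orderTop_of_ne_zero (fun h => hx (Subtype.ext h)),
    ← HahnSeries.order_eq_orderTop_of_ne_zero (fun h => hy (Subtype.ext h)), WithTop.coe_lt_coe]
  exact Iff.rfl

/-- The leading term of the larger summand is not cancelled. -/
theorem sval_add_of_lt {x y : Puiseux} (h : val y < val x) : sval (x + y) = sval x := by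
  have h1 := val_lt_val.1 h
  have hx : x ≠ 0 := by rintro rfl; simp [val_zero] at h
  have hl : ((x + y : Puiseux) : HahnSeries ℝᵒᵈ ℝ).leadingCoeff =
      (x : HahnSeries ℝᵒᵈ ℝ).leadingCoeff := HahnSeries.leadingCoeff_add_eq_left h1
  have hxy : x + y ≠ 0 := by
    intro h0
    rw [h0] at hl
    exact Puiseux.leadingCoeff_ne_zero hx (by rw [← hl]; simp)
  have ho : ((x + y : Puiseux) : HahnSeries ℝᵒᵈ ℝ).order = (x : HahnSeries ℝᵒᵈ ℝ).order := by
    have h2 : ((x + y : Puiseux) : HahnSeries ℝᵒᵈ ℝ).orderTop =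
      (x : HahnSeries ℝᵒᵈ ℝ).orderTop := HahnSeries.orderTop_add_eq_left h1
    rw [← HahnSeries.order_eq_orderTop_of_ne_zero (fun h => hx (Subtype.ext h)),
      ← HahnSeries.order_eq_orderTop_of_ne_zero (fun h => hxy (Subtype.ext h))] at h2
    exact WithTop.coe_injective h2
  have hp : 0 < x + y ↔ 0 < x := by rw [Puiseux.pos_iff, Puiseux.pos_iff, hl]
  rw [sval, sval, if_neg hx, if_neg hxy, ho]
  simp only [hp]

theorem val_add_lt {x y : Puiseux} {c : WithBot ℝ} (hx : val x < c) (hy : val y < c) :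
    val (x + y) < c := by
  rcases lt_trichotomy (val x) (val y) with h | h | h
  · rw [val, add_comm, sval_add_of_lt h]; exact hy
  · by_contra h2
    have h3 : val x < val (x + y) := hx.trans_le (not_lt.1 h2)
    have h4 : val y < val (x + y) := h ▸ h3
    have h5 : min (x : HahnSeries ℝᵒᵈ ℝ).orderTop (y : HahnSeries ℝᵒᵈ ℝ).orderTop ≤
      ((x + y : Puiseux) : HahnSeries ℝᵒᵈ ℝ).orderTop := HahnSeries.min_orderTop_le_orderTop_add
    exact absurd h5 (not_le.2 (lt_min (val_lt_val.1 h3) (val_lt_val.1 h4)))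
  · rw [val, sval_add_of_lt h]; exact hx

theorem val_sum_lt {ι : Type*} {s : Finset ι} {f : ι → Puiseux} {c : WithBot ℝ} (hc : ⊥ < c)
    (h : ∀ i ∈ s, val (f i) < c) : val (∑ i ∈ s, f i) < c := by
  classical
  induction s using Finset.induction_on with
  | empty => simpa [val_zero] using hc
  | insert a s ha ih =>
    rw [Finset.sum_insert ha]
    exact val_add_lt (h a (by simp)) (ih fun i hi => h i (by simp [hi]))

/-- A sum with a single term of maximal valuation has the signed valuation of this term. -/
theorem sval_sum_eq {ι : Type*} {s : Finset ι} {f : ι → Puiseux} {a : ι}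
    (ha : a ∈ s) (h0 : f a ≠ 0) (h : ∀ i ∈ s, i ≠ a → val (f i) < val (f a)) :
    sval (∑ i ∈ s, f i) = sval (f a) := by
  classical
  rw [← Finset.add_sum_erase s f ha]
  refine sval_add_of_lt (val_sum_lt ?_ fun i hi => ?_)
  · exact bot_lt_iff_ne_bot.2 fun hb => h0 (val_eq_bot.1 hb)
  · exact h i (Finset.mem_of_mem_erase hi) (Finset.ne_of_mem_erase hi)

theorem val_neg (x : Puiseux) : val (-x) = val x := by
  by_cases hx : x = 0
  · simp [hx]
  rw [val_of_ne hx, val_of_ne (neg_ne_zero.2 hx)]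
  show ((OrderDual.ofDual (-(x : HahnSeries ℝᵒᵈ ℝ)).order : ℝ) : WithBot ℝ) = _
  rw [HahnSeries.order_neg]

theorem val_one : val 1 = 0 := by rw [val, sval_one]; rfl

theorem val_intUnit (s : ℤˣ) : val ((s : ℤ) : Puiseux) = 0 := by
  rcases Int.units_eq_one_or s with rfl | rfl
  · simp [val_one]
  · simp [val_neg, val_one]

/-! ### Tropical polynomials with a dominant monomial -/

section Dominant

variable {ι : Type*} [Fintype ι]

/-- The value at the point `X` of the monomial of exponent `α` of `P`. -/
noncomputable def termAt (P : MvPolynomial ι Puiseux) (X : ι → Puiseux) (α : ι →₀ ℕ) : Puiseux :=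
  P.coeff α * ∏ i, X i ^ α i

/-- At the point `X`, the monomial of exponent `α` of `P` is nonzero, and its valuation is larger
than that of any other monomial of `P`. -/
def Dominant (P : MvPolynomial ι Puiseux) (X : ι → Puiseux) (α : ι →₀ ℕ) : Prop :=
  termAt P X α ≠ 0 ∧ ∀ β, β ≠ α → val (termAt P X β) < val (termAt P X α)

theorem sval_termAt {P : MvPolynomial ι Puiseux} {X : ι → Puiseux} {x : ι → SignedTrop}
    (hX : ∀ i, sval (X i) = x i) (α : ι →₀ ℕ) : sval (termAt P X α) = tropTerm P x α := by
  simp only [termAt, sval_mul, sval_prod, sval_pow, hX, tropTerm]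

theorem val_termAt {P : MvPolynomial ι Puiseux} {X : ι → Puiseux} {x : ι → SignedTrop}
    (hX : ∀ i, sval (X i) = x i) (α : ι →₀ ℕ) :
    val (termAt P X α) = tropTermModulus P x α := by
  rw [val, sval_termAt hX, tropTerm, SignedTrop.modulus_mul, SignedTrop.modulus_prod,
    tropTermModulus]
  simp only [SignedTrop.modulus_pow]

/-- The tropicalization does not vanish at a point if and only if the polynomial has a dominant
monomial at a lift of this point. -/
theorem not_tropVanishes_iff {P : MvPolynomial ι Puiseux} {X : ι → Puiseux} {x : ι → SignedTrop}
    (hX : ∀ i, sval (X i) = x i) : ¬ TropVanishes P x ↔ ∃ α, Dominant P X α := by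
  constructor
  · intro h
    obtain ⟨α, hα, hm⟩ := exists_max_of_not_tropVanishes h
    have h' := h
    simp only [TropVanishes, not_or] at h'
    have hne : termAt P X α ≠ 0 := by
      intro h0
      exact h'.1 (by rw [← hm, ← val_termAt hX, h0, val_zero])
    refine ⟨α, hne, fun β hβ => ?_⟩
    by_cases hs : β ∈ P.support
    · rw [val_termAt hX, val_termAt hX, hm]
      refine lt_of_le_of_ne (Finset.le_sup (f := tropTermModulus P x) hs) fun he => ?_
      exact h'.2 ⟨α, hα, β, hs, hβ.symm, hm, he⟩
    · have : termAt P X β = 0 := by rw [termAt, MvPolynomial.notMem_support_iff.1 hs, zero_mul]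
      rw [this, val_zero]
      exact bot_lt_iff_ne_bot.2 fun hb => hne (val_eq_bot.1 hb)
  · rintro ⟨α, hne, hα⟩
    have hs : α ∈ P.support := by
      rw [MvPolynomial.mem_support_iff]
      intro h0
      exact hne (by rw [termAt, h0, zero_mul])
    have hm : tropModulus P x = tropTermModulus P x α := by
      refine le_antisymm (Finset.sup_le fun β _ => ?_)
        (Finset.le_sup (f := tropTermModulus P x) hs)
      by_cases hβ : β = α
      · rw [hβ]
      · rw [← val_termAt hX, ← val_termAt hX]; exact (hα β hβ).le
    rintro (h | ⟨β, _, γ, _, hβγ, h1, h2⟩)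
    · rw [hm, ← val_termAt hX] at h
      exact hne (val_eq_bot.1 h)
    · rw [hm, ← val_termAt hX, ← val_termAt hX] at h1 h2
      by_cases hb : β = α
      · exact (hα γ (fun hg => hβγ (hb.trans hg.symm))).ne h2
      · exact (hα β hb).ne h1

/-- If the tropicalization of `P` does not vanish at `x`, then its value is the signed valuation of
the value of `P` at any lift of `x`. -/
theorem sval_eval_eq_tropEval {P : MvPolynomial ι Puiseux} {X : ι → Puiseux}
    {x : ι → SignedTrop} (hX : ∀ i, sval (X i) = x i) (h : ¬ TropVanishes P x) :
    sval (MvPolynomial.eval X P) = tropEval P x := by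
  have hspec := Classical.choose_spec (exists_max_of_not_tropVanishes h)
  rw [tropEval, dif_neg h]
  set α := Classical.choose (exists_max_of_not_tropVanishes h) with hαdef
  obtain ⟨β, hβ0, hβ⟩ := (not_tropVanishes_iff hX).1 h
  have hβs : β ∈ P.support := by
    rw [MvPolynomial.mem_support_iff]
    intro h0
    exact hβ0 (by rw [termAt, h0, zero_mul])
  have hαβ : α = β := by
    by_contra hne
    have h1 := hβ α hne
    rw [val_termAt hX, val_termAt hX, hspec.2] at h1
    exact absurd (Finset.le_sup (f := tropTermModulus P x) hβs) (not_le.2 h1)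
  rw [hαβ, MvPolynomial.eval_eq', ← sval_termAt hX]
  exact sval_sum_eq (f := termAt P X) hβs hβ0 fun i _ hi => hβ i hi

theorem withBot_add_lt_add_of_lt_of_le {a b c d : WithBot ℝ} (hd : d ≠ ⊥) (h1 : a < c)
    (h2 : b ≤ d) : a + b < c + d := by
  lift d to ℝ using hd
  have hc : c ≠ ⊥ := (bot_le.trans_lt h1).ne'
  lift c to ℝ using hc
  induction a with
  | bot => simp only [WithBot.bot_add, ← WithBot.coe_add]; exact WithBot.bot_lt_coe _
  | coe a =>
    induction b with
    | bot => simp only [WithBot.add_bot, ← WithBot.coe_add]; exact WithBot.bot_lt_coe _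
    | coe b => norm_cast at *; linarith

/-- The product of the dominant monomials is dominant in the product. -/
theorem Dominant.mul {P Q : MvPolynomial ι Puiseux} {X : ι → Puiseux} {α β : ι →₀ ℕ}
    (hP : Dominant P X α) (hQ : Dominant Q X β) : Dominant (P * Q) X (α + β) := by
  classical
  have hterm : ∀ γ, termAt (P * Q) X γ =
      ∑ p ∈ Finset.HasAntidiagonal.antidiagonal γ, termAt P X p.1 * termAt Q X p.2 := by
    intro γ
    rw [termAt, MvPolynomial.coeff_mul, Finset.sum_mul]
    refine Finset.sum_congr rfl fun p hp => ?_
    have : ∏ i, X i ^ γ i = (∏ i, X i ^ p.1 i) * ∏ i, X i ^ p.2 i := by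
      rw [← Finset.prod_mul_distrib]
      refine Finset.prod_congr rfl fun i _ => ?_
      rw [← pow_add, ← Finset.HasAntidiagonal.mem_antidiagonal.1 hp]; rfl
    rw [this, termAt, termAt]; ring
  have hlt : ∀ p : (ι →₀ ℕ) × (ι →₀ ℕ), p ≠ (α, β) →
      val (termAt P X p.1 * termAt Q X p.2) < val (termAt P X α * termAt Q X β) := by
    rintro ⟨p, q⟩ hpq
    rw [val_mul, val_mul]
    have hp0 : val (termAt P X α) ≠ ⊥ := fun h => hP.1 (val_eq_bot.1 h)
    have hq0 : val (termAt Q X β) ≠ ⊥ := fun h => hQ.1 (val_eq_bot.1 h)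
    by_cases hp : p = α
    · have hq : q ≠ β := fun hq => hpq (by rw [hp, hq])
      rw [add_comm, add_comm (val (termAt P X α))]
      exact withBot_add_lt_add_of_lt_of_le hp0 (hQ.2 q hq) (by rw [hp])
    · refine withBot_add_lt_add_of_lt_of_le hq0 (hP.2 p hp) ?_
      by_cases hq : q = β
      · rw [hq]
      · exact (hQ.2 q hq).le
  have h0 := mul_ne_zero hP.1 hQ.1
  have hs : sval (termAt (P * Q) X (α + β)) = sval (termAt P X α * termAt Q X β) := by
    rw [hterm]
    exact sval_sum_eq (f := fun p : (ι →₀ ℕ) × (ι →₀ ℕ) => termAt P X p.1 * termAt Q X p.2)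
      (a := (α, β)) (Finset.HasAntidiagonal.mem_antidiagonal.2 rfl) h0 fun p _ hp => hlt p hp
  refine ⟨fun h => h0 (sval_eq_zero.1 (by rw [← hs, h, sval_zero])), fun γ hγ => ?_⟩
  rw [val, val, hs, hterm]
  refine val_sum_lt (bot_lt_iff_ne_bot.2 fun hb => h0 (val_eq_bot.1 hb)) fun p hp => hlt p ?_
  rintro rfl
  exact hγ (Finset.HasAntidiagonal.mem_antidiagonal.1 hp).symm

theorem Dominant.neg {P : MvPolynomial ι Puiseux} {X : ι → Puiseux} {α : ι →₀ ℕ}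
    (hP : Dominant P X α) : Dominant (-P) X α := by
  have h : ∀ β, termAt (-P) X β = -termAt P X β := fun β => by
    rw [termAt, MvPolynomial.coeff_neg, termAt]; ring
  refine ⟨by rw [h]; exact neg_ne_zero.2 hP.1, fun β hβ => ?_⟩
  rw [h, h, val_neg, val_neg]; exact hP.2 β hβ

theorem Dominant.intUnit_mul {P : MvPolynomial ι Puiseux} {X : ι → Puiseux} {α : ι →₀ ℕ}
    (hP : Dominant P X α) (s : ℤˣ) : Dominant (((s : ℤ) : MvPolynomial ι Puiseux) * P) X α := by
  rcases Int.units_eq_one_or s with rfl | rfl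
  · simpa using hP
  · convert hP.neg using 1
    rw [Units.val_neg, Units.val_one, Int.cast_neg, Int.cast_one]
    exact neg_one_mul P

end Dominant

/-! ### Generic matrices -/

theorem Generic.exists_unique_max {k : ℕ} {B : Matrix (Fin k) (Fin k) SignedTrop}
    (h : Generic B) : ∃ π, permWeight B π ≠ ⊥ ∧ ∀ ρ, ρ ≠ π → permWeight B ρ < permWeight B π := by
  obtain ⟨h0, π, hπ, hu⟩ := h
  refine ⟨π, by rwa [hπ], fun ρ hρ => ?_⟩
  rw [hπ]
  exact lt_of_le_of_ne (Finset.le_sup (f := permWeight B) (Finset.mem_univ ρ))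
    fun he => hρ (hu ρ he)

theorem permWeight_submatrix {k : ℕ} (B : Matrix (Fin k) (Fin k) SignedTrop)
    (σ τ π : Equiv.Perm (Fin k)) :
    permWeight (B.submatrix σ τ) π = permWeight B (τ * π * σ⁻¹) := by
  unfold permWeight
  rw [← Equiv.sum_comp σ fun i => (B i ((τ * π * σ⁻¹) i)).modulus]
  simp

/-- In a strongly non-degenerate matrix, a square submatrix is generic whatever the order of its
rows and columns. -/
theorem StronglyNonDegenerate.exists_unique_max {p q : ℕ} {M : Matrix (Fin p) (Fin q) SignedTrop}
    (hM : StronglyNonDegenerate M) {k : ℕ} {r : Fin k → Fin p} {c : Fin k → Fin q}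
    (hr : Function.Injective r) (hc : Function.Injective c) :
    ∃ π, permWeight (M.submatrix r c) π ≠ ⊥ ∧
      ∀ ρ, ρ ≠ π → permWeight (M.submatrix r c) ρ < permWeight (M.submatrix r c) π := by
  set σ := Tuple.sort r
  set τ := Tuple.sort c
  have hr' : StrictMono (r ∘ σ) :=
    (Tuple.monotone_sort r).strictMono_of_injective (hr.comp σ.injective)
  have hc' : StrictMono (c ∘ τ) :=
    (Tuple.monotone_sort c).strictMono_of_injective (hc.comp τ.injective)
  obtain ⟨π, hπ, hu⟩ := (hM k (OrderEmbedding.ofStrictMono _ hr')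
    (OrderEmbedding.ofStrictMono _ hc')).exists_unique_max
  have he : M.submatrix (OrderEmbedding.ofStrictMono _ hr') (OrderEmbedding.ofStrictMono _ hc') =
      (M.submatrix r c).submatrix σ τ := rfl
  rw [he] at hπ hu
  simp only [permWeight_submatrix] at hπ hu
  refine ⟨τ * π * σ⁻¹, hπ, fun ρ hρ => ?_⟩
  have h := hu (τ⁻¹ * ρ * σ) (fun h => hρ (by rw [← h]; group))
  have : τ * (τ⁻¹ * ρ * σ) * σ⁻¹ = ρ := by group
  rwa [this] at h

theorem StronglyNonDegenerate.ne_zero {p q : ℕ} {M : Matrix (Fin p) (Fin q) SignedTrop}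
    (hM : StronglyNonDegenerate M) (i : Fin p) (j : Fin q) : M i j ≠ 0 := by
  obtain ⟨π, h, -⟩ := hM.exists_unique_max (r := fun _ : Fin 1 => i) (c := fun _ : Fin 1 => j)
    (Function.injective_of_subsingleton _) (Function.injective_of_subsingleton _)
  intro h0
  exact h (by simp [permWeight, h0, SignedTrop.modulus_zero])

/-! ### Lifts of matrices and determinants -/

/-- `N` is a lift of `M`. -/
def IsLift {p q : ℕ} (N : Matrix (Fin p) (Fin q) Puiseux) (M : Matrix (Fin p) (Fin q) SignedTrop) :
    Prop := ∀ i j, sval (N i j) = M i j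

theorem IsLift.val_prod {p q : ℕ} {N : Matrix (Fin p) (Fin q) Puiseux}
    {M : Matrix (Fin p) (Fin q) SignedTrop} (h : IsLift N M) {k : ℕ} (r : Fin k → Fin p)
    (c : Fin k → Fin q) (s : ℤˣ) (σ : Equiv.Perm (Fin k)) :
    val (((s : ℤ) : Puiseux) * ∏ i, N (r i) (c (σ i))) = permWeight (M.submatrix r c) σ := by
  rw [val_mul, val_intUnit, zero_add, val, sval_prod, SignedTrop.modulus_prod]
  simp only [h _ _]; rfl

theorem det_eq_sum {R : Type*} [CommRing R] {k : ℕ} (B : Matrix (Fin k) (Fin k) R) :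
    B.det = ∑ σ : Equiv.Perm (Fin k), ((Equiv.Perm.sign σ : ℤ) : R) * ∏ i, B i (σ i) := by
  rw [← Matrix.det_transpose, Matrix.det_apply']; rfl

/-- The sign of a minor of a lift, read on the optimal permutation of the tropical minor. -/
theorem IsLift.sign_det {p q : ℕ} {N : Matrix (Fin p) (Fin q) Puiseux}
    {M : Matrix (Fin p) (Fin q) SignedTrop} (h : IsLift N M) {k : ℕ} (r : Fin k → Fin p)
    (c : Fin k → Fin q) (π : Equiv.Perm (Fin k)) (h0 : permWeight (M.submatrix r c) π ≠ ⊥)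
    (hu : ∀ ρ, ρ ≠ π → permWeight (M.submatrix r c) ρ < permWeight (M.submatrix r c) π) :
    SignType.sign (N.submatrix r c).det =
      SignType.sign (Equiv.Perm.sign π : ℤ) * ∏ i, (M (r i) (c (π i))).sign := by
  have hv := fun σ => h.val_prod r c (Equiv.Perm.sign σ) σ
  have hs : sval (N.submatrix r c).det =
      sval (((Equiv.Perm.sign π : ℤ) : Puiseux) * ∏ i, N (r i) (c (π i))) := by
    rw [det_eq_sum]
    refine sval_sum_eq (f := fun σ : Equiv.Perm (Fin k) =>
      ((Equiv.Perm.sign σ : ℤ) : Puiseux) * ∏ i, N (r i) (c (σ i))) (Finset.mem_univ π) ?_ ?_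
    · intro hz
      exact h0 (by rw [← hv, hz, val_zero])
    · intro σ _ hσ
      rw [hv, hv]; exact hu σ hσ
  have hp : ∀ (s : Finset (Fin k)), SignType.sign (∏ i ∈ s, N (r i) (c (π i))) =
      ∏ i ∈ s, (M (r i) (c (π i))).sign := by
    intro s
    induction s using Finset.induction_on with
    | empty => simp
    | insert a s ha ih =>
      rw [Finset.prod_insert ha, Finset.prod_insert ha, sign_mul, ih, ← sign_sval, h]
  rw [← sign_sval, hs, sign_sval, sign_mul, hp]
  congr 1
  rcases Int.units_eq_one_or (Equiv.Perm.sign π) with h | h <;> simp [h]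

theorem IsLift.det_ne_zero {p q : ℕ} {N : Matrix (Fin p) (Fin q) Puiseux}
    {M : Matrix (Fin p) (Fin q) SignedTrop} (h : IsLift N M) (hM : StronglyNonDegenerate M)
    {k : ℕ} {r : Fin k → Fin p} {c : Fin k → Fin q} (hr : Function.Injective r)
    (hc : Function.Injective c) : (N.submatrix r c).det ≠ 0 := by
  obtain ⟨π, h0, hu⟩ := hM.exists_unique_max hr hc
  rw [← sign_ne_zero, h.sign_det r c π h0 hu]
  refine mul_ne_zero (by simp) (Finset.prod_ne_zero_iff.2 fun i _ => ?_)
  rw [← h, sign_sval]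
  exact sign_ne_zero.2 fun hz => hM.ne_zero (r i) (c (π i)) (by rw [← h, hz, sval_zero])

/-- The matrix of variables. -/
noncomputable def varMatrix (p q : ℕ) :
    Matrix (Fin p) (Fin q) (MvPolynomial (Fin p × Fin q) Puiseux) :=
  Matrix.of fun i j => MvPolynomial.X (i, j)

/-- A minor of the matrix of variables of a strongly non-degenerate matrix has a dominant
monomial, given by the optimal permutation. -/
theorem exists_dominant_det {p q : ℕ} {N : Matrix (Fin p) (Fin q) Puiseux}
    {M : Matrix (Fin p) (Fin q) SignedTrop} (h : IsLift N M) (hM : StronglyNonDegenerate M)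
    {k : ℕ} {r : Fin k → Fin p} {c : Fin k → Fin q} (hr : Function.Injective r)
    (hc : Function.Injective c) :
    ∃ α, Dominant ((varMatrix p q).submatrix r c).det (entries N) α := by
  classical
  obtain ⟨π, h0, hu⟩ := hM.exists_unique_max hr hc
  let e : Equiv.Perm (Fin k) → (Fin p × Fin q →₀ ℕ) :=
    fun σ => ∑ i, Finsupp.single (r i, c (σ i)) 1
  have he : ∀ σ (a b : Fin k), e σ (r a, c b) = if σ a = b then 1 else 0 := by
    intro σ a b
    simp only [e, Finsupp.finsetSum_apply, Finsupp.single_apply, Prod.mk.injEq, hr.eq_iff,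
      hc.eq_iff]
    rw [Finset.sum_eq_single a]
    · simp
    · intro i _ hi; simp [hi]
    · simp
  have hinj : Function.Injective e := by
    intro σ τ hστ
    ext1 a
    have := he τ a (σ a)
    rw [← hστ, he] at this
    by_contra hne
    simp [Ne.symm hne] at this
  have hmono : ∀ σ, ∏ i, (varMatrix p q).submatrix r c i (σ i) =
      MvPolynomial.monomial (e σ) (1 : Puiseux) := by
    intro σ
    simp only [e, varMatrix, Matrix.submatrix_apply, Matrix.of_apply, MvPolynomial.X]
    rw [MvPolynomial.monomial_sum_one]
  have hdet : ((varMatrix p q).submatrix r c).det =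
      ∑ σ : Equiv.Perm (Fin k),
        MvPolynomial.monomial (e σ) ((Equiv.Perm.sign σ : ℤ) : Puiseux) := by
    rw [det_eq_sum]
    refine Finset.sum_congr rfl fun σ _ => ?_
    rw [hmono, ← map_intCast (MvPolynomial.C : Puiseux →+* MvPolynomial (Fin p × Fin q) Puiseux),
      MvPolynomial.C_mul_monomial, mul_one]
  have hcoeff : ∀ σ, ((varMatrix p q).submatrix r c).det.coeff (e σ) =
      ((Equiv.Perm.sign σ : ℤ) : Puiseux) := by
    intro σ
    rw [hdet, MvPolynomial.coeff_sum, Finset.sum_eq_single σ]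
    · simp
    · intro τ _ hτ
      rw [MvPolynomial.coeff_monomial, if_neg (fun h => hτ (hinj h))]
    · simp
  have hcoeff0 : ∀ β, (∀ σ, e σ ≠ β) → ((varMatrix p q).submatrix r c).det.coeff β = 0 := by
    intro β hβ
    rw [hdet, MvPolynomial.coeff_sum]
    exact Finset.sum_eq_zero fun σ _ => by rw [MvPolynomial.coeff_monomial, if_neg (hβ σ)]
  have hterm : ∀ σ, val (termAt ((varMatrix p q).submatrix r c).det (entries N) (e σ)) =
      permWeight (M.submatrix r c) σ := by
    intro σ
    rw [← h.val_prod r c (Equiv.Perm.sign σ) σ, termAt, hcoeff]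
    congr 2
    have : ∏ i, entries N i ^ (e σ) i = MvPolynomial.eval (entries N)
        (MvPolynomial.monomial (e σ) (1 : Puiseux)) := by
      rw [MvPolynomial.eval_monomial, one_mul, Finsupp.prod_fintype]; simp
    rw [this, ← hmono, map_prod]
    simp [varMatrix, entries]
  refine ⟨e π, fun hz => h0 (by rw [← hterm, hz, val_zero]), fun β hβ => ?_⟩
  by_cases hex : ∃ σ, e σ = β
  · obtain ⟨σ, rfl⟩ := hex
    rw [hterm, hterm]
    exact hu σ fun h => hβ (by rw [h])
  · rw [termAt, hcoeff0 β (fun σ hσ => hex ⟨σ, hσ⟩), zero_mul, val_zero, hterm]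
    exact bot_lt_iff_ne_bot.2 h0

/-! ### Determinant identities -/

section Determinants

variable {R : Type*} [CommRing R] {ι : Type*} [Fintype ι] [DecidableEq ι]

/-- Cramer's rule: `det B • u` is the combination of the rows of `B` whose coefficients are the
determinants in which `u` replaces a row of `B`. -/
theorem det_smul_eq_sum_updateRow (B : Matrix ι ι R) (u : ι → R) :
    B.det • u = ∑ q, (B.updateRow q u).det • B q := by
  have h := Matrix.mulVec_cramer B.transpose u
  rw [Matrix.det_transpose] at h
  rw [← h]
  ext c
  simp [Matrix.mulVec, dotProduct, Matrix.cramer_transpose_apply, mul_comm]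

/-- A three-term Plücker relation. -/
theorem det_mul_det_updateRow_updateRow (B : Matrix ι ι R) {k l : ι} (hkl : k ≠ l) (u v : ι → R) :
    B.det * ((B.updateRow k u).updateRow l v).det =
      (B.updateRow k u).det * (B.updateRow l v).det -
        (B.updateRow l u).det * (B.updateRow k v).det := by
  have hcomm : ∀ w, (B.updateRow k w).updateRow l v = (B.updateRow l v).updateRow k w :=
    fun w => Matrix.updateRow_comm _ hkl _ _
  have hsum : ∀ f : ι → R, ((B.updateRow l v).updateRow k (∑ q, f q • B q)).det =
      ∑ q, f q * ((B.updateRow l v).updateRow k (B q)).det := by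
    intro f
    let g : (ι → R) →ₗ[R] R :=
      { toFun := fun w => ((B.updateRow l v).updateRow k w).det
        map_add' := fun w w' => Matrix.det_updateRow_add _ _ _ _
        map_smul' := fun c w => Matrix.det_updateRow_smul _ _ _ _ }
    have := map_sum g (fun q => f q • B q) Finset.univ
    simp only [map_smul, smul_eq_mul] at this
    exact this
  have h := hsum fun q => (B.updateRow q u).det
  rw [← det_smul_eq_sum_updateRow] at h
  rw [hcomm, ← Matrix.det_updateRow_smul, h, Finset.sum_eq_add k l hkl, sub_eq_add_neg]
  · congr 1
    · rw [← hcomm, Matrix.updateRow_eq_self]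
    · have hswap : (B.updateRow l v).updateRow k (B l) =
          (B.updateRow k v).submatrix (Equiv.swap k l) id := by
        ext a b
        simp only [Matrix.submatrix_apply, id, Matrix.updateRow_apply, Equiv.swap_apply_def]
        split_ifs <;> simp_all
      rw [hswap, Matrix.det_permute, Equiv.Perm.sign_swap hkl]
      simp
  · intro q _ hq
    refine mul_eq_zero_of_right _ (Matrix.det_zero_of_row_eq hq.1 ?_)
    ext b
    simp [Matrix.updateRow_apply, hq.1, hq.2]
  · simp
  · simp

/-- If the rows whose indices do not belong to the range of `e` are those of the identity matrix,
then the determinant is the principal minor supported by the range of `e`. -/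
theorem det_eq_det_submatrix_of_identity_rows {k : ℕ} (B : Matrix ι ι R) {e : Fin k → ι}
    (he : Function.Injective e)
    (hB : ∀ q, q ∉ Set.range e → B q = (1 : Matrix ι ι R) q) :
    B.det = (B.submatrix e e).det := by
  classical
  rw [Matrix.twoBlockTriangular_det B (· ∈ Set.range e)]
  · have h1 : B.toSquareBlockProp (fun i => i ∉ Set.range e) = 1 := by
      ext ⟨i, hi⟩ ⟨j, hj⟩
      rw [Matrix.toSquareBlockProp_def, Matrix.of_apply, hB i hi, Matrix.one_apply,
        Matrix.one_apply]
      simp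
    rw [h1, Matrix.det_one, mul_one]
    have h2 := Matrix.det_submatrix_equiv_self (Equiv.ofInjective e he)
      (B.toSquareBlockProp (· ∈ Set.range e))
    convert h2.symm
    rfl
  · intro i hi j hj
    rw [hB i hi, Matrix.one_apply_ne]
    rintro rfl
    exact hi hj

/-- Up to sign, the position at which a row is inserted does not matter. -/
theorem det_insertNth {ρ κ : Type*} (X : Matrix ρ κ R) {p : ℕ} (a : Fin (p + 1)) (x : ρ)
    (f : Fin p → ρ) (c : Fin (p + 1) → κ) :
    (X.submatrix (a.insertNth (α := fun _ => ρ) x f) c).det =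
      (-1) ^ (p - a : ℕ) * (X.submatrix (Fin.snoc (α := fun _ => ρ) f x) c).det := by
  have key : ∀ b : Fin (p + 1), (X.submatrix (b.insertNth (α := fun _ => ρ) x f) c).det =
      (-1) ^ (b : ℕ) * ∑ j : Fin (p + 1), (-1) ^ (j : ℕ) * X x (c j) *
        (X.submatrix f (c ∘ j.succAbove)).det := by
    intro b
    rw [Matrix.det_succ_row _ b, Finset.mul_sum]
    refine Finset.sum_congr rfl fun j _ => ?_
    have : (X.submatrix (b.insertNth (α := fun _ => ρ) x f) c).submatrix b.succAbove j.succAbove =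
        X.submatrix f (c ∘ j.succAbove) := by
      ext i l
      simp
    rw [this, Matrix.submatrix_apply, Fin.insertNth_apply_same, pow_add]
    ring
  rw [← Fin.insertNth_last', key, key, ← mul_assoc, ← pow_add]
  congr 1
  rw [Fin.val_last]
  have h : (p - a : ℕ) + p = a + 2 * (p - a) := by omega
  rw [h, pow_add, pow_mul]
  simp

theorem det_insertNth_col {ρ κ : Type*} (X : Matrix ρ κ R) {p : ℕ} (a : Fin (p + 1)) (x : κ)
    (f : Fin p → κ) (r : Fin (p + 1) → ρ) :
    (X.submatrix r (a.insertNth (α := fun _ => κ) x f)).det =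
      (-1) ^ (p - a : ℕ) * (X.submatrix r (Fin.snoc (α := fun _ => κ) f x)).det := by
  have h := det_insertNth X.transpose a x f r
  rwa [← Matrix.det_transpose, Matrix.transpose_submatrix, Matrix.transpose_transpose,
    ← Matrix.det_transpose (X.transpose.submatrix _ _), Matrix.transpose_submatrix,
    Matrix.transpose_transpose] at h

end Determinants

/-! ### Minors with unsorted rows and columns -/

theorem minorPoly_eq_det {p q k : ℕ} {r : Fin k → Fin p} {c : Fin k → Fin q} (hr : StrictMono r)
    (hc : StrictMono c) {K : Finset (Fin p)} {L : Finset (Fin q)}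
    (hK : K = Finset.univ.image r) (hL : L = Finset.univ.image c) :
    minorPoly K L = ((varMatrix p q).submatrix r c).det := by
  have hLk : L.card = k := by rw [hL, Finset.card_image_of_injective _ hc.injective]; simp
  have hKk : K.card = k := by rw [hK, Finset.card_image_of_injective _ hr.injective]; simp
  subst hLk
  rw [minorPoly, dif_pos hKk,
    ← Finset.orderEmbOfFin_unique hKk (f := r) (fun x => by
      have := Finset.mem_image_of_mem r (Finset.mem_univ x); rwa [← hK] at this) hr,
    ← Finset.orderEmbOfFin_unique rfl (f := c) (fun x => by
      have := Finset.mem_image_of_mem c (Finset.mem_univ x); rwa [← hL] at this) hc]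
  rfl

theorem card_filter_lt_image {n p : ℕ} {g : Fin (p + 1) → Fin n} (hg : StrictMono g)
    (a : Fin (p + 1)) : ((Finset.univ.image g).filter fun x => g a < x).card = p - a := by
  have : (Finset.univ.image g).filter (fun x => g a < x) = (Finset.Ioi a).image g := by
    ext x
    simp only [Finset.mem_filter, Finset.mem_image, Finset.mem_univ, true_and, Finset.mem_Ioi]
    constructor
    · rintro ⟨⟨b, rfl⟩, h⟩; exact ⟨b, hg.lt_iff_lt.1 h, rfl⟩
    · rintro ⟨b, h, rfl⟩; exact ⟨⟨b, rfl⟩, hg h⟩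
  rw [this, Finset.card_image_of_injective _ hg.injective, Fin.card_Ioi]
  omega

theorem strictMono_snoc {q p : ℕ} {f : Fin p → Fin q} (hf : StrictMono f) {x : Fin q}
    (hx : ∀ i, f i < x) :
    StrictMono (Fin.snoc (α := fun _ => Fin q) f x : Fin (p + 1) → Fin q) := by
  intro i j hij
  induction j using Fin.lastCases with
  | last =>
    induction i using Fin.lastCases with
    | last => exact absurd hij (lt_irrefl _)
    | cast i => simpa using hx i
  | cast j =>
    induction i using Fin.lastCases with
    | last => exact absurd hij (Fin.le_last _).not_gt
    | cast i => simpa using hf (by simpa using hij)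

theorem image_snoc {ρ : Type*} [DecidableEq ρ] {p : ℕ} (f : Fin p → ρ) (x : ρ) :
    Finset.univ.image (Fin.snoc (α := fun _ => ρ) f x : Fin (p + 1) → ρ) =
      insert x (Finset.univ.image f) := by
  ext y
  simp only [Finset.mem_image, Finset.mem_univ, true_and, Finset.mem_insert]
  constructor
  · rintro ⟨i, rfl⟩
    induction i using Fin.lastCases with
    | last => simp
    | cast i => simp
  · rintro (rfl | ⟨i, rfl⟩)
    · exact ⟨Fin.last p, by simp⟩
    · exact ⟨i.castSucc, by simp⟩

theorem image_succAbove {ρ : Type*} [DecidableEq ρ] {p : ℕ} {g : Fin (p + 1) → ρ}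
    (hg : Function.Injective g) (a : Fin (p + 1)) :
    Finset.univ.image (g ∘ a.succAbove) = (Finset.univ.image g).erase (g a) := by
  ext y
  simp only [Finset.mem_image, Finset.mem_univ, true_and, Finset.mem_erase, Function.comp]
  constructor
  · rintro ⟨i, rfl⟩; exact ⟨fun h => Fin.succAbove_ne a i (hg h), _, rfl⟩
  · rintro ⟨h, i, rfl⟩
    obtain ⟨j, rfl⟩ := Fin.exists_succAbove_eq (show i ≠ a from fun h' => h (by rw [h']))
    exact ⟨j, rfl⟩

/-! ### Bases as row selections -/

section Selection

variable {R : Type*} [CommRing R] {ι : Type*} [DecidableEq ι]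

/-- The matrix whose row `q` is the row `r` of `N` if `f q = some r`, and the row `q` of the
identity matrix if `f q = none`; the columns of `N` are numbered through `col`. -/
def selMatrix {p n : ℕ} (N : Matrix (Fin p) (Fin n) R) (col : ι ≃ Fin n)
    (f : ι → Option (Fin p)) : Matrix ι ι R :=
  Matrix.of fun q q' => (f q).elim ((1 : Matrix ι ι R) q q') fun r => N r (col q')

theorem selMatrix_update {p n : ℕ} (N : Matrix (Fin p) (Fin n) R) (col : ι ≃ Fin n)
    (f : ι → Option (Fin p)) (q : ι) (r : Fin p) :
    selMatrix N col (Function.update f q (some r)) =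
      (selMatrix N col f).updateRow q fun q' => N r (col q') := by
  ext a b
  by_cases h : a = q
  · subst h; simp [selMatrix]
  · simp [selMatrix, h]

variable [Fintype ι]

theorem det_selMatrix {p n : ℕ} (N : Matrix (Fin p) (Fin n) R) (col : ι ≃ Fin n)
    (f : ι → Option (Fin p)) {k : ℕ} {e : Fin k → ι} (he : Function.Injective e)
    (hf : ∀ q, q ∉ Set.range e → f q = none) {r : Fin k → Fin p} (hr : ∀ a, f (e a) = some (r a)) :
    (selMatrix N col f).det = (N.submatrix r (col ∘ e)).det := by
  rw [det_eq_det_submatrix_of_identity_rows _ he]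
  · congr 1
    ext a b
    simp [selMatrix, hr]
  · intro q hq
    ext q'
    simp [selMatrix, hf q hq]

theorem map_det_selMatrix {S : Type*} [CommRing S] (φ : R →+* S) {p n : ℕ}
    (N : Matrix (Fin p) (Fin n) R) (col : ι ≃ Fin n) (f : ι → Option (Fin p)) :
    φ (selMatrix N col f).det = (selMatrix (N.map φ) col f).det := by
  rw [RingHom.map_det]
  congr 1
  ext a b
  cases h : f a <;> simp [selMatrix, h, Matrix.one_apply, apply_ite φ]

end Selection

section Basis

variable {m n p s : ℕ} {I : Finset (Fin m)} {J : Finset (Fin n)}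

theorem IsBasis.card_compl (h : IsBasis I J) : Jᶜ.card = I.card := by
  rw [Finset.card_compl, Fintype.card_fin]; unfold IsBasis at h; omega

/-- The columns, in the order in which the basis numbers them: those that do not belong to `J`, then
those that do. -/
noncomputable def basisCol (hI : Jᶜ.card = p) (hJ : J.card = s) : Fin p ⊕ Fin s ≃ Fin n :=
  (Equiv.sumComm _ _).trans (finSumEquivOfFinset hJ hI)

theorem basisCol_inl (hI : Jᶜ.card = p) (hJ : J.card = s) (a : Fin p) :
    basisCol hI hJ (.inl a) = Jᶜ.orderEmbOfFin hI a := by simp [basisCol]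

theorem basisCol_inr (hI : Jᶜ.card = p) (hJ : J.card = s) (b : Fin s) :
    basisCol hI hJ (.inr b) = J.orderEmbOfFin hJ b := by simp [basisCol]

/-- The row selection of the basis: the rows of `A` indexed by `I`, then rows of the identity
matrix. -/
noncomputable def basisSel (s : ℕ) (hI : I.card = p) : Fin p ⊕ Fin s → Option (Fin (m + 2)) :=
  Sum.elim (fun a => some (Fin.castAdd 2 (I.orderEmbOfFin hI a))) fun _ => none

/-- The element of `I ⊎ J` at a given position. -/
noncomputable def basisLabel (hI : I.card = p) (hJ : J.card = s) : Fin p ⊕ Fin s → Fin m ⊕ Fin n :=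
  Sum.map (I.orderEmbOfFin hI) (J.orderEmbOfFin hJ)

theorem basisLabel_injective (hI : I.card = p) (hJ : J.card = s) :
    Function.Injective (basisLabel hI hJ) :=
  Sum.map_injective.2 ⟨(I.orderEmbOfFin hI).injective, (J.orderEmbOfFin hJ).injective⟩

theorem mem_disjSum_iff (hI : I.card = p) (hJ : J.card = s) (l : Fin m ⊕ Fin n) :
    l ∈ I.disjSum J ↔ ∃ q, basisLabel hI hJ q = l := by
  have h1 := Finset.range_orderEmbOfFin I hI
  have h2 := Finset.range_orderEmbOfFin J hJ
  rcases l with i | j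
  · rw [Finset.inl_mem_disjSum, ← Finset.mem_coe, ← h1]
    constructor
    · rintro ⟨a, rfl⟩; exact ⟨.inl a, rfl⟩
    · rintro ⟨a | b, h⟩
      · exact ⟨a, Sum.inl_injective h⟩
      · exact absurd h (by simp [basisLabel])
  · rw [Finset.inr_mem_disjSum, ← Finset.mem_coe, ← h2]
    constructor
    · rintro ⟨a, rfl⟩; exact ⟨.inr a, rfl⟩
    · rintro ⟨a | b, h⟩
      · exact absurd h (by simp [basisLabel])
      · exact ⟨b, Sum.inr_injective h⟩

/-- The sign `s_l`, as a unit. -/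
def costUnit (I : Finset (Fin m)) (J : Finset (Fin n)) : Fin m ⊕ Fin n → ℤˣ
  | .inl i => (-1) ^ (I.filter fun a => i < a).card
  | .inr j => (-1) ^ (Jᶜ.filter fun b => j < b).card

theorem costSign_eq (l : Fin m ⊕ Fin n) : costSign I J l = SignType.sign (costUnit I J l : ℤ) := by
  have h : ∀ k : ℕ, (-1 : SignType) ^ k = SignType.sign ((((-1) ^ k : ℤˣ) : ℤ)) := by
    intro k
    rcases Nat.even_or_odd k with h | h <;> simp [h.neg_one_pow]
  rcases l with i | j
  · exact h _
  · exact h _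

theorem castAdd_lt_natAdd (i : Fin m) (r : Fin 2) : Fin.castAdd 2 i < Fin.natAdd m r := by
  rw [Fin.lt_def]; simp; omega

theorem strictMono_castAdd {k : ℕ} {g : Fin k → Fin m} (hg : StrictMono g) :
    StrictMono fun a => Fin.castAdd 2 (g a) := fun _ _ h => hg h

theorem liftRows_image {k : ℕ} (g : Fin k → Fin m) :
    liftRows (Finset.univ.image g) = Finset.univ.image (fun a => Fin.castAdd 2 (g a)) := by
  rw [liftRows, Finset.map_eq_image, Finset.image_image]; rfl

theorem basisPoly_eq (hI : I.card = p) (hc : Jᶜ.card = p) (hJ : J.card = s) :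
    basisPoly I J = (selMatrix (varMatrix (m + 2) n) (basisCol hc hJ) (basisSel s hI)).det := by
  rw [det_selMatrix (e := Sum.inl) _ _ _ Sum.inl_injective
    (r := fun a => Fin.castAdd 2 (I.orderEmbOfFin hI a))]
  · have : basisCol hc hJ ∘ Sum.inl = Jᶜ.orderEmbOfFin hc := funext fun a => basisCol_inl hc hJ a
    rw [this, basisPoly]
    refine minorPoly_eq_det (strictMono_castAdd (I.orderEmbOfFin hI).strictMono)
      (OrderEmbedding.strictMono _) ?_ ?_
    · rw [← liftRows_image, Finset.image_orderEmbOfFin_univ]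
    · rw [Finset.image_orderEmbOfFin_univ]
  · rintro (a | b) h
    · exact absurd ⟨a, rfl⟩ h
    · rfl
  · intro a; rfl

theorem intCast_neg_one_pow_mul {R : Type*} [CommRing R] (k : ℕ) :
    ((((-1) ^ k : ℤˣ) : ℤ) : R) * (-1) ^ k = 1 := by
  push_cast
  rw [← mul_pow]; simp

/-- The polynomials `Q_l` and `R_l` are, up to the sign `s_l`, the determinants that Cramer's rule
attaches to the basis. -/
theorem costPoly_eq (hI : I.card = p) (hc : Jᶜ.card = p) (hJ : J.card = s) (r : Fin 2)
    (q : Fin p ⊕ Fin s) :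
    costPoly r I J (basisLabel hI hJ q) =
      ((costUnit I J (basisLabel hI hJ q) : ℤ) : MvPolynomial (Fin (m + 2) × Fin n) Puiseux) *
      (selMatrix (varMatrix (m + 2) n) (basisCol hc hJ)
        (Function.update (basisSel s hI) q (some (Fin.natAdd m r)))).det := by
  rcases q with a | b
  · obtain _ | p := p
    · exact a.elim0
    set g := I.orderEmbOfFin hI with hg
    have hIg : I = Finset.univ.image g := (Finset.image_orderEmbOfFin_univ I hI).symm
    set f : Fin p → Fin (m + 2) := fun i => Fin.castAdd 2 (g (a.succAbove i)) with hf
    rw [det_selMatrix (e := Sum.inl) _ _ _ Sum.inl_injective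
      (r := a.insertNth (α := fun _ => Fin (m + 2)) (Fin.natAdd m r) f)]
    · have : basisCol hc hJ ∘ Sum.inl = Jᶜ.orderEmbOfFin hc := funext fun a => basisCol_inl hc hJ a
      rw [this, det_insertNth, ← mul_assoc]
      have hs : costUnit I J (basisLabel hI hJ (.inl a)) = (-1) ^ (p - a : ℕ) := by
        show (-1) ^ (I.filter fun x => g a < x).card = _
        rw [hIg, card_filter_lt_image g.strictMono]
      rw [hs]
      rw [intCast_neg_one_pow_mul, one_mul]
      refine minorPoly_eq_det (strictMono_snoc (strictMono_castAdd
        (g.strictMono.comp (Fin.strictMono_succAbove a))) fun i => castAdd_lt_natAdd _ _)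
        (OrderEmbedding.strictMono _) ?_ ?_
      · rw [image_snoc]
        show insert (Fin.natAdd m r) (liftRows (I.erase (g a))) = _
        congr 1
        rw [hIg, ← image_succAbove g.injective, liftRows_image]
      · rw [Finset.image_orderEmbOfFin_univ]
    · rintro (a | b) h
      · exact absurd ⟨a, rfl⟩ h
      · simp [basisSel]
    · intro a'
      by_cases h : a' = a
      · subst h; simp
      · obtain ⟨i, rfl⟩ := Fin.exists_succAbove_eq h
        rw [Function.update_of_ne (fun h' => h (Sum.inl_injective h')),
          Fin.insertNth_apply_succAbove]
        rfl
  · set j := J.orderEmbOfFin hJ b with hj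
    have hjJ : j ∈ J := Finset.orderEmbOfFin_mem J hJ b
    have hjc : j ∉ Jᶜ := by simpa using hjJ
    set c := Jᶜ.orderEmbOfFin hc with hcdef
    have hcim : Finset.univ.image c = Jᶜ := Finset.image_orderEmbOfFin_univ _ hc
    have hcard : (insert j Jᶜ).card = p + 1 := by rw [Finset.card_insert_of_notMem hjc, hc]
    set g := (insert j Jᶜ).orderEmbOfFin hcard with hgdef
    have hgim : Finset.univ.image g = insert j Jᶜ := Finset.image_orderEmbOfFin_univ _ hcard
    obtain ⟨k, -, hk⟩ := Finset.mem_image.1 (hgim ▸ Finset.mem_insert_self j Jᶜ :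
      j ∈ Finset.univ.image g)
    have hgc : g ∘ k.succAbove = c := by
      refine Finset.orderEmbOfFin_unique hc (fun i => ?_)
        (g.strictMono.comp (Fin.strictMono_succAbove k))
      have : (g ∘ k.succAbove) i ∈ Finset.univ.image (g ∘ k.succAbove) :=
        Finset.mem_image_of_mem _ (Finset.mem_univ i)
      rw [image_succAbove g.injective, hgim, hk, Finset.erase_insert hjc] at this
      exact this
    have hgn : (g : Fin (p + 1) → Fin n) = k.insertNth (α := fun _ => Fin n) j c := by
      ext i
      by_cases h : i = k
      · subst h; simp [hk]
      · obtain ⟨i, rfl⟩ := Fin.exists_succAbove_eq h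
        rw [Fin.insertNth_apply_succAbove, ← hgc]; rfl
    rw [det_selMatrix (e := Fin.snoc (α := fun _ => Fin p ⊕ Fin s) Sum.inl (Sum.inr b)) _ _ _
      (r := Fin.snoc (α := fun _ => Fin (m + 2))
        (fun a => Fin.castAdd 2 (I.orderEmbOfFin hI a)) (Fin.natAdd m r))]
    · have : (basisCol hc hJ ∘ Fin.snoc (α := fun _ => Fin p ⊕ Fin s) Sum.inl (Sum.inr b) :
          Fin (p + 1) → Fin n) = Fin.snoc (α := fun _ => Fin n) c j := by
        ext i
        induction i using Fin.lastCases with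
        | last => simp [basisCol_inr, hj]
        | cast i => simp [basisCol_inl, hcdef]
      rw [this]
      have hs : costUnit I J (basisLabel hI hJ (.inr b)) = (-1) ^ (p - k : ℕ) := by
        show (-1) ^ (Jᶜ.filter fun x => j < x).card = _
        rw [← card_filter_lt_image g.strictMono, hgim, Finset.filter_insert, hk,
          if_neg (lt_irrefl _)]
      have hdet := det_insertNth_col (varMatrix (m + 2) n) k j c (Fin.snoc (α := fun _ => Fin (m + 2))
        (fun a => Fin.castAdd 2 (I.orderEmbOfFin hI a)) (Fin.natAdd m r))
      rw [← hgn] at hdet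
      rw [hs]
      push_cast
      rw [← hdet]
      refine minorPoly_eq_det (strictMono_snoc (strictMono_castAdd (I.orderEmbOfFin hI).strictMono)
        fun i => castAdd_lt_natAdd _ _)
        (OrderEmbedding.strictMono _) ?_ hgim.symm
      · rw [image_snoc, ← liftRows_image, Finset.image_orderEmbOfFin_univ]
    · intro x y hxy
      induction x using Fin.lastCases with
      | last =>
        induction y using Fin.lastCases with
        | last => rfl
        | cast y => simp at hxy
      | cast x =>
        induction y using Fin.lastCases with
        | last => simp at hxy
        | cast y => simpa using hxy
    · rintro (a | b') h
      · exact absurd ⟨a.castSucc, by simp⟩ h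
      · rw [Function.update_of_ne]
        · rfl
        · rintro h'
          exact h ⟨Fin.last p, by rw [h']; simp⟩
    · intro x
      induction x using Fin.lastCases with
      | last => simp
      | cast x => simp [basisSel]

end Basis

/-! ### The determinants attached to a basis -/

section BasisDet

variable {m n : ℕ} {I : Finset (Fin m)} {J : Finset (Fin n)} {R : Type*} [CommRing R]

/-- No row is selected twice. -/
def SelInjective {ι : Type*} {p : ℕ} (f : ι → Option (Fin p)) : Prop :=
  ∀ ⦃q q' r⦄, f q = some r → f q' = some r → q = q'

theorem SelInjective.update {ι : Type*} [DecidableEq ι] {p : ℕ} {f : ι → Option (Fin p)}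
    (hf : SelInjective f) (k : ι) {r : Fin p} (hr : ∀ q, f q ≠ some r) :
    SelInjective (Function.update f k (some r)) := by
  intro q q' r' h h'
  by_cases hq : q = k <;> by_cases hq' : q' = k
  · rw [hq, hq']
  · subst hq
    rw [Function.update_self] at h
    rw [Function.update_of_ne hq', ← h] at h'
    exact absurd h' (hr q')
  · subst hq'
    rw [Function.update_self] at h'
    rw [Function.update_of_ne hq, ← h'] at h
    exact absurd h (hr q)
  · rw [Function.update_of_ne hq] at h
    rw [Function.update_of_ne hq'] at h'
    exact hf h h'

/-- The determinant of a row selection is a minor. -/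
theorem SelInjective.exists_minor {ι : Type*} [Fintype ι] [DecidableEq ι] {p : ℕ}
    {f : ι → Option (Fin p)} (hf : SelInjective f) (col : ι ≃ Fin n) :
    ∃ (k : ℕ) (r : Fin k → Fin p) (c : Fin k → Fin n), Function.Injective r ∧
      Function.Injective c ∧ ∀ {R : Type} [CommRing R] (N : Matrix (Fin p) (Fin n) R),
        (selMatrix N col f).det = (N.submatrix r c).det := by
  let e := (Fintype.equivFin {q // (f q).isSome}).symm
  have hr : ∀ a, f (e a) = some ((f (e a)).get (e a).2) := fun a => (Option.some_get _).symm
  have hinj : Function.Injective fun a => (e a : ι) := Subtype.val_injective.comp e.injective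
  refine ⟨_, fun a => (f (e a)).get (e a).2, col ∘ fun a => (e a : ι), fun a b hab => ?_,
    col.injective.comp hinj, fun {R} _ N => ?_⟩
  · refine hinj (hf (hr a) ?_)
    rw [hr b]; exact congrArg some hab.symm
  · refine det_selMatrix N col f hinj (fun q hq => ?_) hr
    by_contra h
    exact hq ⟨e.symm ⟨q, Option.isSome_iff_ne_none.2 h⟩, by simp⟩

/-- The row selection of the basis, where the rows of `uᵀ` and `vᵀ` replace those at the positions
`k` and `l`, if any. -/
noncomputable def replaceSel (I : Finset (Fin m)) (J : Finset (Fin n))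
    (k l : Option (Fin I.card ⊕ Fin J.card)) : Fin I.card ⊕ Fin J.card → Option (Fin (m + 2)) :=
  fun q => if l = some q then some (Fin.natAdd m 1)
    else if k = some q then some (Fin.natAdd m 0) else basisSel J.card rfl q

/-- The determinant of the rows of `N` and of the identity matrix that are selected by the basis,
where the rows of `uᵀ` and `vᵀ` replace those at the positions `k` and `l`, if any. -/
noncomputable def basisDet (h : IsBasis I J) (N : Matrix (Fin (m + 2)) (Fin n) R)
    (k l : Option (Fin I.card ⊕ Fin J.card)) : R :=
  (selMatrix N (basisCol h.card_compl rfl) (replaceSel I J k l)).det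

theorem replaceSel_none_none : replaceSel I J none none = basisSel J.card rfl := by
  ext1 q; simp [replaceSel]

theorem replaceSel_some_none (k : Fin I.card ⊕ Fin J.card) : replaceSel I J (some k) none =
    Function.update (basisSel J.card rfl) k (some (Fin.natAdd m 0)) := by
  ext1 q; simp [replaceSel, Function.update_apply, eq_comm]

theorem replaceSel_none_some (l : Fin I.card ⊕ Fin J.card) : replaceSel I J none (some l) =
    Function.update (basisSel J.card rfl) l (some (Fin.natAdd m 1)) := by
  ext1 q; simp [replaceSel, Function.update_apply, eq_comm]

theorem replaceSel_some_some (k l : Fin I.card ⊕ Fin J.card) : replaceSel I J (some k) (some l) =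
    Function.update (Function.update (basisSel J.card rfl) k (some (Fin.natAdd m 0))) l
      (some (Fin.natAdd m 1)) := by
  ext1 q; simp [replaceSel, Function.update_apply, eq_comm]

theorem basisSel_ne (r : Fin 2) (q : Fin I.card ⊕ Fin J.card) :
    basisSel J.card rfl q ≠ some (Fin.natAdd m r) := by
  rcases q with a | b
  · intro h
    exact (castAdd_lt_natAdd (I.orderEmbOfFin rfl a) r).ne (Option.some_injective _ h)
  · simp [basisSel]

theorem basisSel_injective :
    SelInjective (basisSel J.card rfl : Fin I.card ⊕ Fin J.card → Option (Fin (m + 2))) := by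
  rintro (a | b) (a' | b') r h h'
  · have := Option.some_injective _ (h.trans h'.symm)
    simpa using this
  all_goals simp [basisSel] at h h'

theorem natAdd_zero_ne_one : Fin.natAdd m (0 : Fin 2) ≠ Fin.natAdd m 1 := by simp [Fin.ext_iff]

theorem replaceSel_injective {k l : Option (Fin I.card ⊕ Fin J.card)} (hkl : k = l → k = none) :
    SelInjective (replaceSel I J k l) := by
  rcases k with _ | k <;> rcases l with _ | l
  · rw [replaceSel_none_none]; exact basisSel_injective
  · rw [replaceSel_none_some]; exact basisSel_injective.update _ fun q => basisSel_ne _ _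
  · rw [replaceSel_some_none]; exact basisSel_injective.update _ fun q => basisSel_ne _ _
  · rw [replaceSel_some_some]
    refine (basisSel_injective.update _ fun q => basisSel_ne _ _).update _ fun q => ?_
    by_cases h : q = k
    · subst h
      rw [Function.update_self]
      exact fun h => natAdd_zero_ne_one (Option.some_injective _ h)
    · rw [Function.update_of_ne h]; exact basisSel_ne _ _

variable (h : IsBasis I J)

/-- Through this relation, the comparison polynomial `T_{kl}` and the comparison of two ratios of
reduced costs depend only on the sign of `basisDet h N (some k) (some l)`. -/
theorem basisDet_plucker (N : Matrix (Fin (m + 2)) (Fin n) R) {k l : Fin I.card ⊕ Fin J.card}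
    (hkl : k ≠ l) : basisDet h N none none * basisDet h N (some k) (some l) =
      basisDet h N (some k) none * basisDet h N none (some l) -
        basisDet h N (some l) none * basisDet h N none (some k) := by
  simp only [basisDet, replaceSel_none_none, replaceSel_none_some, replaceSel_some_none,
    replaceSel_some_some, selMatrix_update]
  exact det_mul_det_updateRow_updateRow _ hkl _ _

theorem map_basisDet {S : Type*} [CommRing S] (φ : R →+* S) (N : Matrix (Fin (m + 2)) (Fin n) R)
    (k l : Option (Fin I.card ⊕ Fin J.card)) :
    φ (basisDet h N k l) = basisDet h (N.map φ) k l := map_det_selMatrix φ N _ _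

theorem eval_basisDet (N : Matrix (Fin (m + 2)) (Fin n) Puiseux)
    (k l : Option (Fin I.card ⊕ Fin J.card)) :
    MvPolynomial.eval (entries N) (basisDet h (varMatrix (m + 2) n) k l) = basisDet h N k l := by
  rw [map_basisDet]
  congr 1
  ext i j : 1
  simp [varMatrix, entries]

theorem basisPoly_eq_basisDet : basisPoly I J = basisDet h (varMatrix (m + 2) n) none none := by
  rw [basisDet, replaceSel_none_none]
  exact basisPoly_eq rfl _ rfl

/-- The position `q` is replaced by the row of `uᵀ` if `r = 0` and by that of `vᵀ` if `r = 1`. -/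
noncomputable def basisDet₁ (N : Matrix (Fin (m + 2)) (Fin n) R) (r : Fin 2)
    (q : Fin I.card ⊕ Fin J.card) : R :=
  if r = 0 then basisDet h N (some q) none else basisDet h N none (some q)

theorem basisDet₁_eq (N : Matrix (Fin (m + 2)) (Fin n) R) (r : Fin 2)
    (q : Fin I.card ⊕ Fin J.card) : basisDet₁ h N r q =
      (selMatrix N (basisCol h.card_compl rfl)
        (Function.update (basisSel J.card rfl) q (some (Fin.natAdd m r)))).det := by
  obtain rfl | rfl : r = 0 ∨ r = 1 := by omega
  · rw [← replaceSel_some_none]; rfl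
  · rw [← replaceSel_none_some]; rfl

theorem costPoly_eq_basisDet (r : Fin 2) (q : Fin I.card ⊕ Fin J.card) :
    costPoly r I J (basisLabel rfl rfl q) =
      ((costUnit I J (basisLabel rfl rfl q) : ℤ) : MvPolynomial (Fin (m + 2) × Fin n) Puiseux) *
      basisDet₁ h (varMatrix (m + 2) n) r q := by
  rw [basisDet₁_eq]; exact costPoly_eq rfl _ rfl r q

theorem polyT_eq {k l : Fin I.card ⊕ Fin J.card} (hkl : k ≠ l) :
    polyT I J (basisLabel rfl rfl k) (basisLabel rfl rfl l) =
      (((costUnit I J (basisLabel rfl rfl k) * costUnit I J (basisLabel rfl rfl l) : ℤˣ) : ℤ) :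
        MvPolynomial (Fin (m + 2) × Fin n) Puiseux) *
      (basisDet h (varMatrix (m + 2) n) none none *
        basisDet h (varMatrix (m + 2) n) (some k) (some l)) := by
  rw [basisDet_plucker h _ hkl, polyT, polyQ, polyQ, polyR, polyR, costPoly_eq_basisDet h,
    costPoly_eq_basisDet h, costPoly_eq_basisDet h, costPoly_eq_basisDet h]
  simp only [basisDet₁, if_true, one_ne_zero, if_false]
  push_cast
  ring

variable {M : Matrix (Fin (m + 2)) (Fin n) SignedTrop} {N : Matrix (Fin (m + 2)) (Fin n) Puiseux}
  (hN : IsLift N M) (hM : StronglyNonDegenerate M)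

include h hN hM

theorem basisDet_ne_zero {k l : Option (Fin I.card ⊕ Fin J.card)} (hkl : k = l → k = none) :
    basisDet h N k l ≠ 0 := by
  obtain ⟨_, r, c, hr, hc, he⟩ :=
    (replaceSel_injective hkl).exists_minor (basisCol h.card_compl rfl)
  rw [basisDet, he]
  exact hN.det_ne_zero hM hr hc

theorem exists_dominant_basisDet {k l : Option (Fin I.card ⊕ Fin J.card)} (hkl : k = l → k = none) :
    ∃ α, Dominant (basisDet h (varMatrix (m + 2) n) k l) (entries N) α := by
  obtain ⟨_, r, c, hr, hc, he⟩ :=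
    (replaceSel_injective hkl).exists_minor (basisCol h.card_compl rfl)
  rw [basisDet, he]
  exact exists_dominant_det hN hM hr hc

theorem exists_dominant_basisPoly : ∃ α, Dominant (basisPoly I J) (entries N) α := by
  rw [basisPoly_eq_basisDet h]; exact exists_dominant_basisDet h hN hM (by simp)

theorem exists_dominant_costPoly (r : Fin 2) (q : Fin I.card ⊕ Fin J.card) :
    ∃ α, Dominant (costPoly r I J (basisLabel rfl rfl q)) (entries N) α := by
  rw [costPoly_eq_basisDet h]
  have : ∃ α, Dominant (basisDet₁ h (varMatrix (m + 2) n) r q) (entries N) α := by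
    unfold basisDet₁
    split_ifs
    · exact exists_dominant_basisDet h hN hM (by simp)
    · exact exists_dominant_basisDet h hN hM (by simp)
  obtain ⟨α, hα⟩ := this
  exact ⟨α, hα.intUnit_mul _⟩

/-- The polynomial `T_{kl}` is, up to sign, a product of two minors, each with a dominant
monomial. -/
theorem exists_dominant_polyT {k l : Fin I.card ⊕ Fin J.card} (hkl : k ≠ l) :
    ∃ α, Dominant (polyT I J (basisLabel rfl rfl k) (basisLabel rfl rfl l)) (entries N) α := by
  rw [polyT_eq h hkl]
  obtain ⟨α, hα⟩ := exists_dominant_basisDet h hN hM (k := none) (l := none) (by simp)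
  obtain ⟨β, hβ⟩ := exists_dominant_basisDet h hN hM (k := some k) (l := some l)
    (by simpa using hkl)
  exact ⟨_, (hα.mul hβ).intUnit_mul _⟩

omit h hM in
/-- The sign of a tropical polynomial is that of the polynomial at any lift. -/
theorem sign_tropEval {P : MvPolynomial (Fin (m + 2) × Fin n) Puiseux}
    (hP : ∃ α, Dominant P (entries N) α) :
    (tropEval P (entries M)).sign = SignType.sign (MvPolynomial.eval (entries N) P) := by
  have hX : ∀ i, sval (entries N i) = entries M i := fun i => hN i.1 i.2
  rw [← sval_eval_eq_tropEval hX ((not_tropVanishes_iff hX).2 hP), sign_sval]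

end BasisDet

/-! ### The classical and the tropical rules at a basis -/

section RuleAtBasis

variable {m n : ℕ} {I : Finset (Fin m)} {J : Finset (Fin n)} (h : IsBasis I J)

/-- The sign of `y_q` and that of `z_q` are positive, where `y` and `z` are the reduced cost
vectors, written by Cramer's rule. -/
def IsCandidate (N : Matrix (Fin (m + 2)) (Fin n) Puiseux) (q : Fin I.card ⊕ Fin J.card) : Prop :=
  SignType.sign (basisDet h N (some q) none) = SignType.sign (basisDet h N none none) ∧
    SignType.sign (basisDet h N none (some q)) = SignType.sign (basisDet h N none none)

/-- The ratio `y_q / z_q` of the reduced costs. -/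
noncomputable def costRatio (N : Matrix (Fin (m + 2)) (Fin n) Puiseux)
    (q : Fin I.card ⊕ Fin J.card) : Puiseux :=
  basisDet h N (some q) none / basisDet h N none (some q)

/-- The positions in the basis, as elements of `I ⊎ J`. -/
noncomputable def basisEquiv (I : Finset (Fin m)) (J : Finset (Fin n)) :
    Fin I.card ⊕ Fin J.card ≃ I.disjSum J :=
  Equiv.ofBijective (fun q => ⟨basisLabel rfl rfl q, (mem_disjSum_iff rfl rfl _).2 ⟨q, rfl⟩⟩)
    ⟨fun _ _ hab => basisLabel_injective rfl rfl (congrArg Subtype.val hab), fun l => by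
      obtain ⟨q, hq⟩ := (mem_disjSum_iff rfl rfl _).1 l.2
      exact ⟨q, Subtype.ext hq⟩⟩

theorem coe_basisEquiv (q : Fin I.card ⊕ Fin J.card) :
    ((basisEquiv I J q : I.disjSum J) : Fin m ⊕ Fin n) = basisLabel rfl rfl q := rfl

theorem isReducedCost_iff (A : Matrix (Fin m) (Fin n) Puiseux) (u v w : Fin n → Puiseux)
    (y : I.disjSum J → Puiseux) :
    IsReducedCost A w I J y ↔
      (selMatrix (stack A u v) (basisCol h.card_compl rfl) (basisSel J.card rfl)).transpose.mulVec
        (y ∘ basisEquiv I J) = w ∘ basisCol h.card_compl rfl := by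
  unfold IsReducedCost
  rw [← (basisCol (J := J) h.card_compl rfl).surjective.injective_comp_right.eq_iff]
  have : (((Matrix.fromRows A (1 : Matrix (Fin n) (Fin n) Puiseux)).submatrix
      (Subtype.val : (I.disjSum J) → Fin m ⊕ Fin n) id).transpose.mulVec y) ∘
        basisCol h.card_compl rfl =
      (selMatrix (stack A u v) (basisCol h.card_compl rfl) (basisSel J.card rfl)).transpose.mulVec
        (y ∘ basisEquiv I J) := by
    funext c
    simp only [Matrix.mulVec, dotProduct, Function.comp, Matrix.transpose_apply,
      Matrix.submatrix_apply, id]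
    refine (Equiv.sum_comp (basisEquiv I J) _).symm.trans (Finset.sum_congr rfl fun q _ => ?_)
    congr 1
    rw [coe_basisEquiv]
    rcases q with a | b
    · simp [basisLabel, selMatrix, basisSel, stack]
    · simp only [basisLabel, selMatrix, basisSel, Sum.map_inr, Matrix.fromRows_apply_inr,
        Matrix.of_apply, Sum.elim_inr, Option.elim_none]
      rw [← basisCol_inr h.card_compl rfl, Matrix.one_apply, Matrix.one_apply]
      simp only [Equiv.apply_eq_iff_eq]
  rw [this]

/-- Cramer's rule for the reduced costs. -/
theorem isReducedCost_iff_eq {A : Matrix (Fin m) (Fin n) Puiseux} {u v : Fin n → Puiseux}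
    (h0 : basisDet h (stack A u v) none none ≠ 0) (r : Fin 2) (y : I.disjSum J → Puiseux) :
    IsReducedCost A (![u, v] r) I J y ↔
      y = fun l => basisDet₁ h (stack A u v) r ((basisEquiv I J).symm l) /
        basisDet h (stack A u v) none none := by
  set B := selMatrix (stack A u v) (basisCol h.card_compl rfl) (basisSel J.card rfl) with hB
  have hdet : basisDet h (stack A u v) none none = B.det := by
    rw [basisDet, replaceSel_none_none]
  have hrow : (![u, v] r) ∘ basisCol h.card_compl rfl =
      fun q' => stack A u v (Fin.natAdd m r) (basisCol h.card_compl rfl q') := by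
    funext q'; simp [stack]
  have hD : ∀ q, basisDet₁ h (stack A u v) r q =
      (B.updateRow q ((![u, v] r) ∘ basisCol h.card_compl rfl)).det := by
    intro q
    rw [basisDet₁_eq, selMatrix_update, hrow]
  rw [isReducedCost_iff h A u v, hdet]
  rw [hdet] at h0
  have hinj : Function.Injective B.transpose.mulVec :=
    Matrix.mulVec_injective_of_isUnit ((Matrix.isUnit_iff_isUnit_det _).2
      (by rw [Matrix.det_transpose]; exact isUnit_iff_ne_zero.2 h0))
  have hsol : B.transpose.mulVec (fun q => basisDet₁ h (stack A u v) r q / B.det) =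
      (![u, v] r) ∘ basisCol h.card_compl rfl := by
    have := det_smul_eq_sum_updateRow B ((![u, v] r) ∘ basisCol h.card_compl rfl)
    funext c
    have hc := congrFun this c
    simp only [Pi.smul_apply, smul_eq_mul, Finset.sum_apply] at hc
    rw [← mul_right_inj' h0, hc]
    simp only [Matrix.mulVec, dotProduct, Matrix.transpose_apply, Finset.mul_sum]
    refine Finset.sum_congr rfl fun q _ => ?_
    rw [hD]; field_simp
  rw [← hsol, hinj.eq_iff]
  constructor
  · intro hy
    ext1 l
    rw [← congrFun hy]; simp
  · rintro rfl
    ext1 q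
    simp

variable {A : Matrix (Fin m) (Fin n) SignedTrop} {u v : Fin n → SignedTrop}
  {N : Matrix (Fin (m + 2)) (Fin n) Puiseux}
  (hN : IsLift N (stack A u v)) (hM : StronglyNonDegenerate (stack A u v))

include h hN hM

theorem tropCandidate_iff (q : Fin I.card ⊕ Fin J.card) :
    TropCandidate (stack A u v) I J (basisLabel rfl rfl q) ↔ IsCandidate h N q := by
  have hs : ∀ (s : ℤˣ) (a b : SignType), SignType.sign (s : ℤ) * a = SignType.sign (s : ℤ) * b ↔
      a = b := by
    intro s a b
    rcases Int.units_eq_one_or s with rfl | rfl <;> simp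
  have hs' : ∀ s : ℤˣ, SignType.sign (((s : ℤ) : Puiseux)) = SignType.sign (s : ℤ) := by
    intro s
    rcases Int.units_eq_one_or s with rfl | rfl <;> simp
  have hcost : ∀ r, (tropEval (costPoly r I J (basisLabel rfl rfl q)) (entries (stack A u v))).sign =
      SignType.sign (costUnit I J (basisLabel rfl rfl q) : ℤ) *
        SignType.sign (basisDet₁ h N r q) := by
    intro r
    rw [sign_tropEval hN (exists_dominant_costPoly h hN hM r q), costPoly_eq_basisDet h, map_mul,
      sign_mul, map_intCast, hs']
    congr 2
    unfold basisDet₁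
    split_ifs <;> rw [eval_basisDet]
  have hbasis : (tropEval (basisPoly I J) (entries (stack A u v))).sign =
      SignType.sign (basisDet h N none none) := by
    rw [sign_tropEval hN (exists_dominant_basisPoly h hN hM), basisPoly_eq_basisDet h,
      eval_basisDet]
  unfold TropCandidate polyQ polyR
  rw [hcost, hcost, hbasis, costSign_eq, hs, hs]
  simp only [(mem_disjSum_iff rfl rfl _).2 ⟨q, rfl⟩, true_and, IsCandidate]
  rfl

theorem pos_iff_isCandidate (q : Fin I.card ⊕ Fin J.card) :
    (0 < basisDet h N (some q) none / basisDet h N none none ∧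
      0 < basisDet h N none (some q) / basisDet h N none none) ↔ IsCandidate h N q := by
  have key : ∀ a b : Puiseux, b ≠ 0 → (0 < a / b ↔ SignType.sign a = SignType.sign b) := by
    intro a b hb
    rcases lt_or_gt_of_ne hb with hb | hb
    · rw [div_pos_iff, sign_neg hb, sign_eq_neg_one_iff]
      simp [hb, hb.not_gt]
    · rw [div_pos_iff, sign_pos hb, sign_eq_one_iff]
      simp [hb, hb.not_gt]
  have h0 := basisDet_ne_zero h hN hM (k := none) (l := none) (by simp)
  rw [key _ _ h0, key _ _ h0, IsCandidate]

/-- The sign of `D(k, l)`, relatively to that of the basis, compares two ratios. -/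
theorem costRatio_lt_iff {k l : Fin I.card ⊕ Fin J.card} (hk : IsCandidate h N k)
    (hl : IsCandidate h N l) (hkl : k ≠ l) : costRatio h N k < costRatio h N l ↔
      basisDet h N none none * basisDet h N (some k) (some l) < 0 := by
  have h0 := basisDet_ne_zero h hN hM (k := none) (l := none) (by simp)
  have hk' := ((pos_iff_isCandidate h hN hM k).2 hk).2
  have hl' := ((pos_iff_isCandidate h hN hM l).2 hl).2
  rw [basisDet_plucker h N hkl, costRatio, costRatio,
    ← div_div_div_cancel_right₀ h0 (basisDet h N (some k) none),
    ← div_div_div_cancel_right₀ h0 (basisDet h N (some l) none), div_lt_div_iff₀ hk' hl',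
    ← sub_neg, div_mul_div_comm, div_mul_div_comm, ← sub_div,
    div_lt_iff₀ (mul_self_pos.2 h0), zero_mul]

theorem costRatio_ne {k l : Fin I.card ⊕ Fin J.card} (hk : IsCandidate h N k)
    (hl : IsCandidate h N l) (hkl : k ≠ l) : costRatio h N k ≠ costRatio h N l := by
  intro he
  have h1 := (costRatio_lt_iff h hN hM hk hl hkl).not.1 he.not_lt
  have h2 := (costRatio_lt_iff h hN hM hl hk hkl.symm).not.1 he.symm.not_lt
  have h3 := mul_ne_zero (basisDet_ne_zero h hN hM (k := none) (l := none) (by simp))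
    (basisDet_ne_zero h hN hM (k := some k) (l := some l) (by simpa using hkl))
  rw [basisDet_plucker h N hkl] at h1 h3
  rw [basisDet_plucker h N hkl.symm] at h2
  exact h3 (le_antisymm (by linarith) (by linarith))

/-- The tropical comparison of two candidates decides which one has the smaller ratio of reduced
costs, over any lift. -/
theorem sign_polyT_iff {k l : Fin I.card ⊕ Fin J.card} (hk : IsCandidate h N k)
    (hl : IsCandidate h N l) (hkl : k ≠ l) :
    (tropEval (polyT I J (basisLabel rfl rfl k) (basisLabel rfl rfl l))
      (entries (stack A u v))).sign =
        -(costSign I J (basisLabel rfl rfl k) * costSign I J (basisLabel rfl rfl l)) ↔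
      costRatio h N k < costRatio h N l := by
  rw [costRatio_lt_iff h hN hM hk hl hkl, sign_tropEval hN (exists_dominant_polyT h hN hM hkl),
    polyT_eq h hkl, map_mul (MvPolynomial.eval _), map_mul (MvPolynomial.eval _), map_intCast,
    eval_basisDet, eval_basisDet, costSign_eq, costSign_eq, sign_mul, ← sign_eq_neg_one_iff]
  rcases Int.units_eq_one_or (costUnit I J (basisLabel rfl rfl k)) with h1 | h1 <;>
  rcases Int.units_eq_one_or (costUnit I J (basisLabel rfl rfl l)) with h2 | h2 <;>
  simp [h1, h2]
  all_goals exact neg_eq_iff_eq_neg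

theorem isTropShadowVertexValue_none_iff :
    IsTropShadowVertexValue A u v I J none ↔ ∀ q, ¬ IsCandidate h N q := by
  constructor
  · intro ho q hq
    exact ho _ ((tropCandidate_iff h hN hM q).2 hq)
  · intro hq l hl
    obtain ⟨q, rfl⟩ := (mem_disjSum_iff rfl rfl _).1 hl.1
    exact hq q ((tropCandidate_iff h hN hM q).1 hl)

theorem isTropShadowVertexValue_some_iff (k : Fin I.card ⊕ Fin J.card) :
    IsTropShadowVertexValue A u v I J (some (basisLabel rfl rfl k)) ↔
      IsCandidate h N k ∧ ∀ q, IsCandidate h N q → costRatio h N k ≤ costRatio h N q := by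
  constructor
  · rintro ⟨hk, hc⟩
    have hk' := (tropCandidate_iff h hN hM k).1 hk
    refine ⟨hk', fun q hq => ?_⟩
    by_cases hqk : q = k
    · rw [hqk]
    · exact ((sign_polyT_iff h hN hM hk' hq (Ne.symm hqk)).1 (hc _
        ((tropCandidate_iff h hN hM q).2 hq) ((basisLabel_injective rfl rfl).ne hqk))).le
  · rintro ⟨hk, hc⟩
    refine ⟨(tropCandidate_iff h hN hM k).2 hk, fun l hl hlk => ?_⟩
    obtain ⟨q, rfl⟩ := (mem_disjSum_iff rfl rfl _).1 hl.1
    have hq := (tropCandidate_iff h hN hM q).1 hl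
    have hkq : k ≠ q := fun he => hlk (by rw [he])
    exact (sign_polyT_iff h hN hM hk hq hkq).2
      (lt_of_le_of_ne (hc q hq) (costRatio_ne h hN hM hk hq hkq))

/-- Ratios of distinct candidates are distinct, so that the smallest one is attained only once. -/
theorem existsUnique_tropValue : ∃! o, IsTropShadowVertexValue A u v I J o := by
  have hform : ∀ o, IsTropShadowVertexValue A u v I J o → o = none ∨
      ∃ q, o = some (basisLabel (I := I) (J := J) rfl rfl q) := by
    rintro (_ | k) ho
    · exact Or.inl rfl
    · obtain ⟨q, rfl⟩ := (mem_disjSum_iff rfl rfl _).1 ho.1.1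
      exact Or.inr ⟨q, rfl⟩
  by_cases hex : ∃ q, IsCandidate h N q
  · classical
    obtain ⟨k, hk, hmin⟩ := Finset.exists_min_image (Finset.univ.filter fun q => IsCandidate h N q)
      (costRatio h N) (by obtain ⟨q, hq⟩ := hex; exact ⟨q, by simpa using hq⟩)
    simp only [Finset.mem_filter, Finset.mem_univ, true_and] at hk hmin
    refine ⟨some (basisLabel rfl rfl k),
      (isTropShadowVertexValue_some_iff h hN hM k).2 ⟨hk, hmin⟩, fun o ho => ?_⟩
    obtain rfl | ⟨q, rfl⟩ := hform o ho
    · exact absurd hk ((isTropShadowVertexValue_none_iff h hN hM).1 ho k)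
    · obtain ⟨hq, hqm⟩ := (isTropShadowVertexValue_some_iff h hN hM q).1 ho
      by_cases hqk : q = k
      · rw [hqk]
      · exact absurd (le_antisymm (hqm k hk) (hmin q hq)) (costRatio_ne h hN hM hq hk hqk)
  · push Not at hex
    refine ⟨none, (isTropShadowVertexValue_none_iff h hN hM).2 hex, fun o ho => ?_⟩
    obtain rfl | ⟨q, rfl⟩ := hform o ho
    · rfl
    · exact absurd ((isTropShadowVertexValue_some_iff h hN hM q).1 ho).1 (hex q)

theorem tropRuleWellDefined_of_lift : TropRuleWellDefined A u v I J := by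
  have hX : ∀ i, sval (entries N i) = entries (stack A u v) i := fun i => hN i.1 i.2
  refine ⟨(not_tropVanishes_iff hX).2 (exists_dominant_basisPoly h hN hM), fun l hl => ?_,
    fun k hk l hl hkl => ?_, existsUnique_tropValue h hN hM⟩
  · obtain ⟨q, rfl⟩ := (mem_disjSum_iff rfl rfl _).1 hl
    exact ⟨(not_tropVanishes_iff hX).2 (exists_dominant_costPoly h hN hM 0 q),
      (not_tropVanishes_iff hX).2 (exists_dominant_costPoly h hN hM 1 q)⟩
  · obtain ⟨k, rfl⟩ := (mem_disjSum_iff rfl rfl _).1 hk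
    obtain ⟨l, rfl⟩ := (mem_disjSum_iff rfl rfl _).1 hl
    exact (not_tropVanishes_iff hX).2
      (exists_dominant_polyT h hN hM fun he => hkl (by rw [he]))

omit h hN hM in
theorem isLift_stack {A' : Matrix (Fin m) (Fin n) Puiseux} {u' v' : Fin n → Puiseux}
    (hA : ∀ i j, sval (A' i j) = A i j) (hu : ∀ j, sval (u' j) = u j)
    (hv : ∀ j, sval (v' j) = v j) : IsLift (stack A' u' v') (stack A u v) := by
  intro i j
  induction i using Fin.addCases with
  | left i => simpa [stack] using hA i j
  | right r =>
    obtain rfl | rfl : r = 0 ∨ r = 1 := by omega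
    · simpa [stack] using hu j
    · simpa [stack] using hv j

omit hN in
theorem classicalRule_eq_tropicalRule {A' : Matrix (Fin m) (Fin n) Puiseux}
    {u' v' : Fin n → Puiseux} (hN : IsLift (stack A' u' v') (stack A u v)) :
    (∃! y, IsReducedCost A' u' I J y) ∧ (∃! z, IsReducedCost A' v' I J z) ∧
      ∀ o, IsTropShadowVertexValue A u v I J o ↔ IsShadowVertexValue A' u' v' I J o := by
  have h0 := basisDet_ne_zero h hN hM (k := none) (l := none) (by simp)
  have hy := isReducedCost_iff_eq (u := u') (v := v') h h0 0
  have hz := isReducedCost_iff_eq (u := u') (v := v') h h0 1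
  simp only [Matrix.cons_val_zero, Matrix.cons_val_one, basisDet₁, if_true, one_ne_zero,
    if_false] at hy hz
  refine ⟨⟨_, (hy _).2 rfl, fun y => (hy y).1⟩, ⟨_, (hz _).2 rfl, fun z => (hz z).1⟩, fun o => ?_⟩
  have hpos := fun l => pos_iff_isCandidate h hN hM ((basisEquiv I J).symm l)
  have hiff : ∀ o, IsShadowVertexValue A' u' v' I J o ↔ IsRatioChoice
      (fun l => basisDet h (stack A' u' v') (some ((basisEquiv I J).symm l)) none /
        basisDet h (stack A' u' v') none none)
      (fun l => basisDet h (stack A' u' v') none (some ((basisEquiv I J).symm l)) /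
        basisDet h (stack A' u' v') none none) o := by
    intro o
    constructor
    · rintro ⟨y, z, h1, h2, h3⟩
      rwa [(hy y).1 h1, (hz z).1 h2] at h3
    · intro h3
      exact ⟨_, _, (hy _).2 rfl, (hz _).2 rfl, h3⟩
  rw [hiff]
  rcases o with _ | k
  · rw [isTropShadowVertexValue_none_iff h hN hM]
    simp only [IsRatioChoice, hpos]
    exact (basisEquiv I J).symm.forall_congr_right.symm
  · by_cases hk : k ∈ I.disjSum J
    · obtain ⟨q, rfl⟩ := (mem_disjSum_iff rfl rfl _).1 hk
      have hq : (⟨basisLabel rfl rfl q, hk⟩ : I.disjSum J) = basisEquiv I J q := rfl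
      rw [isTropShadowVertexValue_some_iff h hN hM]
      simp only [IsRatioChoice, ← and_imp, hpos, ← and_assoc, hq, div_div_div_cancel_right₀ h0,
        Equiv.symm_apply_apply]
      constructor
      · rintro ⟨h1, h2⟩
        exact ⟨hk, (pos_iff_isCandidate h hN hM q).2 h1, fun l hl => h2 _ hl⟩
      · rintro ⟨_, h1, h2⟩
        refine ⟨(pos_iff_isCandidate h hN hM q).1 h1, fun l hl => ?_⟩
        have := h2 (basisEquiv I J l) (by simpa using hl)
        simpa [costRatio] using this
    · constructor
      · exact fun ho => absurd ho.1.1 hk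
      · rintro ⟨hk', _⟩; exact absurd hk' hk

end RuleAtBasis

/-! ### Reasoning about programs -/

namespace Memory

@[simp] theorem setNat_nat (M : Memory) (d x r : ℕ) :
    (M.setNat d x).nat r = if r = d then x else M.nat r := by
  simp [setNat, Function.update_apply]

@[simp] theorem setNat_real (M : Memory) (d x : ℕ) : (M.setNat d x).real = M.real := rfl

@[simp] theorem setNat_natArr (M : Memory) (d x : ℕ) : (M.setNat d x).natArr = M.natArr := rfl

@[simp] theorem setNat_realArr (M : Memory) (d x : ℕ) : (M.setNat d x).realArr = M.realArr := rfl

@[simp] theorem setReal_nat (M : Memory) (d : ℕ) (x : ℝ) : (M.setReal d x).nat = M.nat := rfl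

@[simp] theorem setReal_real (M : Memory) (d : ℕ) (x : ℝ) (r : ℕ) :
    (M.setReal d x).real r = if r = d then x else M.real r := by
  simp [setReal, Function.update_apply]

@[simp] theorem setReal_natArr (M : Memory) (d : ℕ) (x : ℝ) :
    (M.setReal d x).natArr = M.natArr := rfl

@[simp] theorem setReal_realArr (M : Memory) (d : ℕ) (x : ℝ) :
    (M.setReal d x).realArr = M.realArr := rfl

@[simp] theorem setNatArr_nat (M : Memory) (a i j x : ℕ) : (M.setNatArr a i j x).nat = M.nat := rfl

@[simp] theorem setNatArr_real (M : Memory) (a i j x : ℕ) :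
    (M.setNatArr a i j x).real = M.real := rfl

@[simp] theorem setNatArr_natArr (M : Memory) (a i j x a' i' j' : ℕ) :
    (M.setNatArr a i j x).natArr a' i' j' =
      if a' = a ∧ i' = i ∧ j' = j then x else M.natArr a' i' j' := by
  simp only [setNatArr, Function.update_apply]
  by_cases h : a' = a <;> by_cases h' : i' = i <;> simp [h, h', Function.update_apply]

@[simp] theorem setNatArr_realArr (M : Memory) (a i j x : ℕ) :
    (M.setNatArr a i j x).realArr = M.realArr := rfl

@[simp] theorem setRealArr_nat (M : Memory) (a i j : ℕ) (x : ℝ) :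
    (M.setRealArr a i j x).nat = M.nat := rfl

@[simp] theorem setRealArr_real (M : Memory) (a i j : ℕ) (x : ℝ) :
    (M.setRealArr a i j x).real = M.real := rfl

@[simp] theorem setRealArr_natArr (M : Memory) (a i j : ℕ) (x : ℝ) :
    (M.setRealArr a i j x).natArr = M.natArr := rfl

@[simp] theorem setRealArr_realArr (M : Memory) (a i j : ℕ) (x : ℝ) (a' i' j' : ℕ) :
    (M.setRealArr a i j x).realArr a' i' j' =
      if a' = a ∧ i' = i ∧ j' = j then x else M.realArr a' i' j' := by
  simp only [setRealArr, Function.update_apply]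
  by_cases h : a' = a <;> by_cases h' : i' = i <;> simp [h, h', Function.update_apply]

end Memory

/-- The instruction writes to the given register of natural numbers. -/
def Instr.writesNat : Instr → ℕ → Bool
  | .natConst d _, r | .natCopy d _, r | .natSucc d _, r | .natPred d _, r
  | .natLoad d _ _ _, r => decide (r = d)
  | _, _ => false

/-- The instruction writes to the given register of real numbers. -/
def Instr.writesReal : Instr → ℕ → Bool
  | .realZero d, r | .realCopy d _, r | .realAdd d _ _, r | .realSub d _ _, r
  | .realLoad d _ _ _, r => decide (r = d)
  | _, _ => false

/-- The instruction writes to the given array of natural numbers. -/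
def Instr.writesNatArr : Instr → ℕ → Bool
  | .natStore a _ _ _, r => decide (r = a)
  | _, _ => false

/-- The instruction writes to the given array of real numbers. -/
def Instr.writesRealArr : Instr → ℕ → Bool
  | .realStore a _ _ _, r => decide (r = a)
  | _, _ => false

namespace Program

/-- Some instruction of the program satisfies `f`. -/
def anyInstr (f : Instr → Bool) : Program → Bool
  | skip => false
  | instr c => f c
  | seq p q => p.anyInstr f || q.anyInstr f
  | ite _ p q => p.anyInstr f || q.anyInstr f
  | loop _ p => p.anyInstr f

/-- A sequence of instructions. -/
def block : List Instr → Program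
  | [] => skip
  | c :: cs => seq (instr c) (block cs)

/-- `for i = 0, …, b - 1 do p`, where `b` stands for the content of the register `b`. -/
def forUpTo (i b : ℕ) (p : Program) : Program :=
  seq (instr (.natConst i 0)) (loop (.natLt i b) (seq p (instr (.natSucc i i))))

end Program

/-- What `p` does not write is the same in `M` and in `M'`. -/
structure Frame (p : Program) (M M' : Memory) : Prop where
  nat : ∀ r, p.anyInstr (·.writesNat r) = false → M'.nat r = M.nat r
  real : ∀ r, p.anyInstr (·.writesReal r) = false → M'.real r = M.real r
  natArr : ∀ a, p.anyInstr (·.writesNatArr a) = false → M'.natArr a = M.natArr a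
  realArr : ∀ a, p.anyInstr (·.writesRealArr a) = false → M'.realArr a = M.realArr a

theorem Frame.refl (p : Program) (M : Memory) : Frame p M M :=
  ⟨fun _ _ => rfl, fun _ _ => rfl, fun _ _ => rfl, fun _ _ => rfl⟩

theorem Frame.trans {p : Program} {M M' M'' : Memory} (h : Frame p M M') (h' : Frame p M' M'') :
    Frame p M M'' :=
  ⟨fun r hr => (h'.nat r hr).trans (h.nat r hr), fun r hr => (h'.real r hr).trans (h.real r hr),
    fun r hr => (h'.natArr r hr).trans (h.natArr r hr),
    fun r hr => (h'.realArr r hr).trans (h.realArr r hr)⟩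

theorem Frame.of_imp {p q : Program} {M M' : Memory} (h : Frame p M M')
    (hpq : ∀ f, q.anyInstr f = false → p.anyInstr f = false) : Frame q M M' :=
  ⟨fun r hr => h.nat r (hpq _ hr), fun r hr => h.real r (hpq _ hr),
    fun r hr => h.natArr r (hpq _ hr), fun r hr => h.realArr r (hpq _ hr)⟩

theorem Instr.frame (c : Instr) (M : Memory) : Frame (.instr c) M (c.run M) := by
  constructor <;> intro r hr <;> cases c <;>
    simp_all [Program.anyInstr, Instr.run, Instr.writesNat, Instr.writesReal, Instr.writesNatArr,
      Instr.writesRealArr, Memory.setNatArr, Memory.setRealArr]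

/-- An execution changes nothing but what the program writes. -/
theorem Exec.frame {p : Program} {M M' : Memory} {t : ℕ} (h : Exec p M t M') : Frame p M M' := by
  induction h with
  | skip M => exact Frame.refl _ _
  | instr c M => exact c.frame M
  | seq _ _ ih ih' =>
    exact (ih.of_imp fun f hf => by simp_all [Program.anyInstr]).trans
      (ih'.of_imp fun f hf => by simp_all [Program.anyInstr])
  | ite_pos _ _ ih => exact ih.of_imp fun f hf => by simp_all [Program.anyInstr]
  | ite_neg _ _ ih => exact ih.of_imp fun f hf => by simp_all [Program.anyInstr]
  | loop_pos _ _ _ ih ih' => exact (ih.of_imp fun f hf => by simp_all [Program.anyInstr]).trans ih'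
  | loop_neg _ => exact Frame.refl _ _

/-- Started on `M`, the program halts after at most `t` steps, with a memory that satisfies `Q`. -/
def Terminates (p : Program) (M : Memory) (t : ℕ) (Q : Memory → Prop) : Prop :=
  ∃ t' M', Exec p M t' M' ∧ t' ≤ t ∧ Q M'

namespace Terminates

variable {p q : Program} {M : Memory} {t t' : ℕ} {Q Q' : Memory → Prop}

theorem mono (h : Terminates p M t Q) (ht : t ≤ t') (hQ : ∀ M', Frame p M M' → Q M' → Q' M') :
    Terminates p M t' Q' := by
  obtain ⟨s, M', he, hs, hq⟩ := h
  exact ⟨s, M', he, hs.trans ht, hQ M' he.frame hq⟩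

theorem skip (h : Q M) : Terminates .skip M 1 Q := ⟨1, M, .skip M, le_rfl, h⟩

theorem instr {c : Instr} (h : Q (c.run M)) : Terminates (.instr c) M 1 Q :=
  ⟨1, _, .instr c M, le_rfl, h⟩

theorem seq (h : Terminates p M t Q)
    (h' : ∀ M', Frame p M M' → Q M' → Terminates q M' t' Q') :
    Terminates (.seq p q) M (t + t') Q' := by
  obtain ⟨s, M', he, hs, hq⟩ := h
  obtain ⟨s', M'', he', hs', hq'⟩ := h' M' he.frame hq
  exact ⟨s + s', M'', he.seq he', by omega, hq'⟩

theorem ite {b : Test} (h : b.Holds M → Terminates p M t Q)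
    (h' : ¬ b.Holds M → Terminates q M t Q) : Terminates (.ite b p q) M (t + 1) Q := by
  by_cases hb : b.Holds M
  · obtain ⟨s, M', he, hs, hq⟩ := h hb
    exact ⟨s + 1, M', he.ite_pos hb, by omega, hq⟩
  · obtain ⟨s, M', he, hs, hq⟩ := h' hb
    exact ⟨s + 1, M', he.ite_neg hb, by omega, hq⟩

theorem block {cs : List Instr} (h : Q (cs.foldl (fun M c => c.run M) M)) :
    Terminates (.block cs) M (cs.length + 1) Q := by
  induction cs generalizing M with
  | nil => exact skip h
  | cons c cs ih =>
    rw [List.length_cons, add_comm cs.length, add_assoc]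
    exact seq (Q := fun M' => M' = c.run M) (instr rfl) fun M' _ hM' => hM' ▸ ih h

/-- The number `k` for which `Inv k` holds decreases in each pass through the loop, and so bounds
the number of passes. -/
theorem loop {b : Test} {c : ℕ} (Inv : ℕ → Memory → Prop) {k : ℕ} (h0 : Inv k M)
    (h : ∀ k M', Frame (.loop b p) M M' → Inv k M' → b.Holds M' →
      Terminates p M' c fun M'' => ∃ k' < k, Inv k' M'') :
    Terminates (.loop b p) M (k * (c + 1) + 1) fun M' => (∃ k', Inv k' M') ∧ ¬ b.Holds M' := by
  suffices key : ∀ k M', Frame (.loop b p) M M' → Inv k M' →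
      Terminates (.loop b p) M' (k * (c + 1) + 1) fun M' => (∃ k', Inv k' M') ∧ ¬ b.Holds M' from
    key k M (Frame.refl _ _) h0
  intro k
  induction k using Nat.strong_induction_on with
  | _ k ih =>
    intro M' hf hi
    by_cases hb : b.Holds M'
    · obtain ⟨s, M'', he, hs, k', hk', hi'⟩ := h k M' hf hi hb
      obtain ⟨s', M3, he', hs', hq⟩ := ih k' hk' M'' (hf.trans (he.frame.of_imp fun f hf => hf)) hi'
      refine ⟨s + s' + 1, M3, he.loop_pos hb he', ?_, hq⟩
      have : k' * (c + 1) + (c + 1) ≤ k * (c + 1) := by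
        rw [← Nat.succ_mul]; exact Nat.mul_le_mul_right _ hk'
      omega
    · exact ⟨1, M', .loop_neg hb, by omega, ⟨k, hi⟩, hb⟩

/-- `Inv k` holds when the counter `i` is equal to `k`.  The successor is assigned to the counter
after `p`, which explains the memory `M''.setNat i (k + 1)`. -/
theorem forUpTo {i b N c : ℕ} (Inv : ℕ → Memory → Prop) (hN : M.nat b = N)
    (hb : (Program.forUpTo i b p).anyInstr (·.writesNat b) = false)
    (hi : p.anyInstr (·.writesNat i) = false) (h0 : Inv 0 (M.setNat i 0))
    (h : ∀ k M', k < N → M'.nat i = k → Frame (.forUpTo i b p) M M' → Inv k M' →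
      Terminates p M' c fun M'' => Inv (k + 1) (M''.setNat i (k + 1))) :
    Terminates (.forUpTo i b p) M (N * (c + 2) + 2) fun M' => M'.nat i = N ∧ Inv N M' := by
  have key : ∀ d k M', N = k + d → M'.nat i = k → Frame (.forUpTo i b p) M M' → Inv k M' →
      Terminates (.loop (.natLt i b) (.seq p (.instr (.natSucc i i)))) M' (d * (c + 2) + 1)
        fun M' => M'.nat i = N ∧ Inv N M' := by
    intro d
    induction d with
    | zero =>
      intro k M' hk hik hf hinv
      have hbN : M'.nat b = N := (hf.nat b hb).trans hN
      refine ⟨1, M', .loop_neg ?_, by omega, ?_⟩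
      · simp only [Test.Holds]; omega
      · rw [hk, add_zero]; exact ⟨hik, hinv⟩
    | succ d ih =>
      intro k M' hk hik hf hinv
      have hbN : M'.nat b = N := (hf.nat b hb).trans hN
      obtain ⟨s, M'', he, hs, hq⟩ := h k M' (by omega) hik hf hinv
      have hik' : M''.nat i = k := (he.frame.nat i hi).trans hik
      have he2 : Exec (.seq p (.instr (.natSucc i i))) M' (s + 1) (M''.setNat i (k + 1)) := by
        have := he.seq (.instr (.natSucc i i) M'')
        simpa only [Instr.run, hik'] using this
      have hf2 : Frame (.forUpTo i b p) M (M''.setNat i (k + 1)) := by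
        refine hf.trans (he2.frame.of_imp fun f hf => ?_)
        simp_all [Program.anyInstr, Program.forUpTo]
      obtain ⟨s', M3, he', hs', hq'⟩ := ih (k + 1) (M''.setNat i (k + 1)) (by omega) (by simp)
        hf2 hq
      refine ⟨s + 1 + s' + 1, M3, he2.loop_pos ?_ he', ?_, hq'⟩
      · simp only [Test.Holds]; omega
      · rw [Nat.succ_mul]; omega
  have hf0 : Frame (.forUpTo i b p) M (M.setNat i 0) :=
    (Instr.frame (.natConst i 0) M).of_imp fun f hf => by
      simp_all [Program.anyInstr, Program.forUpTo]
  obtain ⟨s, M', he, hs, hq⟩ := key N 0 (M.setNat i 0) (by omega) (by simp) hf0 h0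
  refine ⟨1 + s, M', ?_, by omega, hq⟩
  exact (Exec.instr (.natConst i 0) M).seq he

end Terminates

namespace Program

/-- The program has no loop. -/
def loopFree : Program → Bool
  | skip => true
  | instr _ => true
  | seq p q => p.loopFree && q.loopFree
  | ite _ p q => p.loopFree && q.loopFree
  | loop _ _ => false

/-- An upper bound on the number of steps of a program without loops. -/
def cost : Program → ℕ
  | skip => 1
  | instr _ => 1
  | seq p q => p.cost + q.cost
  | ite _ p q => max p.cost q.cost + 1
  | loop _ _ => 0

open Classical in
/-- The effect of a program without loops. -/
noncomputable def effect : Program → Memory → Memory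
  | skip, M => M
  | instr c, M => c.run M
  | seq p q, M => q.effect (p.effect M)
  | ite b p q, M => if b.Holds M then p.effect M else q.effect M
  | loop _ _, M => M

end Program

/-- For programs without loops, the postcondition can be proved by computation of the effect. -/
theorem Terminates.of_loopFree {p : Program} (hp : p.loopFree = true) {M : Memory}
    {Q : Memory → Prop} (h : Q (p.effect M)) : Terminates p M p.cost Q := by
  induction p generalizing M Q with
  | skip => exact .skip h
  | instr c => exact .instr h
  | seq p q ihp ihq =>
    simp only [Program.loopFree, Bool.and_eq_true] at hp
    exact (ihp hp.1 (Q := fun M' => M' = p.effect M) rfl).seq fun M' _ hM' => ihq hp.2 (hM' ▸ h)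
  | ite b p q ihp ihq =>
    simp only [Program.loopFree, Bool.and_eq_true] at hp
    refine .ite (fun hb => ?_) fun hb => ?_
    · exact (ihp hp.1 (by simpa [Program.effect, hb] using h)).mono (le_max_left _ _) fun _ _ h => h
    · exact (ihq hp.2 (by simpa [Program.effect, hb] using h)).mono (le_max_right _ _)
        fun _ _ h => h
  | loop b p => simp [Program.loopFree] at hp

/-! ### The Hungarian method -/

section Hungarian

/-- The first `i` rows of the `K × K` matrix `w` are matched: the column `j` is matched with the row
`p j`, or is free, in which case `p j = K`.  The matched entries are tight for the feasible dual
variables `a` and `b`. -/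
structure IsMatching (K i : ℕ) (w : ℕ → ℕ → ℝ) (a b : ℕ → ℝ) (p : ℕ → ℕ) : Prop where
  range : ∀ j < K, p j < i ∨ p j = K
  inj : ∀ j < K, ∀ j' < K, p j < i → p j = p j' → j = j'
  surj : ∀ r < i, ∃ j < K, p j = r
  feas : ∀ r < i, ∀ j < K, w r j ≤ a r + b j
  tight : ∀ j < K, p j < i → a (p j) + b j = w (p j) j

/-- The number of columns that do not belong to the tree. -/
def unusedCount (K : ℕ) (used : ℕ → ℕ) : ℕ := ((Finset.range K).filter fun j => used j = 0).card

/-- An alternating tree for a matching, from the unmatched row `i`, which is regarded as matched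
with an additional column `K`.  The columns of the tree are those where `used` is not zero, and its
rows are those matched with them.  The column `j` has been reached through the row matched with the
column `way j`.  If it is not in the tree, then `mv j` is the smallest slack in this column of a row
of the tree, attained at the row matched with `way j`.  The function `rk` is the order in which the
columns have been reached.  The dual inequalities of the row `i` may fail as long as the tree has no
column other than `K` (`rootFeas`): they are established by the first change of the dual variables.
The bound `rankLe` on the ranks limits the length of the alternating path. -/
structure IsTree (K i : ℕ) (w : ℕ → ℕ → ℝ) (a b : ℕ → ℝ) (p way used : ℕ → ℕ) (mv : ℕ → ℝ)
    (rk : ℕ → ℕ) : Prop extends IsMatching K i w a b p where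
  lt : i < K
  root : p K = i
  usedRoot : used K ≠ 0
  rootFeas : (∀ j < K, used j = 0) ∨ ∀ j < K, w i j ≤ a i + b j
  usedMatched : ∀ j < K, used j ≠ 0 → p j < i
  wayUsed : ∀ j < K, way j ≤ K ∧ used (way j) ≠ 0
  wayRank : ∀ j < K, used j ≠ 0 → rk (way j) < rk j
  wayTight : ∀ j < K, used j ≠ 0 → a (p (way j)) + b j = w (p (way j)) j
  mvEq : ∀ j < K, used j = 0 → mv j = a (p (way j)) + b j - w (p (way j)) j
  mvLe : ∀ j < K, used j = 0 → ∀ j' ≤ K, used j' ≠ 0 → mv j ≤ a (p j') + b j - w (p j') j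
  rankLe : ∀ j ≤ K, used j ≠ 0 → rk j + unusedCount K used ≤ K

variable {K i : ℕ} {w : ℕ → ℕ → ℝ} {a b mv : ℕ → ℝ} {p way used : ℕ → ℕ} {rk : ℕ → ℕ}

theorem unusedCount_le : unusedCount K used ≤ K :=
  (Finset.card_filter_le _ _).trans (Finset.card_range K).le

theorem IsMatching.init (hp : ∀ j < K, p j = K) : IsMatching K 0 w a b p where
  range j hj := Or.inr (hp j hj)
  inj _ _ _ _ h := absurd h (Nat.not_lt_zero _)
  surj _ hr := absurd hr (Nat.not_lt_zero _)
  feas _ hr := absurd hr (Nat.not_lt_zero _)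
  tight _ _ h := absurd h (Nat.not_lt_zero _)

/-- A complete matching is an optimal assignment, by weak duality. -/
theorem IsMatching.exists_perm (h : IsMatching K K w a b p) :
    ∃ π : Equiv.Perm (Fin K), (∀ c : Fin K, p c = π c) ∧
      ∀ σ : Equiv.Perm (Fin K), ∑ c : Fin K, w (σ c) c ≤ ∑ c : Fin K, w (π c) c := by
  choose! col hcol hpcol using h.surj
  let f : Fin K → Fin K := fun r => ⟨col r, hcol r r.2⟩
  have hf : Function.Injective f := fun r r' hrr => Fin.ext (by
    have : col r = col r' := congrArg Fin.val hrr
    rw [← hpcol r r.2, this, hpcol r' r'.2])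
  let π := (Equiv.ofBijective f (Finite.injective_iff_bijective.1 hf)).symm
  have hπ : ∀ c : Fin K, p c = π c := by
    intro c
    have h1 : f (π c) = c := (Equiv.ofBijective f _).apply_symm_apply c
    have h2 : col (π c) = c := congrArg Fin.val h1
    rw [← hpcol (π c) (π c).2, h2]
  refine ⟨π, hπ, fun σ => ?_⟩
  have h1 : ∑ c : Fin K, w (π c) c = ∑ c : Fin K, (a (π c) + b c) :=
    Finset.sum_congr rfl fun c _ => by
      have := h.tight c c.2 (by rw [hπ]; exact (π c).2)
      rw [hπ] at this
      exact this.symm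
  have h2 : ∑ c : Fin K, w (σ c) c ≤ ∑ c : Fin K, (a (σ c) + b c) :=
    Finset.sum_le_sum fun c _ => h.feas _ (σ c).2 _ c.2
  rw [h1, Finset.sum_add_distrib, Equiv.sum_comp π fun r : Fin K => a r]
  rwa [Finset.sum_add_distrib, Equiv.sum_comp σ fun r : Fin K => a r] at h2

/-- The tree that consists of the unmatched row `i` and of the additional column `K` only. -/
theorem IsMatching.isTree {p' : ℕ → ℕ} (h : IsMatching K i w a b p) (hi : i < K)
    (hp : ∀ j < K, p' j = p j) (hpK : p' K = i) (hused : ∀ j < K, used j = 0)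
    (husedK : used K ≠ 0) (hway : ∀ j < K, way j = K)
    (hmv : ∀ j < K, mv j = a i + b j - w i j) :
    IsTree K i w a b p' way used mv fun _ => 0 where
  range j hj := by rw [hp j hj]; exact h.range j hj
  inj j hj j' hj' := by rw [hp j hj, hp j' hj']; exact h.inj j hj j' hj'
  surj r hr := by obtain ⟨j, hj, h⟩ := h.surj r hr; exact ⟨j, hj, by rw [hp j hj, h]⟩
  feas := h.feas
  tight j hj := by rw [hp j hj]; exact h.tight j hj
  lt := hi
  root := hpK
  usedRoot := husedK
  rootFeas := Or.inl hused
  usedMatched j hj hu := absurd (hused j hj) hu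
  wayUsed j hj := by rw [hway j hj]; exact ⟨le_rfl, husedK⟩
  wayRank j hj hu := absurd (hused j hj) hu
  wayTight j hj hu := absurd (hused j hj) hu
  mvEq j hj _ := by rw [hway j hj, hpK, hmv j hj]
  mvLe j hj _ j' hj' hu := by
    obtain rfl : j' = K := by
      by_contra hne
      exact hu (hused j' (by omega))
    rw [hpK, hmv j hj]
  rankLe _ _ _ := by rw [zero_add]; exact unusedCount_le

theorem IsTree.row_lt (h : IsTree K i w a b p way used mv rk) {j : ℕ} (hj : j ≤ K)
    (hu : used j ≠ 0) : p j < i + 1 := by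
  rcases hj.lt_or_eq with hj | rfl
  · exact (h.usedMatched j hj hu).trans (Nat.lt_succ_self i)
  · rw [h.root]; exact Nat.lt_succ_self i

theorem IsTree.inj' (h : IsTree K i w a b p way used mv rk) {j j' : ℕ} (hj : j ≤ K)
    (hj' : j' ≤ K) (hp : p j < i + 1) (he : p j = p j') : j = j' := by
  have hiK := h.lt
  have hr := h.root
  rcases hj.lt_or_eq with hj1 | rfl <;> rcases hj'.lt_or_eq with hj2 | rfl
  · rcases h.range j hj1 with h1 | h1
    · exact h.inj j hj1 j' hj2 h1 he
    · omega
  · rcases h.range j hj1 with h1 | h1 <;> omega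
  · rcases h.range j' hj2 with h1 | h1 <;> omega
  · rfl

/-- Some column does not belong to the tree: the columns of the tree are matched with rows before
`i`. -/
theorem IsTree.exists_unused (h : IsTree K i w a b p way used mv rk) : ∃ j < K, used j = 0 := by
  by_contra hne
  push Not at hne
  have hcard : (Finset.range K).card ≤ (Finset.range i).card := by
    refine Finset.card_le_card_of_injOn p (fun j hj => ?_) fun j hj j' hj' he => ?_
    · have hj := Finset.mem_range.1 hj
      simpa using h.usedMatched j hj (hne j hj)
    · have hj := Finset.mem_range.1 hj
      exact h.inj j hj j' (Finset.mem_range.1 hj') (h.usedMatched j hj (hne j hj)) he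
  have := h.lt
  simp at hcard
  omega

/-- Shifting the dual variables by the smallest slack `δ` makes the column `j₁` tight. -/
theorem IsTree.dualUpdate (h : IsTree K i w a b p way used mv rk) {a' b' mv' : ℕ → ℝ} {δ : ℝ}
    {j₁ : ℕ} (hj₁ : j₁ < K) (hu₁ : used j₁ = 0) (hδ : δ = mv j₁)
    (hmin : ∀ j < K, used j = 0 → δ ≤ mv j)
    (ha : ∀ j ≤ K, used j ≠ 0 → a' (p j) = a (p j) - δ)
    (ha' : ∀ r, (∀ j ≤ K, used j ≠ 0 → p j ≠ r) → a' r = a r)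
    (hb : ∀ j < K, b' j = if used j = 0 then b j else b j + δ)
    (hmv : ∀ j < K, used j = 0 → mv' j = mv j - δ) :
    IsTree K i w a' b' p way used mv' rk ∧ mv' j₁ = 0 ∧ ∀ j < K, w i j ≤ a' i + b' j := by
  have hiK := h.lt
  have hrootrow : a' i = a i - δ := by
    have := ha K le_rfl h.usedRoot
    rwa [h.root] at this
  have hδ0 : (∃ j < K, used j ≠ 0) → 0 ≤ δ := by
    rintro ⟨j, hj, hu⟩
    have hall : ∀ r < i + 1, ∀ j < K, w r j ≤ a r + b j := by
      intro r hr j' hj'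
      rcases Nat.lt_succ_iff_lt_or_eq.1 hr with hr | rfl
      · exact h.feas r hr j' hj'
      · rcases h.rootFeas with h1 | h1
        · exact absurd (h1 j hj) hu
        · exact h1 j' hj'
    obtain ⟨hw, hwu⟩ := h.wayUsed j₁ hj₁
    have h2 := hall _ (h.row_lt hw hwu) j₁ hj₁
    rw [hδ, h.mvEq j₁ hj₁ hu₁]; linarith
  have hroot : ∀ j < K, w i j ≤ a' i + b' j := by
    intro j hj
    rw [hrootrow, hb j hj]
    split_ifs with hu
    · have h1 := h.mvLe j hj hu K le_rfl h.usedRoot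
      rw [h.root] at h1
      have h2 := hmin j hj hu
      linarith
    · rcases h.rootFeas with h1 | h1
      · exact absurd (h1 j hj) hu
      · have := h1 j hj; linarith
  refine ⟨{
    range := h.range
    inj := h.inj
    surj := h.surj
    lt := h.lt
    root := h.root
    usedRoot := h.usedRoot
    usedMatched := h.usedMatched
    wayUsed := h.wayUsed
    wayRank := h.wayRank
    rankLe := h.rankLe
    feas := ?_, tight := ?_, rootFeas := Or.inr hroot, wayTight := ?_, mvEq := ?_, mvLe := ?_ },
    by rw [hmv j₁ hj₁ hu₁, hδ, sub_self], hroot⟩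
  · intro r hr j hj
    by_cases hrow : ∃ j' ≤ K, used j' ≠ 0 ∧ p j' = r
    · obtain ⟨j', hj', hu', rfl⟩ := hrow
      rw [ha j' hj' hu', hb j hj]
      split_ifs with hu
      · have h1 := h.mvLe j hj hu j' hj' hu'
        have h2 := hmin j hj hu
        linarith
      · have := h.feas _ hr j hj; linarith
    · push Not at hrow
      rw [ha' r hrow, hb j hj]
      have := h.feas r hr j hj
      split_ifs with hu
      · exact this
      · have := hδ0 ⟨j, hj, hu⟩; linarith
  · intro j hj hp
    have ht := h.tight j hj hp
    by_cases hu : used j = 0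
    · rw [hb j hj, if_pos hu, ha', ht]
      intro j' hj' hu' he
      have := h.inj' hj' hj.le (by omega) he
      exact hu' (this ▸ hu)
    · rw [ha j hj.le hu, hb j hj, if_neg hu]; linarith
  · intro j hj hu
    obtain ⟨hw, hwu⟩ := h.wayUsed j hj
    have := h.wayTight j hj hu
    rw [ha _ hw hwu, hb j hj, if_neg hu]; linarith
  · intro j hj hu
    obtain ⟨hw, hwu⟩ := h.wayUsed j hj
    have := h.mvEq j hj hu
    rw [hmv j hj hu, ha _ hw hwu, hb j hj, if_pos hu]; linarith
  · intro j hj hu j' hj' hu'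
    have := h.mvLe j hj hu j' hj' hu'
    rw [hmv j hj hu, ha _ hj' hu', hb j hj, if_pos hu]; linarith

/-- A tight matched column enters the tree. -/
theorem IsTree.grow (h : IsTree K i w a b p way used mv rk) {way' used' : ℕ → ℕ} {mv' : ℕ → ℝ}
    {j₁ : ℕ} (hj₁ : j₁ < K) (hu₁ : used j₁ = 0) (h0 : mv j₁ = 0)
    (hroot : ∀ j < K, w i j ≤ a i + b j) (hp₁ : p j₁ ≠ K)
    (hused : ∀ j ≤ K, used' j = if j = j₁ then 1 else used j)
    (hmv : ∀ j < K, used' j = 0 → mv' j = if a (p j₁) + b j - w (p j₁) j < mv j then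
      a (p j₁) + b j - w (p j₁) j else mv j)
    (hway : ∀ j < K, way' j = if used' j = 0 ∧ a (p j₁) + b j - w (p j₁) j < mv j then j₁
      else way j) :
    IsTree K i w a b p way' used' mv' (Function.update rk j₁ (K - unusedCount K used')) ∧
      unusedCount K used' < unusedCount K used := by
  have hpi : p j₁ < i := (h.range j₁ hj₁).resolve_right hp₁
  have hV : unusedCount K used' + 1 = unusedCount K used := by
    have : (Finset.range K).filter (fun j => used' j = 0) =
        ((Finset.range K).filter fun j => used j = 0).erase j₁ := by
      ext j
      simp only [Finset.mem_filter, Finset.mem_range, Finset.mem_erase]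
      constructor
      · rintro ⟨hj, hu⟩
        rw [hused j hj.le] at hu
        split_ifs at hu with hjj
        exact ⟨hjj, hj, hu⟩
      · rintro ⟨hjj, hj, hu⟩
        exact ⟨hj, by rw [hused j hj.le, if_neg hjj, hu]⟩
    rw [unusedCount, this, unusedCount, Finset.card_erase_add_one]
    simp [hj₁, hu₁]
  have hmono : ∀ j ≤ K, used j ≠ 0 → used' j ≠ 0 := by
    intro j hj hu
    rw [hused j hj]
    split_ifs
    · exact one_ne_zero
    · exact hu
  have hold : ∀ j < K, used' j = 0 → j ≠ j₁ ∧ used j = 0 := by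
    intro j hj hu
    rw [hused j hj.le] at hu
    split_ifs at hu with hjj
    exact ⟨hjj, hu⟩
  have husedj : used' j₁ ≠ 0 := by rw [hused j₁ hj₁.le, if_pos rfl]; exact one_ne_zero
  have hcases : ∀ j ≤ K, used' j ≠ 0 → j = j₁ ∨ used j ≠ 0 := by
    intro j hj hu
    rw [hused j hj] at hu
    split_ifs at hu with hjj
    · exact Or.inl hjj
    · exact Or.inr hu
  have hway1 : ∀ j < K, used' j ≠ 0 → way' j = way j := by
    intro j hj hu
    rw [hway j hj, if_neg fun hh => hu hh.1]
  have hne : ∀ j, used j ≠ 0 → j ≠ j₁ := fun j hu he => hu (he ▸ hu₁)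
  have hVK : unusedCount K used ≤ K := unusedCount_le
  refine ⟨{
    range := h.range
    inj := h.inj
    surj := h.surj
    feas := h.feas
    tight := h.tight
    lt := h.lt
    root := h.root
    usedRoot := hmono K le_rfl h.usedRoot
    rootFeas := Or.inr hroot
    usedMatched := ?_, wayUsed := ?_, wayRank := ?_, wayTight := ?_, mvEq := ?_, mvLe := ?_,
    rankLe := ?_ }, by omega⟩
  · intro j hj hu
    rcases hcases j hj.le hu with rfl | hu
    · exact hpi
    · exact h.usedMatched j hj hu
  · intro j hj
    obtain ⟨hw, hwu⟩ := h.wayUsed j hj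
    rw [hway j hj]
    split_ifs
    · exact ⟨hj₁.le, husedj⟩
    · exact ⟨hw, hmono _ hw hwu⟩
  · intro j hj hu
    obtain ⟨hw, hwu⟩ := h.wayUsed j hj
    rw [hway1 j hj hu, Function.update_of_ne (hne _ hwu)]
    rcases hcases j hj.le hu with rfl | hu'
    · rw [Function.update_self]
      have := h.rankLe _ hw hwu
      omega
    · rw [Function.update_of_ne (hne _ hu')]
      exact h.wayRank j hj hu'
  · intro j hj hu
    rw [hway1 j hj hu]
    rcases hcases j hj.le hu with rfl | hu'
    · have := h.mvEq j hj hu₁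
      rw [h0] at this; linarith
    · exact h.wayTight j hj hu'
  · intro j hj hu
    rw [hmv j hj hu, hway j hj]
    by_cases hlt : a (p j₁) + b j - w (p j₁) j < mv j
    · rw [if_pos hlt, if_pos ⟨hu, hlt⟩]
    · rw [if_neg hlt, if_neg fun hh => hlt hh.2]
      exact h.mvEq j hj (hold j hj hu).2
  · intro j hj hu j' hj' hu'
    rw [hmv j hj hu]
    rcases hcases j' hj' hu' with rfl | hu'
    · split_ifs with hlt
      · exact le_rfl
      · exact not_lt.1 hlt
    · have := h.mvLe j hj (hold j hj hu).2 j' hj' hu'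
      split_ifs with hlt
      · linarith
      · exact this
  · intro j hj hu
    rcases hcases j hj hu with rfl | hu'
    · rw [Function.update_self]; omega
    · rw [Function.update_of_ne (hne _ hu')]
      have := h.rankLe j hj hu'
      omega

/-- While an alternating path is flipped, from the free column `j₁` to the root, the column `j₀`
waits for its new row: the other columns are matched with the rows up to `i`. -/
structure IsFlip (K i : ℕ) (w : ℕ → ℕ → ℝ) (a b : ℕ → ℝ) (p₀ used : ℕ → ℕ) (rk : ℕ → ℕ)
    (j₁ : ℕ) (p : ℕ → ℕ) (j₀ : ℕ) : Prop where
  le : j₀ ≤ K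
  onPath : used j₀ ≠ 0 ∨ j₀ = j₁
  range : ∀ j ≤ K, j ≠ j₀ → p j < i + 1 ∨ p j = K
  inj : ∀ j ≤ K, j ≠ j₀ → ∀ j' ≤ K, j' ≠ j₀ → p j < i + 1 → p j = p j' → j = j'
  surj : ∀ r < i + 1, ∃ j ≤ K, j ≠ j₀ ∧ p j = r
  tight : ∀ j < K, j ≠ j₀ → p j < i + 1 → a (p j) + b j = w (p j) j
  orig : ∀ j ≤ K, used j ≠ 0 → (j₀ = j₁ ∨ rk j < rk j₀) → p j = p₀ j

/-- Before any step of the exchange along the alternating path, the free column `j₁` is the one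
that waits for its new row. -/
theorem IsTree.isFlip (h : IsTree K i w a b p way used mv rk) {j₁ : ℕ} (hj₁ : j₁ < K)
    (hfree : p j₁ = K) : IsFlip K i w a b p used rk j₁ p j₁ where
  le := hj₁.le
  onPath := Or.inr rfl
  range j hj hne := by
    have := h.root
    rcases hj.lt_or_eq with hj | rfl
    · rcases h.range j hj with h1 | h1
      · left; omega
      · exact Or.inr h1
    · left; omega
  inj j hj _ j' hj' _ hp he := h.inj' hj hj' hp he
  surj r hr := by
    have hiK := h.lt
    rcases Nat.lt_succ_iff_lt_or_eq.1 hr with hr | rfl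
    · obtain ⟨j, hj, hp⟩ := h.surj r hr
      exact ⟨j, hj.le, by rintro rfl; omega, hp⟩
    · exact ⟨K, le_rfl, hj₁.ne', h.root⟩
  tight j hj _ hp := by
    have hiK := h.lt
    rcases h.range j hj with h1 | h1
    · exact h.tight j hj h1
    · omega
  orig _ _ _ _ := rfl

/-- The column that waits takes the row through which it has been reached. -/
theorem IsFlip.step {p₀ p' : ℕ → ℕ} {j₀ j₁ : ℕ} (h : IsFlip K i w a b p₀ used rk j₁ p j₀)
    (ht : IsTree K i w a b p₀ way used mv rk) (hu₁ : used j₁ = 0) (h0 : mv j₁ = 0) (hK : j₀ ≠ K)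
    (hp' : ∀ j ≤ K, p' j = if j = j₀ then p (way j₀) else p j) :
    IsFlip K i w a b p₀ used rk j₁ p' (way j₀) ∧ (j₀ = j₁ ∨ rk (way j₀) < rk j₀) := by
  have hj₀ : j₀ < K := lt_of_le_of_ne h.le hK
  obtain ⟨hw, hwu⟩ := ht.wayUsed j₀ hj₀
  have hrk : j₀ = j₁ ∨ rk (way j₀) < rk j₀ := by
    rcases h.onPath with hu | hu
    · exact Or.inr (ht.wayRank j₀ hj₀ hu)
    · exact Or.inl hu
  have hwne : way j₀ ≠ j₀ := by
    intro he
    rcases hrk with hh | hh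
    · rw [he, hh] at hwu; exact hwu hu₁
    · rw [he] at hh; exact lt_irrefl _ hh
  have horig : p (way j₀) = p₀ (way j₀) := h.orig _ hw hwu hrk
  have hrow : p (way j₀) < i + 1 := by rw [horig]; exact ht.row_lt hw hwu
  have hself : p' j₀ = p (way j₀) := by rw [hp' _ h.le, if_pos rfl]
  have hother : ∀ j ≤ K, j ≠ j₀ → p' j = p j := fun j hj hne => by rw [hp' j hj, if_neg hne]
  refine ⟨⟨hw, Or.inl hwu, ?_, ?_, ?_, ?_, ?_⟩, hrk⟩
  · intro j hj hne
    by_cases hjj : j = j₀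
    · rw [hjj, hself]; exact Or.inl hrow
    · rw [hother j hj hjj]; exact h.range j hj hjj
  · intro j hj hne j' hj' hne' hp he
    by_cases hjj : j = j₀ <;> by_cases hjj' : j' = j₀
    · rw [hjj, hjj']
    · rw [hjj, hself, hother j' hj' hjj'] at he
      exact absurd (h.inj _ hw hwne j' hj' hjj' hrow he).symm hne'
    · rw [hjj', hself, hother j hj hjj] at he
      exact absurd (h.inj _ hw hwne j hj hjj hrow he.symm).symm hne
    · rw [hother j hj hjj] at hp he
      rw [hother j' hj' hjj'] at he
      exact h.inj j hj hjj j' hj' hjj' hp he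
  · intro r hr
    obtain ⟨j, hj, hne, hpj⟩ := h.surj r hr
    by_cases hjw : j = way j₀
    · exact ⟨j₀, h.le, hwne.symm, by rw [hself, ← hjw, hpj]⟩
    · exact ⟨j, hj, hjw, by rw [hother j hj hne, hpj]⟩
  · intro j hj hne hp
    by_cases hjj : j = j₀
    · rw [hjj, hself, horig]
      rcases h.onPath with hu | hu
      · exact ht.wayTight j₀ hj₀ hu
      · have := ht.mvEq j₀ hj₀ (by rw [hu, hu₁])
        rw [hu, h0] at this
        rw [hu]; linarith
    · rw [hother j hj.le hjj] at hp ⊢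
      exact h.tight j hj hjj hp
  · intro j hj hu hlt
    have hne : j ≠ j₀ := by
      rintro rfl
      rcases hlt with hlt | hlt
      · exact hwu (hlt ▸ hu₁)
      · rcases hrk with hh | hh
        · exact hu (hh ▸ hu₁)
        · omega
    rw [hother j hj hne]
    refine h.orig j hj hu ?_
    rcases hlt with hlt | hlt
    · exact absurd hu₁ (hlt ▸ hwu)
    · rcases hrk with hh | hh
      · exact Or.inl hh
      · exact Or.inr (hlt.trans hh)

/-- When the column that waits is the additional column `K`, the row `i` has been matched. -/
theorem IsFlip.isMatching {p₀ : ℕ → ℕ} {j₁ : ℕ} (h : IsFlip K i w a b p₀ used rk j₁ p K)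
    (ht : IsTree K i w a b p₀ way used mv rk) (hroot : ∀ j < K, w i j ≤ a i + b j) :
    IsMatching K (i + 1) w a b p where
  range j hj := h.range j hj.le hj.ne
  inj j hj j' hj' hp he := h.inj j hj.le hj.ne j' hj'.le hj'.ne hp he
  surj r hr := by
    obtain ⟨j, hj, hne, hp⟩ := h.surj r hr
    exact ⟨j, lt_of_le_of_ne hj hne, hp⟩
  feas r hr j hj := by
    rcases Nat.lt_succ_iff_lt_or_eq.1 hr with hr | rfl
    · exact ht.feas r hr j hj
    · exact hroot j hj
  tight j hj hp := h.tight j hj hj.ne hp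

end Hungarian

/-! ### The program for the assignment problem

The register `4` contains the constant `0` and the register `5` the constant `1`; the register `6`
contains the order `K` of the matrix, and the register `7` the number `K + 1`.  The row `i` to be
matched is in register `8`, the column that enters the tree in register `10`, and the register `11`
is `1` as long as the search goes on.  The real arrays `1` to `4` contain the matrix `w`, the dual
variables `a` and `b`, and the slacks `mv`.  The arrays `8`, `9`, `10` of natural numbers contain
`p`, `way` and `used`.  One-dimensional data are in the row `0` of an array.  The column `K` is an
additional one, regarded as matched with the row `i`. -/

section Solver

open Instr Test Program

/-- The slack of the entry `(r, j)` of the matrix in the real array `1`, for the dual variables in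
the real arrays `2` and `3`. -/
def slackAt (M : Memory) (r j : ℕ) : ℝ := M.realArr 2 0 r + M.realArr 3 0 j - M.realArr 1 r j

/-- Relaxation of the columns outside the tree, when the column in register `10`, matched with
the row in register `13`, enters the tree. -/
def relaxLoop : Program :=
  forUpTo 9 6 (seq (instr (natLoad 12 10 4 9)) (ite (natEq 12 4)
    (seq (block [realLoad 0 2 4 13, realLoad 1 3 4 9, realAdd 0 0 1, realLoad 1 1 13 9,
      realSub 0 0 1, realLoad 1 4 4 9])
      (ite (realLt 0 1) (block [realStore 4 4 9 0, natStore 9 4 9 10]) skip)) skip))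

theorem relaxLoop_spec {M : Memory} {K : ℕ} (hZ : M.nat 4 = 0) (hK : M.nat 6 = K) :
    Terminates relaxLoop M (30 * K + 2) fun M' => ∀ j < K,
      (M'.realArr 4 0 j = if M.natArr 10 0 j = 0 ∧ slackAt M (M.nat 13) j < M.realArr 4 0 j then
        slackAt M (M.nat 13) j else M.realArr 4 0 j) ∧
      (M'.natArr 9 0 j = if M.natArr 10 0 j = 0 ∧ slackAt M (M.nat 13) j < M.realArr 4 0 j then
        M.nat 10 else M.natArr 9 0 j) := by
  refine (Terminates.forUpTo (N := K) (c := 28) (fun k M' => ∀ j,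
      (M'.realArr 4 0 j = if j < k ∧ M.natArr 10 0 j = 0 ∧ slackAt M (M.nat 13) j <
        M.realArr 4 0 j then slackAt M (M.nat 13) j else M.realArr 4 0 j) ∧
      (M'.natArr 9 0 j = if j < k ∧ M.natArr 10 0 j = 0 ∧ slackAt M (M.nat 13) j <
        M.realArr 4 0 j then M.nat 10 else M.natArr 9 0 j)) hK rfl rfl (by simp) ?_).mono
    (by omega) fun M' _ hM' j hj => by simpa [hj] using hM'.2 j
  intro k M' hk hik hf hinv
  have e4 := hf.nat 4 rfl
  have e13 := hf.nat 13 rfl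
  have e10 := hf.nat 10 rfl
  have a10 := hf.natArr 10 rfl
  have hs : M.realArr 2 0 (M.nat 13) + M.realArr 3 0 k - M.realArr 1 (M.nat 13) k =
    slackAt M (M.nat 13) k := rfl
  obtain ⟨hk1, hk2⟩ := hinv k
  simp only [lt_irrefl, false_and, if_false] at hk1 hk2
  refine (Terminates.of_loopFree rfl ?_).mono (t := Program.cost _) (by decide) fun _ _ h => h
  by_cases hu : M.natArr 10 0 k = 0
  · by_cases hlt : slackAt M (M.nat 13) k < M.realArr 4 0 k
    · simp [effect, block, Instr.run, Test.Holds, e4, hZ, hik, a10, hu, hf.realArr 1 rfl,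
        hf.realArr 2 rfl, hf.realArr 3 rfl, e13, hk1, hs, hlt, e10]
      intro j
      obtain ⟨hj1, hj2⟩ := hinv j
      by_cases hjk : j = k
      · subst hjk; simp [hu, hlt]
      · simp [hjk, hj1, hj2, show j ≤ k ↔ j < k by omega]
    · simp [effect, block, Instr.run, Test.Holds, e4, hZ, hik, a10, hu, hf.realArr 1 rfl,
        hf.realArr 2 rfl, hf.realArr 3 rfl, e13, hk1, hs, hlt]
      intro j
      obtain ⟨hj1, hj2⟩ := hinv j
      by_cases hjk : j = k
      · subst hjk; simp [hj1, hj2, hlt]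
      · simp [hj1, hj2, show j ≤ k ↔ j < k by omega]
  · simp [effect, Instr.run, Test.Holds, e4, hZ, hik, a10, hu]
    intro j
    obtain ⟨hj1, hj2⟩ := hinv j
    by_cases hjk : j = k
    · subst hjk; simp [hj1, hj2, hu]
    · simp [hj1, hj2, show j ≤ k ↔ j < k by omega]

/-- A tree reduced to its root, the row in register `8`. -/
def initTree : Program :=
  seq (forUpTo 9 6 (block [natStore 9 4 9 6, natStore 10 4 9 4, realLoad 0 2 4 8,
    realLoad 1 3 4 9, realAdd 0 0 1, realLoad 1 1 8 9, realSub 0 0 1, realStore 4 4 9 0]))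
    (block [natStore 8 4 6 8, natStore 10 4 6 5])

theorem initTree_spec {M : Memory} {K : ℕ} (hZ : M.nat 4 = 0) (hone : M.nat 5 = 1)
    (hK : M.nat 6 = K) :
    Terminates initTree M (20 * K + 5) fun M' => (∀ j < K, M'.natArr 9 0 j = K ∧
      M'.natArr 10 0 j = 0 ∧ M'.realArr 4 0 j = slackAt M (M.nat 8) j) ∧
      (∀ j < K, M'.natArr 8 0 j = M.natArr 8 0 j) ∧ M'.natArr 8 0 K = M.nat 8 ∧
      M'.natArr 10 0 K = 1 := by
  refine ((Terminates.forUpTo (N := K) (c := 18) (fun k M' => ∀ j < k, M'.natArr 9 0 j = K ∧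
      M'.natArr 10 0 j = 0 ∧ M'.realArr 4 0 j = slackAt M (M.nat 8) j) hK rfl rfl
      (fun j hj => absurd hj (Nat.not_lt_zero _)) ?_).seq
    (Q' := fun M' => (∀ j < K, M'.natArr 9 0 j = K ∧
      M'.natArr 10 0 j = 0 ∧ M'.realArr 4 0 j = slackAt M (M.nat 8) j) ∧
      (∀ j < K, M'.natArr 8 0 j = M.natArr 8 0 j) ∧ M'.natArr 8 0 K = M.nat 8 ∧
      M'.natArr 10 0 K = 1) fun M' hf hM' => Terminates.block ?_).mono
    (by simp only [List.length]; omega) fun _ _ h => h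
  · intro k M' hk hik hf hinv
    have e4 := hf.nat 4 rfl
    have e6 := hf.nat 6 rfl
    have e8 := hf.nat 8 rfl
    have hs : M.realArr 2 0 (M.nat 8) + M.realArr 3 0 k - M.realArr 1 (M.nat 8) k =
      slackAt M (M.nat 8) k := rfl
    refine (Terminates.of_loopFree rfl ?_).mono (t := Program.cost _) (by decide) fun _ _ h => h
    simp only [effect, block, Instr.run]
    intro j hj
    by_cases hjk : j = k
    · subst hjk
      simp [e4, e6, e8, hZ, hK, hik, hf.realArr 1 rfl, hf.realArr 2 rfl, hf.realArr 3 rfl, hs]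
    · simpa [e4, hZ, hik, hjk] using hinv j (by omega)
  · have e4 := hf.nat 4 rfl
    have e5 := hf.nat 5 rfl
    have e6 := hf.nat 6 rfl
    have e8 := hf.nat 8 rfl
    have a8 := hf.natArr 8 rfl
    have := hM'.2
    simp only [List.foldl, Instr.run]
    refine ⟨fun j hj => ?_, fun j hj => ?_, ?_, ?_⟩
    · simpa [hj.ne, e6, hK] using this j hj
    · simp [hj.ne, e6, hK, a8]
    · simp [e4, e6, e8, hZ, hK]
    · simp [e4, e6, e5, hZ, hK, hone]

/-- Search of the column outside the tree with the smallest slack. -/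
def findColumn : Program :=
  seq (instr (natCopy 10 6)) (forUpTo 9 6 (seq (instr (natLoad 12 10 4 9)) (ite (natEq 12 4)
    (seq (instr (realLoad 0 4 4 9)) (ite (natEq 10 6) (block [natCopy 10 9, realCopy 2 0])
      (ite (realLt 0 2) (block [natCopy 10 9, realCopy 2 0]) skip))) skip)))

theorem findColumn_spec {M : Memory} {K : ℕ} (hZ : M.nat 4 = 0) (hK : M.nat 6 = K)
    (hex : ∃ j < K, M.natArr 10 0 j = 0) :
    Terminates findColumn M (20 * K + 5) fun M' => ∃ j₁ < K, M'.nat 10 = j₁ ∧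
      M.natArr 10 0 j₁ = 0 ∧ M'.real 2 = M.realArr 4 0 j₁ ∧
      ∀ j < K, M.natArr 10 0 j = 0 → M'.real 2 ≤ M.realArr 4 0 j := by
  refine ((Terminates.instr (Q := fun M' => M' = M.setNat 10 (M.nat 6)) rfl).seq (t' := 20 * K + 4)
    fun M1 _ hM1 => ?_).mono (by omega) fun _ _ h => h
  subst hM1
  refine (Terminates.forUpTo (N := K) (c := 16) (fun k M' =>
    (M'.nat 10 = K ∧ ∀ j < k, M.natArr 10 0 j ≠ 0) ∨ ∃ j₁ < k, M'.nat 10 = j₁ ∧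
      M.natArr 10 0 j₁ = 0 ∧ M'.real 2 = M.realArr 4 0 j₁ ∧
      ∀ j < k, M.natArr 10 0 j = 0 → M'.real 2 ≤ M.realArr 4 0 j) (by simp [hK]) rfl rfl
      (by left; simp [hK]) ?_).mono (by omega) fun M' _ hM' => ?_
  · intro k M' hk hik hf hinv
    have e4 : M'.nat 4 = 0 := (hf.nat 4 rfl).trans (by simpa using hZ)
    have e6 : M'.nat 6 = K := (hf.nat 6 rfl).trans (by simpa using hK)
    have a10 : M'.natArr 10 = M.natArr 10 := hf.natArr 10 rfl
    have a4 : M'.realArr 4 = M.realArr 4 := hf.realArr 4 rfl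
    refine (Terminates.of_loopFree rfl ?_).mono (t := Program.cost _) (by decide) fun _ _ h => h
    by_cases hu : M.natArr 10 0 k = 0
    · have htake : ∀ M'' : Memory, M''.nat 10 = k → M''.real 2 = M.realArr 4 0 k →
          (∀ j < k, M.natArr 10 0 j = 0 → M.realArr 4 0 k ≤ M.realArr 4 0 j) →
          ∃ j₁ < k + 1, M''.nat 10 = j₁ ∧
          M.natArr 10 0 j₁ = 0 ∧ M''.real 2 = M.realArr 4 0 j₁ ∧
          ∀ j < k + 1, M.natArr 10 0 j = 0 → M''.real 2 ≤ M.realArr 4 0 j := by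
        intro M'' h1 h2 h3
        refine ⟨k, by omega, h1, hu, h2, fun j hj hju => ?_⟩
        rcases Nat.lt_succ_iff_lt_or_eq.1 hj with hj | rfl
        · rw [h2]; exact h3 j hj hju
        · rw [h2]
      rcases hinv with ⟨h1, h2⟩ | ⟨j₁, hj₁, h1, h2, h3, h4⟩
      · right
        refine htake _ ?_ ?_ fun j hj hju => absurd hju (h2 j hj)
        all_goals simp [effect, block, Instr.run, Test.Holds, e4, e6, hik, a10, a4, hu, h1]
      · by_cases hlt : M.realArr 4 0 k < M.realArr 4 0 j₁
        · right
          refine htake _ ?_ ?_ fun j hj hju => hlt.le.trans (h3 ▸ h4 j hj hju)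
          all_goals simp [effect, block, Instr.run, Test.Holds, e4, e6, hik, a10, a4, hu, h1,
            show j₁ ≠ K by omega, h3, hlt]
        · right
          refine ⟨j₁, by omega, ?_, h2, ?_, fun j hj hju => ?_⟩
          · simp [effect, Instr.run, Test.Holds, e4, e6, hik, a10, a4, hu, h1,
              show j₁ ≠ K by omega, h3, hlt]
          · simp [effect, Instr.run, Test.Holds, e4, e6, hik, a10, a4, hu, h1,
              show j₁ ≠ K by omega, h3, hlt]
          · have : M.realArr 4 0 j₁ ≤ M.realArr 4 0 j := by
              rcases Nat.lt_succ_iff_lt_or_eq.1 hj with hj | rfl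
              · exact h3 ▸ h4 j hj hju
              · exact not_lt.1 hlt
            simpa [effect, Instr.run, Test.Holds, e4, e6, hik, a10, a4, hu, h1,
              show j₁ ≠ K by omega, h3, hlt] using this
    · have hlast : ∀ j < k + 1, M.natArr 10 0 j = 0 → j < k := by
        intro j hj hju
        rcases Nat.lt_succ_iff_lt_or_eq.1 hj with hj | rfl
        · exact hj
        · exact absurd hju hu
      simp only [effect, Instr.run, Test.Holds, a10, e4, Memory.setNat_nat, hik]
      rcases hinv with ⟨h1, h2⟩ | ⟨j₁, hj₁, h1, h2, h3, h4⟩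
      · left
        refine ⟨by simp [hu, h1], fun j hj hju => h2 j (hlast j hj hju) hju⟩
      · right
        refine ⟨j₁, by omega, by simp [hu, h1], h2, by simp [hu, h3], fun j hj hju => ?_⟩
        simpa [hu] using h4 j (hlast j hj hju) hju
  · rcases hM'.2 with ⟨_, h2⟩ | h
    · obtain ⟨j, hj, hju⟩ := hex
      exact absurd hju (h2 j hj)
    · exact h

/-- Shift of the dual variables by the number in the real register `2`. -/
def shiftDual : Program :=
  forUpTo 9 7 (seq (instr (natLoad 12 10 4 9)) (ite (natEq 12 4)
    (block [realLoad 0 4 4 9, realSub 0 0 2, realStore 4 4 9 0])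
    (block [natLoad 13 8 4 9, realLoad 0 2 4 13, realSub 0 0 2, realStore 2 4 13 0,
      realLoad 0 3 4 9, realAdd 0 0 2, realStore 3 4 9 0])))

theorem shiftDual_spec {M : Memory} {K : ℕ} (hZ : M.nat 4 = 0) (hK : M.nat 7 = K + 1)
    (hinj : ∀ j ≤ K, ∀ j' ≤ K, M.natArr 10 0 j ≠ 0 → M.natArr 10 0 j' ≠ 0 →
      M.natArr 8 0 j = M.natArr 8 0 j' → j = j') :
    Terminates shiftDual M (20 * (K + 1) + 2) fun M' =>
      (∀ j ≤ K, M.natArr 10 0 j ≠ 0 →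
        M'.realArr 2 0 (M.natArr 8 0 j) = M.realArr 2 0 (M.natArr 8 0 j) - M.real 2) ∧
      (∀ r, (∀ j ≤ K, M.natArr 10 0 j ≠ 0 → M.natArr 8 0 j ≠ r) →
        M'.realArr 2 0 r = M.realArr 2 0 r) ∧
      (∀ j ≤ K, M'.realArr 3 0 j = if M.natArr 10 0 j = 0 then M.realArr 3 0 j
        else M.realArr 3 0 j + M.real 2) ∧
      (∀ j ≤ K, M.natArr 10 0 j = 0 → M'.realArr 4 0 j = M.realArr 4 0 j - M.real 2) := by
  refine (Terminates.forUpTo (N := K + 1) (c := 18) (fun k M' =>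
      (∀ j ≤ K, M.natArr 10 0 j ≠ 0 → M'.realArr 2 0 (M.natArr 8 0 j) =
        if j < k then M.realArr 2 0 (M.natArr 8 0 j) - M.real 2
          else M.realArr 2 0 (M.natArr 8 0 j)) ∧
      (∀ r, (∀ j ≤ K, M.natArr 10 0 j ≠ 0 → M.natArr 8 0 j ≠ r) →
        M'.realArr 2 0 r = M.realArr 2 0 r) ∧
      (∀ j, M'.realArr 3 0 j = if j < k ∧ M.natArr 10 0 j ≠ 0 then M.realArr 3 0 j + M.real 2
        else M.realArr 3 0 j) ∧
      (∀ j, M'.realArr 4 0 j = if j < k ∧ M.natArr 10 0 j = 0 then M.realArr 4 0 j - M.real 2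
        else M.realArr 4 0 j)) hK rfl rfl (by simp) ?_).mono (by omega) fun M' _ hM' => ?_
  · intro k M' hk hik hf ⟨h1, h2, h3, h4⟩
    have e4 := hf.nat 4 rfl
    have a8 := hf.natArr 8 rfl
    have a10 := hf.natArr 10 rfl
    have d2 := hf.real 2 rfl
    refine (Terminates.of_loopFree rfl ?_).mono (t := Program.cost _) (by decide) fun _ _ h => h
    by_cases hu : M.natArr 10 0 k = 0
    · simp [effect, block, Instr.run, Test.Holds, e4, hZ, hik, a10, hu, d2, h4]
      refine ⟨fun j hj hju => ?_, h2, fun j => ?_, fun j => ?_⟩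
      · have hjk : j ≠ k := fun he => hju (he ▸ hu)
        simp [h1 j hj hju, show j ≤ k ↔ j < k by omega]
      · by_cases hjk : j = k
        · subst hjk; simp [h3, hu]
        · simp [h3, show j ≤ k ↔ j < k by omega]
      · by_cases hjk : j = k
        · subst hjk; simp [hu]
        · simp [hjk, show j ≤ k ↔ j < k by omega]
    · have h1k := h1 k (by omega) hu
      simp [effect, block, Instr.run, Test.Holds, e4, hZ, hik, a10, a8, hu, d2, h3, h4, h1k]
      refine ⟨fun j hj hju => ?_, fun r hr => ?_, fun j => ?_, fun j => ?_⟩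
      · by_cases hjk : j = k
        · subst hjk; simp
        · have hne : M.natArr 8 0 j ≠ M.natArr 8 0 k := fun he =>
            hjk (hinj j hj k (by omega) hju hu he)
          simp [hne, h1 j hj hju, show j ≤ k ↔ j < k by omega]
      · rw [if_neg fun he => hr k (by omega) hu he.symm]
        exact h2 r hr
      · by_cases hjk : j = k
        · subst hjk; simp [hu]
        · simp [hjk, show j ≤ k ↔ j < k by omega]
      · by_cases hjk : j = k
        · subst hjk; simp [hu]
        · simp [show j ≤ k ↔ j < k by omega]
  · obtain ⟨-, h1, h2, h3, h4⟩ := hM'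
    refine ⟨fun j hj hju => ?_, h2, fun j hj => ?_, fun j hj hju => ?_⟩
    · rw [h1 j hj hju, if_pos (by omega)]
    · rw [h3 j]; by_cases hju : M.natArr 10 0 j = 0 <;> simp [hju]; omega
    · rw [h4 j, if_pos ⟨by omega, hju⟩]

/-- Flip of the alternating path that ends at the column in register `10`. -/
def flipPath : Program :=
  seq (instr (natCopy 14 10)) (loop (natLt 14 6)
    (block [natLoad 15 9 4 14, natLoad 12 8 4 15, natStore 8 4 14 12, natCopy 14 15]))

/-- The Hungarian tree of the row in register `8`, in memory. -/
def TreeAt (K i : ℕ) (M : Memory) (rk : ℕ → ℕ) : Prop :=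
  IsTree K i (M.realArr 1) (M.realArr 2 0) (M.realArr 3 0) (M.natArr 8 0) (M.natArr 9 0)
    (M.natArr 10 0) (M.realArr 4 0) rk

theorem flipPath_spec {M : Memory} {K i j₁ : ℕ} {rk : ℕ → ℕ} (hZ : M.nat 4 = 0)
    (hK : M.nat 6 = K) (ht : TreeAt K i M rk) (hj₁ : M.nat 10 = j₁) (hlt : j₁ < K)
    (hu : M.natArr 10 0 j₁ = 0) (h0 : M.realArr 4 0 j₁ = 0) (hfree : M.natArr 8 0 j₁ = K)
    (hroot : ∀ j < K, M.realArr 1 i j ≤ M.realArr 2 0 i + M.realArr 3 0 j) :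
    Terminates flipPath M (6 * K + 10) fun M' => IsMatching K (i + 1) (M.realArr 1)
      (M.realArr 2 0) (M.realArr 3 0) (M'.natArr 8 0) := by
  refine ((Terminates.instr (Q := fun M' => M' = M.setNat 14 j₁)
    (by rw [← hj₁]; rfl)).seq (t' := (K + 1) * (5 + 1) + 1) fun M1 _ hM1 => ?_).mono
      (by omega) fun _ _ h => h
  subst hM1
  refine (Terminates.loop (c := 5) (fun k M' => IsFlip K i (M.realArr 1) (M.realArr 2 0)
    (M.realArr 3 0) (M.natArr 8 0) (M.natArr 10 0) rk j₁ (M'.natArr 8 0) (M'.nat 14) ∧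
      (if M'.nat 14 = j₁ then K + 1 else rk (M'.nat 14)) ≤ k) ?_ ?_).mono le_rfl ?_
  · simpa using ht.isFlip hlt hfree
  · intro k M' hf ⟨hflip, hk⟩ hb
    have e4 : M'.nat 4 = 0 := (hf.nat 4 rfl).trans (by simpa using hZ)
    have e6 : M'.nat 6 = K := (hf.nat 6 rfl).trans (by simpa using hK)
    have a9 : M'.natArr 9 = M.natArr 9 := hf.natArr 9 rfl
    have hb' : M'.nat 14 < K := by simpa only [Test.Holds, e6] using hb
    refine Terminates.block ?_
    simp only [List.foldl, Instr.run]
    have hstep := hflip.step (p' := fun j => if j = M'.nat 14 then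
      M'.natArr 8 0 (M.natArr 9 0 (M'.nat 14)) else M'.natArr 8 0 j) ht hu h0 hb'.ne
      fun j _ => rfl
    obtain ⟨hw, hwu⟩ := ht.wayUsed _ hb'
    have hne : M.natArr 9 0 (M'.nat 14) ≠ j₁ := fun he => hwu (he ▸ hu)
    refine ⟨rk (M.natArr 9 0 (M'.nat 14)), ?_, ?_, ?_⟩
    · rcases hstep.2 with he | he
      · rw [if_pos he] at hk
        have := ht.rankLe _ hw hwu
        omega
      · split_ifs at hk
        · have := ht.rankLe _ hw hwu
          omega
        · omega
    · convert hstep.1 using 1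
      · ext j
        simp [e4, a9]
      · simp [e4, a9]
    · simp [e4, a9, hne]
  · rintro M' hf ⟨⟨k, hflip, -⟩, hb⟩
    have e6 : M'.nat 6 = K := (hf.nat 6 rfl).trans (by simpa using hK)
    have hK' : M'.nat 14 = K := by
      have := hflip.le
      simp only [Test.Holds, e6] at hb
      omega
    rw [hK'] at hflip
    exact hflip.isMatching ht hroot

end Solver

section Solver

open Instr Test Program

/-- If the column in register `10` is free, then the search stops; otherwise this column enters the
tree. -/
def growTree : Program :=
  seq (instr (natLoad 13 8 4 10)) (ite (natEq 13 6) (instr (natCopy 11 4))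
    (seq (instr (natStore 10 4 10 5)) relaxLoop))

/-- One step of the growth of the tree. -/
def treeStep : Program := seq findColumn (seq shiftDual growTree)

/-- The search of an alternating path from the row `i` has reached the free column in
register `10`. -/
def PathFound (K i : ℕ) (M : Memory) : Prop :=
  ∃ rk, TreeAt K i M rk ∧ M.nat 10 < K ∧ M.natArr 10 0 (M.nat 10) = 0 ∧
    M.realArr 4 0 (M.nat 10) = 0 ∧ M.natArr 8 0 (M.nat 10) = K ∧
    ∀ j < K, M.realArr 1 i j ≤ M.realArr 2 0 i + M.realArr 3 0 j

theorem growTree_spec {M : Memory} {K i : ℕ} {rk : ℕ → ℕ} (hZ : M.nat 4 = 0) (hone : M.nat 5 = 1)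
    (hK : M.nat 6 = K) (ht : TreeAt K i M rk) (hlt : M.nat 10 < K)
    (hu : M.natArr 10 0 (M.nat 10) = 0) (h0 : M.realArr 4 0 (M.nat 10) = 0)
    (hroot : ∀ j < K, M.realArr 1 i j ≤ M.realArr 2 0 i + M.realArr 3 0 j) :
    Terminates growTree M (30 * K + 5) fun M' => (M'.nat 11 = M.nat 11 ∧
      ∃ rk', TreeAt K i M' rk' ∧
        unusedCount K (M'.natArr 10 0) < unusedCount K (M.natArr 10 0)) ∨
      (M'.nat 11 = 0 ∧ PathFound K i M') := by
  refine ((Terminates.instr (Q := fun M' => M' = M.setNat 13 (M.natArr 8 0 (M.nat 10)))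
    (by rw [← hZ]; rfl)).seq (t' := 30 * K + 3 + 1) fun M1 _ hM1 => ?_).mono
      (by omega) fun _ _ h => h
  subst hM1
  refine Terminates.ite (fun hb => ?_) fun hb => ?_
  · refine (Terminates.instr ?_).mono (by omega) fun _ _ h => h
    have hfree : M.natArr 8 0 (M.nat 10) = K := by simpa [Test.Holds, hK] using hb
    right
    refine ⟨by simp [Instr.run, hZ], rk, ?_⟩
    simpa [Instr.run] using ⟨ht, hlt, hu, h0, hfree, hroot⟩
  · have hnf : M.natArr 8 0 (M.nat 10) ≠ K := by simpa [Test.Holds, hK] using hb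
    set M2 := (M.setNat 13 (M.natArr 8 0 (M.nat 10))).setNatArr 10 0 (M.nat 10) 1 with hM2
    refine ((Terminates.instr (Q := fun M' => M' = M2) ?_).seq (t' := 30 * K + 2)
      fun M3 _ hM3 => ?_).mono (by omega) fun _ _ h => h
    · simp [hM2, Instr.run, hZ, hone]
    · subst hM3
      refine (relaxLoop_spec (K := K) (by simp [hM2, hZ]) (by simp [hM2, hK])).mono le_rfl
        fun M' hf hM' => ?_
      left
      have e10 : M'.natArr 10 = M2.natArr 10 := hf.natArr 10 rfl
      have a1 : M'.realArr 1 = M.realArr 1 := hf.realArr 1 rfl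
      have a2 : M'.realArr 2 = M.realArr 2 := hf.realArr 2 rfl
      have a3 : M'.realArr 3 = M.realArr 3 := hf.realArr 3 rfl
      have a8 : M'.natArr 8 0 = M.natArr 8 0 := by
        rw [hf.natArr 8 rfl]; ext j; simp [hM2]
      have hs : ∀ j, slackAt M2 (M2.nat 13) j = M.realArr 2 0 (M.natArr 8 0 (M.nat 10)) +
          M.realArr 3 0 j - M.realArr 1 (M.natArr 8 0 (M.nat 10)) j := by
        intro j; simp [hM2, slackAt]
      have hused : ∀ j, M'.natArr 10 0 j = if j = M.nat 10 then 1 else M.natArr 10 0 j := by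
        intro j; simp [e10, hM2]
      refine ⟨(hf.nat 11 rfl).trans (by simp [hM2]),
        Function.update rk (M.nat 10) (K - unusedCount K (M'.natArr 10 0)), ?_⟩
      unfold TreeAt
      rw [a1, a2, a3, a8]
      refine IsTree.grow ht hlt hu h0 hroot hnf (fun j _ => hused j) (fun j hj hju => ?_)
        fun j hj => ?_
      · rw [(hM' j hj).1, ← e10, hju, hs]
        simp [hM2]
      · rw [(hM' j hj).2, ← e10, hs]
        simp [hM2]

theorem treeStep_spec {M : Memory} {K i : ℕ} {rk : ℕ → ℕ} (hZ : M.nat 4 = 0) (hone : M.nat 5 = 1)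
    (hK : M.nat 6 = K) (hK1 : M.nat 7 = K + 1) (ht : TreeAt K i M rk) :
    Terminates treeStep M (70 * K + 40) fun M' => (M'.nat 11 = M.nat 11 ∧
      ∃ rk', TreeAt K i M' rk' ∧
        unusedCount K (M'.natArr 10 0) < unusedCount K (M.natArr 10 0)) ∨
      (M'.nat 11 = 0 ∧ PathFound K i M') := by
  refine ((findColumn_spec hZ hK ht.exists_unused).seq (t' := 20 * (K + 1) + 2 + (30 * K + 5))
    fun M1 hf1 ⟨j₁, hj₁, hn, hu, hδ, hmin⟩ => ?_).mono (by omega) fun _ _ h => h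
  have a8 := hf1.natArr 8 rfl
  have a9 := hf1.natArr 9 rfl
  have a10 := hf1.natArr 10 rfl
  have a1 := hf1.realArr 1 rfl
  have a2 := hf1.realArr 2 rfl
  have a3 := hf1.realArr 3 rfl
  have a4 := hf1.realArr 4 rfl
  refine (shiftDual_spec (K := K) ((hf1.nat 4 rfl).trans hZ) ((hf1.nat 7 rfl).trans hK1) ?_).seq
    fun M2 hf2 ⟨h1, h2, h3, h4⟩ => ?_
  · rw [a8, a10]
    intro j hj j' hj' hju hju' he
    exact ht.inj' hj hj' (ht.row_lt hj hju) he
  rw [a10, a8, a2, hδ] at h1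
  rw [a10, a8, a2] at h2
  rw [a10, a3, hδ] at h3
  rw [a10, a4, hδ] at h4
  rw [hδ] at hmin
  obtain ⟨ht', hmv0, hroot⟩ := ht.dualUpdate hj₁ hu rfl hmin h1 h2
    (fun j hj => h3 j hj.le) fun j hj hju => h4 j hj.le hju
  have b8 := (hf2.natArr 8 rfl).trans a8
  have b9 := (hf2.natArr 9 rfl).trans a9
  have b10 := (hf2.natArr 10 rfl).trans a10
  have b1 := (hf2.realArr 1 rfl).trans a1
  have hn' : M2.nat 10 = j₁ := (hf2.nat 10 rfl).trans hn
  have e11 : M2.nat 11 = M.nat 11 := (hf2.nat 11 rfl).trans (hf1.nat 11 rfl)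
  have := growTree_spec (M := M2) (K := K) (i := i) (rk := rk)
    ((hf2.nat 4 rfl).trans ((hf1.nat 4 rfl).trans hZ))
    ((hf2.nat 5 rfl).trans ((hf1.nat 5 rfl).trans hone))
    ((hf2.nat 6 rfl).trans ((hf1.nat 6 rfl).trans hK))
    (by unfold TreeAt; rw [b8, b9, b10, b1]; exact ht') (by rw [hn']; exact hj₁)
    (by rw [hn', b10]; exact hu) (by rw [hn']; exact hmv0) (by rw [b1]; exact hroot)
  rwa [e11, b10] at this

/-- The row in register `8` enters the matching. -/
def matchRow : Program :=
  seq initTree (seq (instr (natCopy 11 5)) (seq (loop (natEq 11 5) treeStep) flipPath))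

/-- The matching and the dual variables, in memory. -/
def MatchingAt (K i : ℕ) (M : Memory) : Prop :=
  IsMatching K i (M.realArr 1) (M.realArr 2 0) (M.realArr 3 0) (M.natArr 8 0)

theorem matchRow_spec {M : Memory} {K i : ℕ} (hZ : M.nat 4 = 0) (hone : M.nat 5 = 1)
    (hK : M.nat 6 = K) (hK1 : M.nat 7 = K + 1) (hi : M.nat 8 = i) (hiK : i < K)
    (hm : MatchingAt K i M) :
    Terminates matchRow M (100 * (K + 1) * (K + 1)) (MatchingAt K (i + 1)) := by
  refine ((initTree_spec hZ hone hK).seq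
    (t' := 1 + ((K + 1) * (70 * K + 40 + 1) + 1 + (6 * K + 10)))
    fun M1 hf1 ⟨h1, h2, h3, h4⟩ => ?_).mono (by nlinarith) fun _ _ h => h
  have a1 := hf1.realArr 1 rfl
  have a2 := hf1.realArr 2 rfl
  have a3 := hf1.realArr 3 rfl
  have e5 : M1.nat 5 = 1 := (hf1.nat 5 rfl).trans hone
  have ht : TreeAt K i M1 fun _ => 0 := by
    unfold TreeAt
    rw [a1, a2, a3]
    refine IsMatching.isTree hm hiK h2 (h3.trans hi) (fun j hj => (h1 j hj).2.1)
      (by rw [h4]; exact one_ne_zero) (fun j hj => (h1 j hj).1) fun j hj => ?_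
    rw [(h1 j hj).2.2, hi]; rfl
  refine (Terminates.instr (Q := fun M' => M' = M1.setNat 11 1) (by rw [← e5]; rfl)).seq
    fun M2 _ hM2 => ?_
  have c4 : M2.nat 4 = 0 := by rw [hM2]; simpa using (hf1.nat 4 rfl).trans hZ
  have c5 : M2.nat 5 = 1 := by rw [hM2]; simpa using e5
  have c6 : M2.nat 6 = K := by rw [hM2]; simpa using (hf1.nat 6 rfl).trans hK
  have c7 : M2.nat 7 = K + 1 := by rw [hM2]; simpa using (hf1.nat 7 rfl).trans hK1
  have hstart : M2.nat 11 = 1 ∧ TreeAt K i M2 fun _ => 0 := by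
    rw [hM2]; exact ⟨by simp, ht⟩
  refine (Terminates.loop (c := 70 * K + 40) (k := K + 1) (fun k M' =>
    (M'.nat 11 = 1 ∧ ∃ rk, TreeAt K i M' rk ∧ unusedCount K (M'.natArr 10 0) + 1 ≤ k) ∨
      (M'.nat 11 = 0 ∧ PathFound K i M')) ?_ ?_).seq ?_
  · left
    have : unusedCount K (M2.natArr 10 0) ≤ K := unusedCount_le
    exact ⟨hstart.1, _, hstart.2, by omega⟩
  · intro k M' hf hinv hb
    have d5 : M'.nat 5 = 1 := (hf.nat 5 rfl).trans c5
    have hb' : M'.nat 11 = 1 := by simpa only [Test.Holds, d5] using hb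
    rcases hinv with ⟨-, rk, htr, hk⟩ | ⟨h0, -⟩
    · refine (treeStep_spec ((hf.nat 4 rfl).trans c4) d5 ((hf.nat 6 rfl).trans c6)
        ((hf.nat 7 rfl).trans c7) htr).mono le_rfl fun M'' _ hM'' => ?_
      rcases hM'' with ⟨h11, rk', htr', hlt⟩ | hfound
      · exact ⟨k - 1, by omega, Or.inl ⟨h11.trans hb', rk', htr', by omega⟩⟩
      · exact ⟨k - 1, by omega, Or.inr hfound⟩
    · omega
  · rintro M3 hf3 ⟨⟨k, hinv⟩, hb⟩
    have d5 : M3.nat 5 = 1 := (hf3.nat 5 rfl).trans c5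
    rcases hinv with ⟨h11, -⟩ | ⟨-, rk, htr, hlt, hu, hmv, hfree, hroot⟩
    · exact absurd (by simpa only [Test.Holds, d5] using h11) hb
    · refine (flipPath_spec ((hf3.nat 4 rfl).trans c4) ((hf3.nat 6 rfl).trans c6) htr rfl hlt hu hmv
        hfree hroot).mono le_rfl fun M' hf hM' => ?_
      unfold MatchingAt
      rwa [hf.realArr 1 rfl, hf.realArr 2 rfl, hf.realArr 3 rfl]

/-- The Hungarian method, for the `K × K` matrix in the real array `1`, where `K` is in
register `6` and `K + 1` in register `7`. -/
def hungarian : Program :=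
  seq (forUpTo 9 6 (instr (natStore 8 4 9 6))) (forUpTo 8 6 matchRow)

theorem hungarian_spec {M : Memory} {K : ℕ} (hZ : M.nat 4 = 0) (hone : M.nat 5 = 1)
    (hK : M.nat 6 = K) (hK1 : M.nat 7 = K + 1) :
    Terminates hungarian M (110 * (K + 1) ^ 3) (MatchingAt K K) := by
  refine ((Terminates.forUpTo (N := K) (c := 1) (fun k M' => ∀ j < k, M'.natArr 8 0 j = K) hK rfl
    rfl (fun j hj => absurd hj (Nat.not_lt_zero _)) ?_).seq
      (t' := K * (100 * (K + 1) * (K + 1) + 2) + 2) fun M1 hf1 hM1 => ?_).mono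
      (by nlinarith [Nat.zero_le (K ^ 3), Nat.zero_le (K ^ 2)]) fun _ _ h => h
  · intro k M' hk hik hf hinv
    refine Terminates.instr fun j hj => ?_
    have e4 := hf.nat 4 rfl
    have e6 := hf.nat 6 rfl
    by_cases hjk : j = k
    · simp [Instr.run, e4, hZ, hik, hjk, e6, hK]
    · simpa [Instr.run, e4, hZ, hik, hjk] using hinv j (by omega)
  · have c4 : M1.nat 4 = 0 := (hf1.nat 4 rfl).trans hZ
    have c5 : M1.nat 5 = 1 := (hf1.nat 5 rfl).trans hone
    have c6 : M1.nat 6 = K := (hf1.nat 6 rfl).trans hK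
    have c7 : M1.nat 7 = K + 1 := (hf1.nat 7 rfl).trans hK1
    refine (Terminates.forUpTo (N := K) (c := 100 * (K + 1) * (K + 1))
      (fun k M' => MatchingAt K k M')
      c6 rfl rfl (IsMatching.init hM1.2) ?_).mono le_rfl fun M' _ hM' => hM'.2
    intro k M' hk hik hf hinv
    exact (matchRow_spec ((hf.nat 4 rfl).trans c4) ((hf.nat 5 rfl).trans c5)
      ((hf.nat 6 rfl).trans c6) ((hf.nat 7 rfl).trans c7) hik hk hinv).mono le_rfl fun _ _ h => h

/-! ### The program for the sign of a tropical determinant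

The register `17` contains the constant `2`, and the register `16` the code of the sign.  The lists
of the rows and of the columns of the minor are in the arrays `5` and `6`, and the codes of the
signs of its entries in the array `7`. -/

/-- The code of a sign that is not zero. -/
def unitCode (s : ℤˣ) : ℕ := if s = 1 then 1 else 2

theorem unitCode_one : unitCode 1 = 1 := rfl

/-- The sign in register `16` changes. -/
def changeSign : Program := ite (natEq 16 5) (instr (natCopy 16 17)) (instr (natCopy 16 5))

theorem changeSign_effect {M : Memory} {s : ℤˣ} (hone : M.nat 5 = 1) (htwo : M.nat 17 = 2)
    (hs : M.nat 16 = unitCode s) : (changeSign.effect M).nat 16 = unitCode (-s) := by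
  rcases Int.units_eq_one_or s with rfl | rfl <;>
    simp [changeSign, effect, Instr.run, Test.Holds, hone, htwo, hs, unitCode]

/-- The sign of the permutation in the array `8`, multiplied by the signs of the corresponding
entries of the array `7`. -/
def permSign : Program :=
  seq (instr (natCopy 16 5)) (forUpTo 9 6 (seq
    (seq (block [natLoad 13 8 4 9, natLoad 12 7 13 9]) (ite (natEq 12 17) changeSign skip))
    (forUpTo 18 9 (seq (instr (natLoad 12 8 4 18)) (ite (natLt 13 12) changeSign skip)))))

theorem permSign_spec {M : Memory} {K : ℕ} (hZ : M.nat 4 = 0) (hone : M.nat 5 = 1)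
    (htwo : M.nat 17 = 2) (hK : M.nat 6 = K) :
    Terminates permSign M (40 * (K + 1) ^ 2) fun M' => M'.nat 16 = unitCode
      (∏ j ∈ Finset.range K, ((if M.natArr 7 (M.natArr 8 0 j) j = 2 then -1 else 1) *
        ∏ i ∈ Finset.range j, if M.natArr 8 0 j < M.natArr 8 0 i then -1 else 1)) := by
  refine ((Terminates.instr (Q := fun M' => M' = M.setNat 16 1) (by rw [← hone]; rfl)).seq
    (t' := K * (10 + (K * 8 + 2) + 2) + 2) fun M1 _ hM1 => ?_).mono
      (by nlinarith) fun _ _ h => h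
  subst hM1
  refine (Terminates.forUpTo (N := K) (c := 10 + (K * 8 + 2)) (fun k M' => M'.nat 16 = unitCode
      (∏ j ∈ Finset.range k, ((if M.natArr 7 (M.natArr 8 0 j) j = 2 then -1 else 1) *
        ∏ i ∈ Finset.range j, if M.natArr 8 0 j < M.natArr 8 0 i then -1 else 1)))
      (by simp [hK]) rfl rfl (by simp [unitCode_one]) ?_).mono le_rfl fun _ _ h => h.2
  intro k M' hk hik hf hinv
  have e4 : M'.nat 4 = 0 := (hf.nat 4 rfl).trans (by simpa using hZ)
  have e5 : M'.nat 5 = 1 := (hf.nat 5 rfl).trans (by simpa using hone)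
  have e17 : M'.nat 17 = 2 := (hf.nat 17 rfl).trans (by simpa using htwo)
  have a7 : M'.natArr 7 = M.natArr 7 := hf.natArr 7 rfl
  have a8 : M'.natArr 8 = M.natArr 8 := hf.natArr 8 rfl
  rw [Finset.prod_range_succ]
  set s := ∏ j ∈ Finset.range k, ((if M.natArr 7 (M.natArr 8 0 j) j = 2 then (-1 : ℤˣ) else 1) *
        ∏ i ∈ Finset.range j, if M.natArr 8 0 j < M.natArr 8 0 i then -1 else 1)
  refine Terminates.seq (Q := fun M'' => M''.nat 13 = M.natArr 8 0 k ∧ M''.nat 16 = unitCode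
    (s * if M.natArr 7 (M.natArr 8 0 k) k = 2 then -1 else 1)) (t := 10) ?_
      fun M2 hf2 ⟨h13, h16⟩ => ?_
  · refine (Terminates.of_loopFree rfl ?_).mono (t := Program.cost _) (by decide) fun _ _ h => h
    by_cases hsg : M.natArr 7 (M.natArr 8 0 k) k = 2
    · set M3 := (block [natLoad 13 8 4 9, natLoad 12 7 13 9]).effect M' with hM3
      have hM3' : effect (seq (block [natLoad 13 8 4 9, natLoad 12 7 13 9])
          (ite (natEq 12 17) changeSign skip)) M' = changeSign.effect M3 := by
        rw [effect, ← hM3, effect, if_pos]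
        simp [hM3, effect, block, Instr.run, Test.Holds, e4, e17, hik, a8, a7, hsg]
      rw [hM3']
      constructor
      · simp only [changeSign, effect]
        split_ifs <;> simp [hM3, effect, block, Instr.run, e4, hik, a8]
      · rw [if_pos hsg, mul_neg, mul_one]
        refine changeSign_effect ?_ ?_ ?_ <;>
          simp [hM3, effect, block, Instr.run, e5, e17, hinv]
    · simp [effect, block, Instr.run, Test.Holds, e4, e17, hik, a8, a7, hsg, hinv]
  · have c4 : M2.nat 4 = 0 := (hf2.nat 4 rfl).trans e4
    have c5 : M2.nat 5 = 1 := (hf2.nat 5 rfl).trans e5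
    have c17 : M2.nat 17 = 2 := (hf2.nat 17 rfl).trans e17
    have c9 : M2.nat 9 = k := (hf2.nat 9 rfl).trans hik
    have b8 : M2.natArr 8 = M.natArr 8 := (hf2.natArr 8 rfl).trans a8
    refine (Terminates.forUpTo (N := k) (c := 6) (fun l M' => M'.nat 16 = unitCode
      (s * (if M.natArr 7 (M.natArr 8 0 k) k = 2 then -1 else 1) *
        ∏ i ∈ Finset.range l, if M.natArr 8 0 k < M.natArr 8 0 i then -1 else 1))
      c9 rfl rfl (by simp [h16]) ?_).mono (by nlinarith) fun M'' _ hM'' => ?_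
    · intro l M3 hl hil hf3 hinv3
      have d4 : M3.nat 4 = 0 := (hf3.nat 4 rfl).trans c4
      have d5 : M3.nat 5 = 1 := (hf3.nat 5 rfl).trans c5
      have d17 : M3.nat 17 = 2 := (hf3.nat 17 rfl).trans c17
      have d13 : M3.nat 13 = M.natArr 8 0 k := (hf3.nat 13 rfl).trans h13
      have d8 : M3.natArr 8 = M.natArr 8 := (hf3.natArr 8 rfl).trans b8
      rw [Finset.prod_range_succ]
      refine (Terminates.of_loopFree rfl ?_).mono (t := Program.cost _) (by decide) fun _ _ h => h
      by_cases hlt : M.natArr 8 0 k < M.natArr 8 0 l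
      · set M4 := (instr (natLoad 12 8 4 18)).effect M3 with hM4
        have hM4' : effect (seq (instr (natLoad 12 8 4 18))
            (ite (natLt 13 12) changeSign skip)) M3 =
            changeSign.effect M4 := by
          rw [effect, ← hM4, effect, if_pos]
          simp [hM4, effect, Instr.run, Test.Holds, d4, d13, d8, hil, hlt]
        rw [hM4', if_pos hlt, ← mul_assoc, mul_neg, mul_one, Memory.setNat_nat, if_neg (by decide)]
        refine changeSign_effect ?_ ?_ ?_ <;>
          simp [hM4, effect, Instr.run, d5, d17, hinv3]
      · simp [effect, Instr.run, Test.Holds, d4, d13, hil, d8, hlt, hinv3]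
    · simpa [mul_assoc] using hM''.2

end Solver

section Determinant

open Instr Test Program

variable {m n : ℕ} {I : Finset (Fin m)} {J : Finset (Fin n)}

theorem unitCode_eq_signCode (s : ℤˣ) : unitCode s = signCode (SignType.sign (s : ℤ)) := by
  rcases Int.units_eq_one_or s with rfl | rfl <;> simp [unitCode, signCode]

theorem signCode_injective : Function.Injective signCode := by
  intro s t h
  cases s <;> cases t <;> first | rfl | exact absurd h (by decide)

/-- For a sign that is not zero, the unit of which the program keeps the code. -/
theorem sign_ite_signCode {s : SignType} (hs : s ≠ 0) :
    SignType.sign ((if signCode s = 2 then -1 else 1 : ℤˣ) : ℤ) = s := by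
  cases s
  · exact absurd rfl hs
  · have : signCode .neg = 2 := rfl
    simp only [this, if_true]; rfl
  · have : signCode .pos ≠ 2 := by decide
    simp only [this, if_false]; rfl

/-- The sign of a minor, from an optimal matching: genericity makes the optimal permutation unique,
and its term has the sign of the determinant of every lift. -/
theorem IsLift.sign_det_of_isMatching {p q K : ℕ} {N : Matrix (Fin p) (Fin q) Puiseux}
    {M : Matrix (Fin p) (Fin q) SignedTrop} (hN : IsLift N M) (hM : StronglyNonDegenerate M)
    {r : Fin K → Fin p} {c : Fin K → Fin q} (hr : Function.Injective r)
    (hc : Function.Injective c) {w : ℕ → ℕ → ℝ} {a b : ℕ → ℝ} {mate : ℕ → ℕ} {sg : ℕ → ℕ → ℕ}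
    (hp : IsMatching K K w a b mate)
    (hw : ∀ i j : Fin K, w i j = (M (r i) (c j)).modulus.unbotD 0)
    (hsg : ∀ i j : Fin K, sg i j = signCode (M (r i) (c j)).sign) :
    signCode (SignType.sign (N.submatrix r c).det) = unitCode (∏ j ∈ Finset.range K,
      ((if sg (mate j) j = 2 then -1 else 1) *
        ∏ i ∈ Finset.range j, if mate j < mate i then -1 else 1)) := by
  obtain ⟨π, hπ, hopt⟩ := hp.exists_perm
  obtain ⟨τ, h0, hu⟩ := hM.exists_unique_max hr hc
  have hweight : ∀ σ : Equiv.Perm (Fin K), permWeight (M.submatrix r c) σ⁻¹ =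
      ((∑ j : Fin K, w (σ j) j : ℝ) : WithBot ℝ) := by
    intro σ
    rw [permWeight, ← Equiv.sum_comp σ, WithBot.coe_sum]
    refine Finset.sum_congr rfl fun j _ => ?_
    rw [hw, Matrix.submatrix_apply, show σ⁻¹ (σ j) = j from σ.symm_apply_apply j]
    have hne := hM.ne_zero (r (σ j)) (c j)
    generalize M (r (σ j)) (c j) = x at hne ⊢
    induction x using WithZero.recZeroCoe with
    | zero => exact absurd rfl hne
    | coe x => rfl
  have hτ : τ = π⁻¹ := by
    by_contra hne
    have h1 := hu π⁻¹ (Ne.symm hne)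
    rw [← inv_inv τ, hweight, hweight, WithBot.coe_lt_coe] at h1
    exact absurd (hopt τ⁻¹) (not_le.2 h1)
  subst hτ
  rw [hN.sign_det r c _ h0 hu, unitCode_eq_signCode]
  congr 1
  rw [Finset.prod_mul_distrib, mul_comm, Units.val_mul, sign_mul]
  congr 1
  · rw [← Equiv.prod_comp π, ← Fin.prod_univ_eq_prod_range
      (fun j => if sg (mate j) j = 2 then (-1 : ℤˣ) else 1), Units.coe_prod]
    refine Eq.trans ?_ (map_prod (signHom : ℤ →*₀ SignType) _ _).symm
    refine Finset.prod_congr rfl fun j _ => ?_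
    rw [show π⁻¹ (π j) = j from π.symm_apply_apply j, hπ, hsg]
    refine (sign_ite_signCode ?_).symm
    have hne := hM.ne_zero (r (π j)) (c j)
    rw [← hN, sign_sval]
    rw [← hN] at hne
    exact sign_ne_zero.2 fun hz => hne (by rw [hz, sval_zero])
  · rw [Equiv.Perm.sign_inv, Equiv.Perm.sign_eq_prod_prod_Iio]
    congr 2
    rw [← Fin.prod_univ_eq_prod_range
      (fun j => ∏ i ∈ Finset.range j, if mate j < mate i then (-1 : ℤˣ) else 1)]
    refine Finset.prod_congr rfl fun j _ => ?_
    refine Finset.prod_bij (fun i _ => (i : ℕ)) ?_ ?_ ?_ ?_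
    · intro i hi; simpa using hi
    · intro i _ i' _ h; exact Fin.ext h
    · intro i hi
      rw [Finset.mem_range] at hi
      exact ⟨⟨i, hi.trans j.2⟩, by simpa [Fin.lt_def] using hi, rfl⟩
    · intro i hi
      have hij : i ≠ j := (Finset.mem_Iio.1 hi).ne
      have hne : π i ≠ π j := fun h => hij (π.injective h)
      rw [hπ, hπ]
      simp only [Fin.val_fin_lt]
      rcases lt_or_gt_of_ne hne with h | h
      · rw [if_pos h, if_neg h.not_gt]
      · rw [if_neg h.not_gt, if_pos h]

/-- The number that the program uses for an element of `I ⊎ J`: first the elements of `I`, then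
those of `J`. -/
def position (q : Fin I.card ⊕ Fin J.card) : ℕ := finSumFinEquiv q

/-- The position of an element of `I ⊎ J`, or `n` for `none`. -/
def optPosition (n : ℕ) (k : Option (Fin I.card ⊕ Fin J.card)) : ℕ := k.elim n position

theorem position_lt (h : IsBasis I J) (q : Fin I.card ⊕ Fin J.card) : position q < n :=
  (finSumFinEquiv q).2.trans_eq h

theorem position_injective :
    Function.Injective (position : Fin I.card ⊕ Fin J.card → ℕ) :=
  Fin.val_injective.comp finSumFinEquiv.injective

theorem position_lt_succ {x y : Fin I.card ⊕ Fin J.card} :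
    position y < position x + 1 ↔ position y < position x ∨ y = x := by
  rw [Nat.lt_succ_iff_lt_or_eq, position_injective.eq_iff]

theorem exists_position_eq (h : IsBasis I J) {q : ℕ} (hq : q < n) :
    ∃ x : Fin I.card ⊕ Fin J.card, position x = q :=
  ⟨finSumFinEquiv.symm ⟨q, hq.trans_eq h.symm⟩, by simp [position]⟩

theorem position_eq_optPosition_iff (h : IsBasis I J) {q : Fin I.card ⊕ Fin J.card}
    {k : Option (Fin I.card ⊕ Fin J.card)} : position q = optPosition n k ↔ k = some q := by
  rcases k with _ | k
  · simpa [optPosition] using (position_lt h q).ne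
  · simp [optPosition, position_injective.eq_iff, eq_comm]

/-- The data of the rule in memory: the constants `0`, `1`, `2` and `m + 1`, the dimensions, the
matrix, the set `I`, and the columns in the order in which the basis numbers them. -/
structure BasisMemory (h : IsBasis I J) (T : Matrix (Fin (m + 2)) (Fin n) SignedTrop)
    (M : Memory) : Prop where
  dim : M.nat 0 = m ∧ M.nat 1 = n ∧ M.nat 2 = I.card
  const : M.nat 4 = 0 ∧ M.nat 5 = 1 ∧ M.nat 17 = 2 ∧ M.nat 23 = m + 1
  signs : ∀ i j, M.natArr 0 (i : Fin (m + 2)) (j : Fin n) = signCode (T i j).sign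
  moduli : ∀ i j, M.realArr 0 (i : Fin (m + 2)) (j : Fin n) = (T i j).modulus.unbotD 0
  rows : ∀ a : Fin I.card, M.natArr 1 0 a = I.orderEmbOfFin rfl a
  cols : ∀ q, M.natArr 4 0 (position q) = basisCol (J := J) h.card_compl rfl q

/-- The program does not modify the data of the rule. -/
def keepsBasis (p : Program) : Bool :=
  [0, 1, 2, 4, 5, 17, 23].all (fun r => !p.anyInstr (·.writesNat r)) &&
    [0, 1, 4].all (fun a => !p.anyInstr (·.writesNatArr a)) && !p.anyInstr (·.writesRealArr 0)

theorem BasisMemory.frame {h : IsBasis I J} {T : Matrix (Fin (m + 2)) (Fin n) SignedTrop}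
    {M M' : Memory} (hM : BasisMemory h T M) {p : Program} (hf : Frame p M M')
    (hp : keepsBasis p = true) : BasisMemory h T M' := by
  simp only [keepsBasis, List.all_cons, List.all_nil, Bool.and_true, Bool.and_eq_true,
    Bool.not_eq_true'] at hp
  obtain ⟨⟨⟨r0, r1, r2, r4, r5, r17, r23⟩, a0, a1, a4⟩, b0⟩ := hp
  constructor
  · rw [hf.nat 0 r0, hf.nat 1 r1, hf.nat 2 r2]; exact hM.dim
  · rw [hf.nat 4 r4, hf.nat 5 r5, hf.nat 17 r17, hf.nat 23 r23]; exact hM.const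
  · rw [hf.natArr 0 a0]; exact hM.signs
  · rw [hf.realArr 0 b0]; exact hM.moduli
  · rw [hf.natArr 1 a1]; exact hM.rows
  · rw [hf.natArr 4 a4]; exact hM.cols

/-- Appends the row in register `13` and the column at the position in register `9` to the lists in
the arrays `5` and `6`. -/
def pushRow : Program :=
  block [natStore 5 4 6 13, natLoad 12 4 4 9, natStore 6 4 6 12, natSucc 6 6]

/-- Lists the rows selected by the basis, where the row `m + 1` replaces the one at the position in
register `22`, and the row `m` the one at the position in register `21`; and the corresponding
columns. -/
def listRows : Program :=
  seq (instr (natCopy 6 4)) (forUpTo 9 1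
    (ite (natEq 9 22) (seq (instr (natCopy 13 23)) pushRow)
      (ite (natEq 9 21) (seq (instr (natCopy 13 0)) pushRow)
        (ite (natLt 9 2) (seq (instr (natLoad 13 1 4 9)) pushRow) skip))))

/-- The arrays `5` and `6` contain the rows that `f` selects at the positions in the list `L`, and
the corresponding columns. -/
def ListedRows {p : ℕ} {ι : Type*} (f : ι → Option (Fin p)) (col : ι → Fin n) (L : List ι)
    (M : Memory) : Prop :=
  M.nat 6 = L.length ∧ ∀ a (ha : a < L.length),
    (∃ r, f L[a] = some r ∧ M.natArr 5 0 a = r) ∧ M.natArr 6 0 a = col L[a]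

theorem ListedRows.push {p : ℕ} {ι : Type*} {f : ι → Option (Fin p)} {col : ι → Fin n} {L : List ι}
    {M : Memory} (hL : ListedRows f col L M) {x : ι} {r : Fin p} (hx : f x = some r)
    (hZ : M.nat 4 = 0) (hr : M.nat 13 = r) (hcol : M.natArr 4 0 (M.nat 9) = col x) (k : ℕ) :
    ListedRows f col (L ++ [x]) ((pushRow.effect M).setNat 9 k) := by
  obtain ⟨h6, hL⟩ := hL
  refine ⟨by simp [pushRow, effect, block, Instr.run, h6], fun a ha => ?_⟩
  rw [List.length_append, List.length_singleton] at ha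
  rcases Nat.lt_succ_iff_lt_or_eq.1 ha with ha' | rfl
  · rw [List.getElem_append_left ha']
    have hne : a ≠ L.length := ha'.ne
    simpa [pushRow, effect, block, Instr.run, h6, hZ, hne] using hL a ha'
  · rw [List.getElem_concat_length rfl]
    refine ⟨⟨r, hx, ?_⟩, ?_⟩
    · simp [pushRow, effect, block, Instr.run, h6, hZ, hr]
    · simp [pushRow, effect, block, Instr.run, h6, hZ, hcol]

theorem listRows_spec {h : IsBasis I J} {T : Matrix (Fin (m + 2)) (Fin n) SignedTrop} {M : Memory}
    (hM : BasisMemory h T M) {k l : Option (Fin I.card ⊕ Fin J.card)}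
    (hk : M.nat 21 = optPosition n k) (hl : M.nat 22 = optPosition n l) :
    Terminates listRows M (20 * n + 5) fun M' => ∃ L : List (Fin I.card ⊕ Fin J.card), L.Nodup ∧
      (∀ x, x ∈ L ↔ (replaceSel I J k l x).isSome) ∧
      ListedRows (replaceSel I J k l) (basisCol (J := J) h.card_compl rfl) L M' := by
  refine ((Terminates.instr (Q := fun M' => M' = M.setNat 6 0) (by rw [← hM.const.1]; rfl)).seq
    (t' := n * (10 + 2) + 2) fun M1 hf1 hM1 => ?_).mono (by omega) fun _ _ h => h
  have hB1 := hM.frame hf1 (by decide)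
  have k1 : M1.nat 21 = optPosition n k := (hf1.nat 21 rfl).trans hk
  have l1 : M1.nat 22 = optPosition n l := (hf1.nat 22 rfl).trans hl
  refine (Terminates.forUpTo (N := n) (c := 10)
    (fun q M' => ∃ L : List (Fin I.card ⊕ Fin J.card), L.Nodup ∧
      (∀ x, x ∈ L ↔ position x < q ∧ (replaceSel I J k l x).isSome) ∧
      ListedRows (replaceSel I J k l) (basisCol (J := J) h.card_compl rfl) L M')
    hB1.dim.2.1 rfl rfl ⟨[], List.nodup_nil, by simp, ?_⟩ ?_).mono le_rfl
      fun M' _ ⟨_, L, hn, hmem, hL⟩ => ⟨L, hn, fun x => ?_, hL⟩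
  · exact ⟨by simp [hM1], fun a ha => absurd ha (Nat.not_lt_zero _)⟩
  · intro q M' hq hiq hf ⟨L, hn, hmem, hL⟩
    have hB := hB1.frame hf (by decide)
    have k2 : M'.nat 21 = optPosition n k := (hf.nat 21 rfl).trans k1
    have l2 : M'.nat 22 = optPosition n l := (hf.nat 22 rfl).trans l1
    obtain ⟨x, rfl⟩ := exists_position_eq h hq
    refine (Terminates.of_loopFree rfl ?_).mono (t := Program.cost _) (by decide) fun _ _ h => h
    have hxL : x ∉ L := fun hx => absurd ((hmem x).1 hx).1 (lt_irrefl _)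
    have hpush : ∀ (M2 : Memory) (r : Fin (m + 2)), replaceSel I J k l x = some r →
        M2 = M'.setNat 13 r → ∃ L : List (Fin I.card ⊕ Fin J.card), L.Nodup ∧
          (∀ y, y ∈ L ↔ position y < position x + 1 ∧ (replaceSel I J k l y).isSome) ∧
          ListedRows (replaceSel I J k l) (basisCol (J := J) h.card_compl rfl) L
            ((pushRow.effect M2).setNat 9 (position x + 1)) := by
      rintro _ r hr rfl
      refine ⟨L ++ [x], ?_, fun y => ?_, ListedRows.push (r := r) ?_ hr ?_ ?_ ?_ _⟩
      · rw [← List.concat_eq_append, List.nodup_concat]; exact ⟨hxL, hn⟩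
      · rw [List.mem_append, List.mem_singleton, hmem, position_lt_succ, or_and_right]
        refine or_congr_right ⟨fun hy => ⟨hy, by rw [hy, hr]; rfl⟩, fun hy => hy.1⟩
      · exact ⟨by simpa using hL.1, fun a ha => by simpa using hL.2 a ha⟩
      · simpa using hB.const.1
      · simp
      · simpa [hiq] using hB.cols x
    simp only [effect]
    split_ifs with h1 h2 h3
    · have hlx : l = some x := by
        rw [← position_eq_optPosition_iff h, ← l2, ← hiq]; exact h1
      refine hpush _ (Fin.natAdd m 1) (by simp [replaceSel, hlx]) ?_
      simp [Instr.run, hB.const.2.2.2]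
    · have hlx : l ≠ some x := by
        rw [Ne, ← position_eq_optPosition_iff h, ← l2, ← hiq]; exact h1
      have hkx : k = some x := by
        rw [← position_eq_optPosition_iff h, ← k2, ← hiq]; exact h2
      refine hpush _ (Fin.natAdd m 0) (by simp [replaceSel, hlx, hkx]) ?_
      simp [Instr.run, hB.dim.1]
    all_goals
      have hlx : l ≠ some x := by
        rw [Ne, ← position_eq_optPosition_iff h, ← l2, ← hiq]; exact h1
      have hkx : k ≠ some x := by
        rw [Ne, ← position_eq_optPosition_iff h, ← k2, ← hiq]; exact h2
      have hx : replaceSel I J k l x = basisSel J.card rfl x := by simp [replaceSel, hlx, hkx]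
      simp only [Test.Holds, hiq, hB.dim.2.2] at h3
    · rcases x with a | b
      · refine hpush _ (Fin.castAdd 2 (I.orderEmbOfFin rfl a)) hx ?_
        have : M'.natArr 1 0 (position (J := J) (.inl a)) = I.orderEmbOfFin rfl a := hB.rows a
        simp [Instr.run, hB.const.1, hiq, this]
      · exact absurd h3 (by simp [position])
    · rcases x with a | b
      · simp [position] at h3
      · refine ⟨L, hn, fun y => ?_, by simpa using hL.1, fun a ha => by simpa using hL.2 a ha⟩
        rw [hmem, position_lt_succ, or_and_right, or_iff_left]
        rintro ⟨rfl, hy⟩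
        rw [hx] at hy
        exact absurd hy (by simp [basisSel])
  · rw [hmem, and_iff_right (position_lt h x)]

end Determinant

section Determinant

open Instr Test Program

variable {m n : ℕ} {I : Finset (Fin m)} {J : Finset (Fin n)}

/-- Copies the submatrix with the rows and the columns listed in the arrays `5` and `6`: its moduli
to the real array `1`, and its signs to the array `7`. -/
def fillMatrix : Program :=
  seq (instr (natSucc 7 6)) (forUpTo 9 6 (seq (instr (natLoad 13 5 4 9))
    (forUpTo 18 6 (block [natLoad 12 6 4 18, realLoad 0 0 13 12, realStore 1 9 18 0,
      natLoad 12 0 13 12, natStore 7 9 18 12]))))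

theorem fillMatrix_spec {h : IsBasis I J} {T : Matrix (Fin (m + 2)) (Fin n) SignedTrop} {M : Memory}
    (hM : BasisMemory h T M) {K : ℕ} {r : Fin K → Fin (m + 2)} {c : Fin K → Fin n}
    (hK : M.nat 6 = K) (hr : ∀ a : Fin K, M.natArr 5 0 a = r a)
    (hc : ∀ a : Fin K, M.natArr 6 0 a = c a) :
    Terminates fillMatrix M (20 * (K + 1) ^ 2) fun M' => M'.nat 6 = K ∧ M'.nat 7 = K + 1 ∧
      (∀ i j : Fin K, M'.realArr 1 i j = (T (r i) (c j)).modulus.unbotD 0) ∧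
      ∀ i j : Fin K, M'.natArr 7 i j = signCode (T (r i) (c j)).sign := by
  refine ((Terminates.instr (Q := fun M' => M'.nat 7 = K + 1) (by simp [Instr.run, hK])).seq
    (t' := K * (1 + (K * 8 + 2) + 2) + 2) fun M1 hf1 hM1 => ?_).mono (by nlinarith) fun _ _ h => h
  have hB1 := hM.frame hf1 (by decide)
  have c6 : M1.nat 6 = K := (hf1.nat 6 rfl).trans hK
  have c5 : M1.natArr 5 = M.natArr 5 := hf1.natArr 5 rfl
  have cc : M1.natArr 6 = M.natArr 6 := hf1.natArr 6 rfl
  refine (Terminates.forUpTo (N := K) (c := 1 + (K * 8 + 2)) (fun k M' =>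
      (∀ i j : Fin K, (i : ℕ) < k → M'.realArr 1 i j = (T (r i) (c j)).modulus.unbotD 0) ∧
      ∀ i j : Fin K, (i : ℕ) < k → M'.natArr 7 i j = signCode (T (r i) (c j)).sign)
    c6 rfl rfl ⟨fun i j hi => absurd hi (Nat.not_lt_zero _),
      fun i j hi => absurd hi (Nat.not_lt_zero _)⟩ ?_).mono le_rfl fun M' hf h =>
        ⟨(hf.nat 6 rfl).trans c6, (hf.nat 7 rfl).trans hM1, fun i j => h.2.1 i j i.2,
          fun i j => h.2.2 i j i.2⟩
  intro i M2 hi hii hf2 ⟨hw, hs⟩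
  have hB2 := hB1.frame hf2 (by decide)
  refine (Terminates.instr (Q := fun M' => M' = M2.setNat 13 (r ⟨i, hi⟩)) ?_).seq
    fun M3 hf3 hM3 => ?_
  · have : M2.natArr 5 0 i = r ⟨i, hi⟩ := by
      rw [hf2.natArr 5 rfl, c5]; exact hr ⟨i, hi⟩
    simp [Instr.run, hB2.const.1, hii, this]
  have hB3 := hB2.frame hf3 (by decide)
  have d6 : M3.nat 6 = K := (hf3.nat 6 rfl).trans ((hf2.nat 6 rfl).trans c6)
  have d9 : M3.nat 9 = i := (hf3.nat 9 rfl).trans hii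
  have d13 : M3.nat 13 = r ⟨i, hi⟩ := by simp [hM3]
  have dc : M3.natArr 6 = M.natArr 6 := (hf3.natArr 6 rfl).trans ((hf2.natArr 6 rfl).trans cc)
  have dw : M3.realArr 1 = M2.realArr 1 := hf3.realArr 1 rfl
  have ds : M3.natArr 7 = M2.natArr 7 := hf3.natArr 7 rfl
  refine (Terminates.forUpTo (N := K) (c := 6) (fun k M' =>
      (∀ i' j : Fin K, (i' : ℕ) < i ∨ (i' : ℕ) = i ∧ (j : ℕ) < k →
        M'.realArr 1 i' j = (T (r i') (c j)).modulus.unbotD 0) ∧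
      ∀ i' j : Fin K, (i' : ℕ) < i ∨ (i' : ℕ) = i ∧ (j : ℕ) < k →
        M'.natArr 7 i' j = signCode (T (r i') (c j)).sign)
    d6 rfl rfl ⟨?_, ?_⟩ ?_).mono le_rfl fun M' hf h => ⟨?_, ?_⟩
  · rintro i' j (h | h)
    · simpa [dw] using hw i' j h
    · exact absurd h.2 (Nat.not_lt_zero _)
  · rintro i' j (h | h)
    · simpa [ds] using hs i' j h
    · exact absurd h.2 (Nat.not_lt_zero _)
  · intro j M4 hj hij hf4 ⟨hw4, hs4⟩
    have hB4 := hB3.frame hf4 (by decide)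
    have e13 : M4.nat 13 = r ⟨i, hi⟩ := (hf4.nat 13 rfl).trans d13
    have e9 : M4.nat 9 = i := (hf4.nat 9 rfl).trans d9
    have ec : M4.natArr 6 0 j = c ⟨j, hj⟩ := by
      rw [hf4.natArr 6 rfl, dc]; exact hc ⟨j, hj⟩
    have hmod := hB4.moduli (r ⟨i, hi⟩) (c ⟨j, hj⟩)
    have hsgn := hB4.signs (r ⟨i, hi⟩) (c ⟨j, hj⟩)
    have hcase : ∀ i' j' : Fin K, ((i' : ℕ) < i ∨ (i' : ℕ) = i ∧ (j' : ℕ) < j + 1) →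
        ((i' : ℕ) = i ∧ (j' : ℕ) = j) ∨ (¬ ((i' : ℕ) = i ∧ (j' : ℕ) = j) ∧
          ((i' : ℕ) < i ∨ (i' : ℕ) = i ∧ (j' : ℕ) < j)) := by omega
    refine (Terminates.block ?_).mono (by decide) fun _ _ h => h
    constructor
    · intro i' j' h'
      rcases hcase i' j' h' with ⟨hi', hj'⟩ | ⟨hne, h'⟩
      · obtain rfl : i' = ⟨i, hi⟩ := Fin.ext hi'
        obtain rfl : j' = ⟨j, hj⟩ := Fin.ext hj'
        simp [Instr.run, hij, e9, hB4.const.1, e13, ec, hmod]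
      · simpa [Instr.run, hij, e9, hB4.const.1, e13, ec, hne] using hw4 i' j' h'
    · intro i' j' h'
      rcases hcase i' j' h' with ⟨hi', hj'⟩ | ⟨hne, h'⟩
      · obtain rfl : i' = ⟨i, hi⟩ := Fin.ext hi'
        obtain rfl : j' = ⟨j, hj⟩ := Fin.ext hj'
        simp [Instr.run, hij, e9, hB4.const.1, e13, ec, hsgn]
      · simpa [Instr.run, hij, e9, hB4.const.1, e13, ec, hne] using hs4 i' j' h'
  · intro i' j hi'
    simpa using h.2.1 i' j (by omega)
  · intro i' j hi'
    simpa using h.2.2 i' j (by omega)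

/-- Computes the sign of the determinant attached to the positions in the registers `21` and `22`.
The code of the sign goes to register `16`. -/
def basisSign : Program := seq listRows (seq fillMatrix (seq hungarian permSign))

/-- The determinant is the minor of the listed rows and columns, which are not sorted, but are
listed in the same order of positions. -/
theorem basisSign_spec {h : IsBasis I J} {T : Matrix (Fin (m + 2)) (Fin n) SignedTrop}
    {N : Matrix (Fin (m + 2)) (Fin n) Puiseux} (hN : IsLift N T) (hT : StronglyNonDegenerate T)
    {M : Memory} (hM : BasisMemory h T M) {k l : Option (Fin I.card ⊕ Fin J.card)}
    (hkl : k = l → k = none) (hk : M.nat 21 = optPosition n k) (hl : M.nat 22 = optPosition n l) :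
    Terminates basisSign M (200 * (n + 1) ^ 3) fun M' =>
      M'.nat 16 = signCode (SignType.sign (basisDet h N k l)) := by
  refine ((listRows_spec hM hk hl).seq
    (t' := 20 * (n + 1) ^ 2 + (110 * (n + 1) ^ 3 + 40 * (n + 1) ^ 2))
    fun M1 hf1 ⟨L, hnd, hmem, hlen, hL⟩ => ?_).mono (by ring_nf; omega) fun _ _ h => h
  have hB1 := hM.frame hf1 (by decide)
  have hLn : L.length ≤ n := by
    have := hnd.length_le_card
    rwa [Fintype.card_sum, Fintype.card_fin, Fintype.card_fin, h] at this
  set col := basisCol (J := J) h.card_compl rfl with hcol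
  choose r hr hr' using fun a : Fin L.length => (hL a a.2).1
  have hinj : Function.Injective L.get := List.nodup_iff_injective_get.1 hnd
  have hrinj : Function.Injective r := fun a b hab =>
    hinj (replaceSel_injective hkl (hr a) (by rw [hab]; exact hr b))
  have hcinj : Function.Injective (col ∘ L.get) := col.injective.comp hinj
  have hdet : basisDet h N k l = (N.submatrix r (col ∘ L.get)).det := by
    refine det_selMatrix N col _ hinj (fun q hq => ?_) hr
    rw [Set.mem_range, ← List.mem_iff_get, hmem] at hq
    simpa using hq
  have hpow2 : (L.length + 1) ^ 2 ≤ (n + 1) ^ 2 := Nat.pow_le_pow_left (by omega) 2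
  have hpow3 : (L.length + 1) ^ 3 ≤ (n + 1) ^ 3 := Nat.pow_le_pow_left (by omega) 3
  refine ((fillMatrix_spec hB1 hlen hr' fun a => (hL a a.2).2).mono
    (Nat.mul_le_mul_left 20 hpow2) fun _ _ h => h).seq fun M2 hf2 ⟨h6, h7, hw, hs⟩ => ?_
  have hB2 := hB1.frame hf2 (by decide)
  refine ((hungarian_spec hB2.const.1 hB2.const.2.1 h6 h7).mono
    (Nat.mul_le_mul_left 110 hpow3) fun _ _ h => h).seq fun M3 hf3 hM3 => ?_
  have hB3 := hB2.frame hf3 (by decide)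
  refine (permSign_spec hB3.const.1 hB3.const.2.1 hB3.const.2.2.1 ((hf3.nat 6 rfl).trans h6)).mono
    (Nat.mul_le_mul_left 40 hpow2) fun M4 _ hM4 => ?_
  rw [hM4, hdet]
  refine (hN.sign_det_of_isMatching hT hrinj hcinj hM3 ?_ ?_).symm
  · intro i j; rw [hf3.realArr 1 rfl]; exact hw i j
  · intro i j; rw [hf3.natArr 7 rfl]; exact hs i j

end Determinant

/-! ### The program for the shadow-vertex rule

The array `4` contains the columns in the order in which the basis numbers them, and register `20`
is the number of columns written so far.  The positions at which the rows `u` and `v` replace the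
rows of the basis are in the registers `21` and `22`, and the register `23` contains `m + 1`, the
number of the row `v`. -/

section Driver

open Instr Test Program

variable {m n : ℕ} {I : Finset (Fin m)} {J : Finset (Fin n)}

theorem nthElement_eq {p k : ℕ} (S : Finset (Fin p)) (hk : S.card = k) (a : Fin k) :
    nthElement S a = S.orderEmbOfFin hk a := by
  have ha : (a : ℕ) < S.sort.length := by rw [Finset.length_sort, hk]; exact a.2
  rw [nthElement, List.getD_eq_getElem _ _ (by simpa using ha), List.getElem_map]
  rfl

theorem card_filter_lt_orderEmbOfFin {p k : ℕ} (S : Finset (Fin p)) (hk : S.card = k) (a : Fin k) :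
    (S.filter (· < S.orderEmbOfFin hk a)).card = a := by
  have : S.filter (· < S.orderEmbOfFin hk a) =
      (Finset.Iio a).map (S.orderEmbOfFin hk).toEmbedding := by
    ext x
    simp only [Finset.mem_filter, Finset.mem_map, Finset.mem_Iio]
    constructor
    · rintro ⟨hx, hlt⟩
      rw [← Finset.mem_coe, ← Finset.range_orderEmbOfFin S hk] at hx
      obtain ⟨b, rfl⟩ := hx
      exact ⟨b, by simpa using hlt, rfl⟩
    · rintro ⟨b, hb, rfl⟩
      exact ⟨Finset.orderEmbOfFin_mem S hk b, by simpa using hb⟩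
  rw [this, Finset.card_map, Fin.card_Iio]

/-- Writes to the array `4` the columns outside of `J`, then those in `J`.  The entries of the
array `3` are set to `1` at the elements of `J`, and are `0` elsewhere. -/
def listColumns : Program :=
  seq (forUpTo 9 3 (block [natLoad 12 2 4 9, natStore 3 4 12 5]))
    (seq (instr (natCopy 20 4))
      (seq (forUpTo 9 1 (seq (instr (natLoad 12 3 4 9))
          (ite (natEq 12 4) (block [natStore 4 4 20 9, natSucc 20 20]) skip)))
        (forUpTo 9 3 (block [natLoad 12 2 4 9, natStore 4 4 20 12, natSucc 20 20]))))

theorem listColumns_spec (h : IsBasis I J) {M : Memory} (hn : M.nat 1 = n) (hJ : M.nat 3 = J.card)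
    (hZ : M.nat 4 = 0) (hone : M.nat 5 = 1)
    (hcols : ∀ b : Fin J.card, M.natArr 2 0 b = J.orderEmbOfFin rfl b)
    (hflags : ∀ j, M.natArr 3 0 j = 0) :
    Terminates listColumns M (20 * n + 20) fun M' =>
      ∀ q, M'.natArr 4 0 (position q) = basisCol (J := J) h.card_compl rfl q := by
  have hJn : J.card ≤ n := by unfold IsBasis at h; omega
  refine ((Terminates.forUpTo (N := J.card) (c := 3) (fun k M' => ∀ j : Fin n,
      M'.natArr 3 0 j ≠ 0 ↔ ∃ b : Fin J.card, (b : ℕ) < k ∧ J.orderEmbOfFin rfl b = j)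
    hJ rfl rfl (by simp [hflags]) ?_).seq
      (t' := 1 + ((n * (5 + 2) + 2) + (J.card * (4 + 2) + 2))) fun M1 hf1 ⟨_, hM1⟩ => ?_).mono
        (by omega) fun _ _ h => h
  · intro k M' hk hik hf hinv
    have e4 : M'.nat 4 = 0 := (hf.nat 4 rfl).trans hZ
    have e5 : M'.nat 5 = 1 := (hf.nat 5 rfl).trans hone
    have e2 : M'.natArr 2 0 k = J.orderEmbOfFin rfl ⟨k, hk⟩ := by
      rw [hf.natArr 2 rfl]; exact hcols ⟨k, hk⟩
    refine (Terminates.block ?_).mono (by decide) fun _ _ h => h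
    intro j
    by_cases hj : J.orderEmbOfFin rfl ⟨k, hk⟩ = j
    · refine iff_of_true ?_ ⟨⟨k, hk⟩, Nat.lt_succ_self k, hj⟩
      simp [Instr.run, e4, e5, e2, hik, hj]
    · have hj' : (j : ℕ) ≠ J.orderEmbOfFin rfl ⟨k, hk⟩ := fun h => hj (Fin.ext h.symm)
      have := hinv j
      simp only [List.foldl_cons, List.foldl_nil, Instr.run, hik, e4, e2, Memory.setNat_natArr,
        Memory.setNatArr_natArr, Memory.setNat_nat, hj', and_false, if_false, if_true,
        Nat.reduceEqDiff, this]
      constructor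
      · rintro ⟨b, hb, rfl⟩; exact ⟨b, hb.trans (Nat.lt_succ_self k), rfl⟩
      · rintro ⟨b, hb, rfl⟩
        refine ⟨b, lt_of_le_of_ne (Nat.lt_succ_iff.1 hb) fun hbk => hj ?_, rfl⟩
        congr 1; exact Fin.ext hbk.symm
  · have hflag : ∀ j : Fin n, M1.natArr 3 0 j = 0 ↔ j ∈ Jᶜ := by
      intro j
      rw [Finset.mem_compl, ← not_iff_not, not_not, ← Ne, hM1, ← Finset.mem_coe,
        ← Finset.range_orderEmbOfFin J rfl]
      exact ⟨fun ⟨b, _, hb⟩ => ⟨b, hb⟩, fun ⟨b, hb⟩ => ⟨b, b.2, hb⟩⟩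
    have c4 : M1.nat 4 = 0 := (hf1.nat 4 rfl).trans hZ
    refine (Terminates.instr (Q := fun M' => M' = M1.setNat 20 0) (by rw [← c4]; rfl)).seq
      fun M2 hf2 hM2 => ?_
    have d4 : M2.nat 4 = 0 := (hf2.nat 4 rfl).trans c4
    have d1 : M2.nat 1 = n := (hf2.nat 1 rfl).trans ((hf1.nat 1 rfl).trans hn)
    have d3 : M2.nat 3 = J.card := (hf2.nat 3 rfl).trans ((hf1.nat 3 rfl).trans hJ)
    have dflag : M2.natArr 3 = M1.natArr 3 := hf2.natArr 3 rfl
    have d2 : M2.natArr 2 = M.natArr 2 := (hf2.natArr 2 rfl).trans (hf1.natArr 2 rfl)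
    -- The place of a column `j` outside of `J` is the number of such columns before `j`.
    refine (Terminates.forUpTo (N := n) (c := 5) (fun k M' =>
        M'.nat 20 = (Jᶜ.filter fun j : Fin n => (j : ℕ) < k).card ∧
        ∀ j : Fin n, j ∈ Jᶜ → (j : ℕ) < k → M'.natArr 4 0 (Jᶜ.filter (· < j)).card = j)
      d1 rfl rfl ⟨by simp [hM2], fun j _ hj => absurd hj (Nat.not_lt_zero _)⟩ ?_).seq
        fun M3 hf3 ⟨_, h20, h4⟩ => ?_
    · intro k M' hk hik hf ⟨h20, h4⟩
      have e4 : M'.nat 4 = 0 := (hf.nat 4 rfl).trans d4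
      have e3 : M'.natArr 3 0 k = 0 ↔ (⟨k, hk⟩ : Fin n) ∈ Jᶜ := by
        rw [hf.natArr 3 rfl, dflag]; exact hflag ⟨k, hk⟩
      refine (Terminates.of_loopFree rfl ?_).mono (t := Program.cost _) (by decide) fun _ _ h => h
      by_cases hkJ : (⟨k, hk⟩ : Fin n) ∈ Jᶜ
      · have hsucc : Jᶜ.filter (fun j : Fin n => (j : ℕ) < k + 1) =
            insert ⟨k, hk⟩ (Jᶜ.filter fun j : Fin n => (j : ℕ) < k) := by
          ext j
          rw [Finset.mem_insert, Finset.mem_filter, Finset.mem_filter, Fin.ext_iff]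
          constructor
          · rintro ⟨hj, hlt⟩
            rcases Nat.lt_succ_iff_lt_or_eq.1 hlt with h | h
            · exact Or.inr ⟨hj, h⟩
            · exact Or.inl h
          · rintro (hj | ⟨hj, hlt⟩)
            · obtain rfl : j = ⟨k, hk⟩ := Fin.ext hj
              exact ⟨hkJ, Nat.lt_succ_self k⟩
            · exact ⟨hj, hlt.trans (Nat.lt_succ_self k)⟩
        have hcard : (Jᶜ.filter fun j : Fin n => (j : ℕ) < k + 1).card =
            (Jᶜ.filter fun j : Fin n => (j : ℕ) < k).card + 1 := by
          rw [hsucc, Finset.card_insert_of_notMem (by simp)]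
        have hk0 := e3.2 hkJ
        rw [hcard]
        refine ⟨by simp [effect, block, Instr.run, Test.Holds, e4, hik, hk0, h20],
          fun j hj hlt => ?_⟩
        by_cases hjk : (j : ℕ) = k
        · obtain rfl : j = ⟨k, hk⟩ := Fin.ext hjk
          have : (Jᶜ.filter (· < (⟨k, hk⟩ : Fin n))).card =
            (Jᶜ.filter fun j : Fin n => (j : ℕ) < k).card := rfl
          rw [this]
          simp [effect, block, Instr.run, Test.Holds, e4, hik, hk0, h20]
        · have hjlt : (j : ℕ) < k := by omega
          have hne : (Jᶜ.filter (· < j)).card ≠ (Jᶜ.filter fun j : Fin n => (j : ℕ) < k).card := by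
            refine (Finset.card_lt_card ⟨fun x hx => ?_, fun hs => ?_⟩).ne
            · rw [Finset.mem_filter] at hx ⊢
              exact ⟨hx.1, (Fin.lt_def.1 hx.2).trans hjlt⟩
            · have := hs (Finset.mem_filter.2 ⟨hj, hjlt⟩)
              exact lt_irrefl _ (Finset.mem_filter.1 this).2
          simpa [effect, block, Instr.run, Test.Holds, e4, hik, hk0, h20, hne] using h4 j hj hjlt
      · have hsucc : Jᶜ.filter (fun j : Fin n => (j : ℕ) < k + 1) =
            Jᶜ.filter fun j : Fin n => (j : ℕ) < k := by
          refine Finset.filter_congr fun j hj => ?_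
          have : (j : ℕ) ≠ k := fun h => hkJ (by
            rwa [show (⟨k, hk⟩ : Fin n) = j from Fin.ext h.symm])
          omega
        have hk0 := e3.not.2 hkJ
        rw [hsucc]
        refine ⟨by simpa [effect, block, Instr.run, Test.Holds, e4, hik, hk0] using h20,
          fun j hj hlt => ?_⟩
        have : (j : ℕ) ≠ k := fun h => hkJ (by rwa [show (⟨k, hk⟩ : Fin n) = j from Fin.ext h.symm])
        simpa [effect, block, Instr.run, Test.Holds, e4, hik, hk0] using h4 j hj (by omega)
    · have h20' : M3.nat 20 = I.card := by
        rw [h20, ← h.card_compl]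
        congr 1
        exact Finset.filter_true_of_mem fun j _ => j.2
      have c3 : M3.nat 3 = J.card := (hf3.nat 3 rfl).trans d3
      have c2 : M3.natArr 2 = M.natArr 2 := (hf3.natArr 2 rfl).trans d2
      have c40 : M3.nat 4 = 0 := (hf3.nat 4 rfl).trans d4
      refine (Terminates.forUpTo (N := J.card) (c := 4) (fun k M' => M'.nat 20 = I.card + k ∧
          ∀ q : Fin I.card ⊕ Fin J.card, position q < I.card + k →
            M'.natArr 4 0 (position q) = basisCol (J := J) h.card_compl rfl q)
        c3 rfl rfl ⟨by simpa using h20', ?_⟩ ?_).mono le_rfl fun M' _ h' q => h'.2.2 q ?_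
      · rintro (a | b) hlt
        · have ha := card_filter_lt_orderEmbOfFin Jᶜ h.card_compl a
          have := h4 _ (Finset.orderEmbOfFin_mem Jᶜ h.card_compl a) (Fin.is_lt _)
          rw [ha] at this
          rw [basisCol_inl]
          simpa [position] using this
        · simp [position] at hlt
      · intro k M' hk hik hf ⟨h20, hinv⟩
        have e4 : M'.nat 4 = 0 := (hf.nat 4 rfl).trans c40
        have e2 : M'.natArr 2 0 k = J.orderEmbOfFin rfl ⟨k, hk⟩ := by
          rw [hf.natArr 2 rfl, c2]; exact hcols ⟨k, hk⟩
        refine (Terminates.block ?_).mono (by decide) fun _ _ h => h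
        refine ⟨by simp [Instr.run, h20, add_assoc], fun q hq => ?_⟩
        by_cases hqk : position q = I.card + k
        · obtain rfl : q = .inr ⟨k, hk⟩ := by
            apply position_injective; rw [hqk]; simp [position]
          rw [basisCol_inr, hqk]
          simp [Instr.run, h20, e4, hik, e2]
        · simpa [Instr.run, h20, e4, hik, e2, hqk] using hinv q (by omega)
      · rw [show I.card + J.card = n from h]; exact position_lt h q

end Driver

section Driver

open Instr Test Program

variable {m n : ℕ} {I : Finset (Fin m)} {J : Finset (Fin n)}

/-- Among the positions before `k`, the optional position `o` is a candidate with the smallest ratio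
of reduced costs, or `none` if there is no candidate. -/
def IsBest (h : IsBasis I J) (N : Matrix (Fin (m + 2)) (Fin n) Puiseux) (k : ℕ)
    (o : Option (Fin I.card ⊕ Fin J.card)) : Prop :=
  (o = none → ∀ x, position x < k → ¬ IsCandidate h N x) ∧
    ∀ y, o = some y → (position y < k ∧ IsCandidate h N y) ∧
      ∀ x, position x < k → IsCandidate h N x → costRatio h N y ≤ costRatio h N x

section

variable {h : IsBasis I J} {N : Matrix (Fin (m + 2)) (Fin n) Puiseux}
  {o : Option (Fin I.card ⊕ Fin J.card)} {x : Fin I.card ⊕ Fin J.card}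

theorem IsBest.zero : IsBest h N 0 none :=
  ⟨fun _ _ hx => absurd hx (Nat.not_lt_zero _), fun _ h => absurd h (by simp)⟩

/-- The choice remains the best one if the new position is no better candidate. -/
theorem IsBest.keep (ho : IsBest h N (position x) o)
    (hx : IsCandidate h N x → ∃ y, o = some y ∧ costRatio h N y ≤ costRatio h N x) :
    IsBest h N (position x + 1) o := by
  constructor
  · intro hn z hz hc
    rcases position_lt_succ.1 hz with hz | rfl
    · exact ho.1 hn z hz hc
    · obtain ⟨y, hy, -⟩ := hx hc
      rw [hn] at hy; exact absurd hy (by simp)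
  · intro y hy
    refine ⟨⟨(ho.2 y hy).1.1.trans (Nat.lt_succ_self _), (ho.2 y hy).1.2⟩, fun z hz hc => ?_⟩
    rcases position_lt_succ.1 hz with hz | rfl
    · exact (ho.2 y hy).2 z hz hc
    · obtain ⟨y', hy', hle⟩ := hx hc
      rw [hy] at hy'
      exact Option.some_injective _ hy' ▸ hle

/-- A better candidate becomes the best one. -/
theorem IsBest.replace (ho : IsBest h N (position x) o) (hx : IsCandidate h N x)
    (hlt : ∀ y, o = some y → costRatio h N x ≤ costRatio h N y) :
    IsBest h N (position x + 1) (some x) := by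
  refine ⟨fun h => absurd h (by simp), fun y hy => ?_⟩
  obtain rfl := Option.some_injective _ hy
  refine ⟨⟨Nat.lt_succ_self _, hx⟩, fun z hz hc => ?_⟩
  rcases position_lt_succ.1 hz with hz | rfl
  · rcases o with _ | y
    · exact absurd hc (ho.1 rfl z hz)
    · exact (hlt y rfl).trans ((ho.2 y rfl).2 z hz hc)
  · exact le_rfl

end

/-- Computes the sign of the determinant attached to the positions in the registers `i` and `j`. -/
def callSign (i j : ℕ) : Program :=
  seq (block [natCopy 21 i, natCopy 22 j]) basisSign

/-- Compares the position in register `25` with the best one so far, in register `26`.  The content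
`n` of register `1` stands for `none`, and register `24` contains the sign of the determinant of the
basis. -/
def updateBest : Program :=
  seq (callSign 25 1) (ite (natEq 16 24)
    (seq (callSign 1 25) (ite (natEq 16 24)
      (ite (natEq 26 1) (instr (natCopy 26 25))
        (seq (callSign 26 25) (ite (natEq 16 24) (instr (natCopy 26 25)) skip))) skip)) skip)

/-- Finds the best candidate. -/
def findBest : Program :=
  seq (callSign 1 1) (seq (block [natCopy 24 16, natCopy 26 1]) (forUpTo 25 1 updateBest))

/-- Translates the position in register `26` to the element of `I ⊎ J`. -/
def writeOutput : Program :=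
  ite (natEq 26 1) (instr (natCopy 0 4)) (ite (natLt 26 2)
    (block [natLoad 1 1 4 26, natConst 0 1]) (block [natLoad 1 4 4 26, natConst 0 2]))

/-- The program for the shadow-vertex rule. -/
def shadowProgram : Program :=
  seq (block [natConst 4 0, natConst 5 1, natConst 17 2, natSucc 23 0])
    (seq listColumns (seq findBest writeOutput))

section

variable {h : IsBasis I J} {T : Matrix (Fin (m + 2)) (Fin n) SignedTrop}
  {N : Matrix (Fin (m + 2)) (Fin n) Puiseux}

theorem callSign_spec (hN : IsLift N T) (hT : StronglyNonDegenerate T) {M : Memory}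
    (hM : BasisMemory h T M) {i j : ℕ} (hj : j ≠ 21) {k l : Option (Fin I.card ⊕ Fin J.card)}
    (hkl : k = l → k = none) (hk : M.nat i = optPosition n k) (hl : M.nat j = optPosition n l) :
    Terminates (callSign i j) M (200 * (n + 1) ^ 3 + 3) fun M' =>
      M'.nat 16 = signCode (SignType.sign (basisDet h N k l)) := by
  refine ((Terminates.block (Q := fun M' => M' = (M.setNat 21 (M.nat i)).setNat 22 (M.nat j))
    ?_).seq (t' := 200 * (n + 1) ^ 3) fun M1 hf1 hM1 => ?_).mono (by simp; omega) fun _ _ h => h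
  · simp [Instr.run, hj]
  · refine basisSign_spec hN hT (hM.frame hf1 rfl) hkl ?_ ?_ <;> simp [hM1, hk, hl]

variable {A : Matrix (Fin m) (Fin n) SignedTrop} {u v : Fin n → SignedTrop}

/-- If the positions of the best candidate `y` and of the new candidate `x` give a determinant of
the same sign as that of the basis, then `x` has the smaller ratio, by `costRatio_lt_iff`. -/
theorem updateBest_spec (hN : IsLift N (stack A u v))
    (hT : StronglyNonDegenerate (stack A u v)) {M : Memory} (hM : BasisMemory h (stack A u v) M)
    {x : Fin I.card ⊕ Fin J.card}
    {o : Option (Fin I.card ⊕ Fin J.card)} (ho : IsBest h N (position x) o)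
    (h24 : M.nat 24 = signCode (SignType.sign (basisDet h N none none)))
    (h25 : M.nat 25 = position x) (h26 : M.nat 26 = optPosition n o) :
    Terminates updateBest M (700 * (n + 1) ^ 3) fun M' =>
      ∃ o, M'.nat 26 = optPosition n o ∧ IsBest h N (position x + 1) o := by
  have hpos : 1 ≤ (n + 1) ^ 3 := Nat.one_le_pow _ _ (Nat.succ_pos n)
  have hx : M.nat 25 = optPosition n (some x) := h25
  have hn : M.nat 1 = optPosition n (none : Option (Fin I.card ⊕ Fin J.card)) := hM.dim.2.1
  refine ((callSign_spec hN hT hM (by decide) (k := some x) (l := none) (by simp) hx hn).seq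
    fun M1 hf1 h1 => ?_).mono (t := 200 * (n + 1) ^ 3 + 3 + (200 * (n + 1) ^ 3 + 3 +
      (200 * (n + 1) ^ 3 + 3 + (1 + 1) + 1 + 1) + 1)) (by omega) fun _ _ h => h
  have hB1 := hM.frame hf1 rfl
  have e24 := (hf1.nat 24 rfl).trans h24
  have e25 := (hf1.nat 25 rfl).trans hx
  have e26 := (hf1.nat 26 rfl).trans h26
  have e1 := (hf1.nat 1 rfl).trans hn
  refine Terminates.ite (fun hb => ?_) fun hb => ?_
  swap
  · refine (Terminates.skip ⟨o, e26, ho.keep fun hc => absurd ?_ hb⟩).mono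
      (by omega) fun _ _ h => h
    rw [Test.Holds, h1, e24, hc.1]
  have hc1 : SignType.sign (basisDet h N (some x) none) =
      SignType.sign (basisDet h N none none) := signCode_injective (by rw [← h1, ← e24]; exact hb)
  refine (callSign_spec hN hT hB1 (by decide) (k := none) (l := some x) (by simp) e1 e25).seq
    fun M2 hf2 h2 => ?_
  have hB2 := hB1.frame hf2 rfl
  have d24 := (hf2.nat 24 rfl).trans e24
  have d25 := (hf2.nat 25 rfl).trans e25
  have d26 := (hf2.nat 26 rfl).trans e26
  have d1 := (hf2.nat 1 rfl).trans e1
  refine Terminates.ite (fun hb => ?_) fun hb => ?_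
  swap
  · refine (Terminates.skip ⟨o, d26, ho.keep fun hc => absurd ?_ hb⟩).mono
      (by omega) fun _ _ h => h
    rw [Test.Holds, h2, d24, hc.2]
  have hc : IsCandidate h N x :=
    ⟨hc1, signCode_injective (by rw [← h2, ← d24]; exact hb)⟩
  refine Terminates.ite (fun hb => ?_) fun hb => ?_
  · obtain rfl : o = none := by
      rcases o with _ | y
      · rfl
      · have hb' : M2.nat 26 = M2.nat 1 := hb
        rw [d26, d1] at hb'
        exact absurd hb' (position_lt h y).ne
    refine (Terminates.instr ⟨some x, ?_, ho.replace hc fun y hy => absurd hy (by simp)⟩).mono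
      (by omega) fun _ _ h => h
    simpa [Instr.run] using d25
  · obtain ⟨y, rfl⟩ : ∃ y, o = some y := by
      rcases o with _ | y
      · exact absurd (d26.trans d1.symm) hb
      · exact ⟨y, rfl⟩
    obtain ⟨⟨hyx, hcy⟩, -⟩ := ho.2 y rfl
    have hne : y ≠ x := fun h => by rw [h] at hyx; exact lt_irrefl _ hyx
    refine ((callSign_spec hN hT hB2 (by decide) (k := some y) (l := some x)
      (by simpa using hne) d26 d25).seq (t' := 1 + 1) fun M3 hf3 h3 => ?_).mono
        (by omega) fun _ _ h => h
    have c24 := (hf3.nat 24 rfl).trans d24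
    have c25 := (hf3.nat 25 rfl).trans d25
    have c26 := (hf3.nat 26 rfl).trans d26
    have hD0 := basisDet_ne_zero h hN hT (k := none) (l := none) (by simp)
    have hD := basisDet_ne_zero h hN hT (k := some y) (l := some x) (by simpa using hne)
    have hlt := costRatio_lt_iff h hN hT hcy hc hne
    refine Terminates.ite (fun hb => ?_) fun hb => ?_
    · have hs : SignType.sign (basisDet h N (some y) (some x)) =
          SignType.sign (basisDet h N none none) :=
        signCode_injective (by rw [← h3, ← c24]; exact hb)
      refine Terminates.instr ⟨some x, by simpa [Instr.run] using c25, ho.replace hc ?_⟩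
      rintro y' hy'
      obtain rfl := Option.some_injective _ hy'
      rw [← not_lt, hlt, not_lt]
      rcases lt_or_gt_of_ne hD0 with h0 | h0
      · rw [sign_neg h0, sign_eq_neg_one_iff] at hs
        exact (mul_pos_of_neg_of_neg h0 hs).le
      · rw [sign_pos h0, sign_eq_one_iff] at hs
        exact (mul_pos h0 hs).le
    · refine Terminates.skip ⟨some y, c26, ho.keep fun _ => ⟨y, rfl, (hlt.2 ?_).le⟩⟩
      have hs : SignType.sign (basisDet h N (some y) (some x)) ≠
          SignType.sign (basisDet h N none none) := fun hs => hb (by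
        rw [Test.Holds, h3, c24, hs])
      rcases lt_or_gt_of_ne hD0 with h0 | h0 <;> rcases lt_or_gt_of_ne hD with h1 | h1
      · exact absurd (by rw [sign_neg h0, sign_neg h1]) hs
      · exact mul_neg_of_neg_of_pos h0 h1
      · exact mul_neg_of_pos_of_neg h0 h1
      · exact absurd (by rw [sign_pos h0, sign_pos h1]) hs

theorem findBest_spec (hN : IsLift N (stack A u v))
    (hT : StronglyNonDegenerate (stack A u v)) {M : Memory} (hM : BasisMemory h (stack A u v) M) :
    Terminates findBest M (1000 * (n + 1) ^ 4) fun M' =>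
      ∃ o, M'.nat 26 = optPosition n o ∧ IsBest h N n o := by
  have hn : M.nat 1 = optPosition n (none : Option (Fin I.card ⊕ Fin J.card)) := hM.dim.2.1
  refine ((callSign_spec hN hT hM (by decide) (fun h => h) hn hn).seq
    (t' := 3 + (n * (700 * (n + 1) ^ 3 + 2) + 2)) fun M1 hf1 h1 => ?_).mono
      (by ring_nf; omega) fun _ _ h => h
  have hB1 := hM.frame hf1 rfl
  refine (Terminates.block (Q := fun M' => M' = (M1.setNat 24 (M1.nat 16)).setNat 26 n) ?_).seq
    fun M2 hf2 hM2 => ?_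
  · simp [Instr.run, hB1.dim.2.1]
  · have hB2 := hB1.frame hf2 rfl
    refine (Terminates.forUpTo (N := n) (c := 700 * (n + 1) ^ 3)
      (fun k M' => ∃ o, M'.nat 26 = optPosition n o ∧ IsBest h N k o) hB2.dim.2.1 rfl rfl
      ⟨none, by simp [hM2, optPosition], IsBest.zero⟩ ?_).mono le_rfl fun _ _ h => h.2
    intro k M3 hk hik hf3 ⟨o, h26, ho⟩
    obtain ⟨x, rfl⟩ := exists_position_eq h hk
    refine (updateBest_spec hN hT (hB2.frame hf3 rfl) ho ?_ hik h26).mono le_rfl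
      fun M' _ h' => by simpa using h'
    rw [hf3.nat 24 rfl, hM2]
    simpa using h1

end

theorem shadowProgram_spec (h : IsBasis I J) {A : Matrix (Fin m) (Fin n) SignedTrop}
    {u v : Fin n → SignedTrop} {N : Matrix (Fin (m + 2)) (Fin n) Puiseux}
    (hN : IsLift N (stack A u v)) (hM : StronglyNonDegenerate (stack A u v)) :
    Terminates shadowProgram (inputMemory (stack A u v) I J) (1100 * (n + 1) ^ 4) fun M' =>
      ∃ o, IsTropShadowVertexValue A u v I J o ∧ Encodes M' o := by
  have hpos : n + 1 ≤ (n + 1) ^ 4 := Nat.le_self_pow (by decide) _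
  refine ((Terminates.block (cs := [natConst 4 0, natConst 5 1, natConst 17 2, natSucc 23 0])
    (Q := fun M' => (M'.nat 4 = 0 ∧ M'.nat 5 = 1 ∧ M'.nat 17 = 2 ∧ M'.nat 23 = m + 1)) ?_).seq
    (t' := (20 * n + 20) + (1000 * (n + 1) ^ 4 + 10)) fun M1 hf1 hc => ?_).mono
      (by simp; omega) fun _ _ h => h
  · simp [Instr.run, inputMemory]
  have c0 : M1.nat 0 = m := hf1.nat 0 rfl
  have c1 : M1.nat 1 = n := hf1.nat 1 rfl
  have c2 : M1.nat 2 = I.card := hf1.nat 2 rfl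
  have c3 : M1.nat 3 = J.card := hf1.nat 3 rfl
  refine (listColumns_spec h c1 c3 hc.1 hc.2.1 (fun b => ?_) (fun j => ?_)).seq
    fun M2 hf2 hcols => ?_
  · rw [hf1.natArr 2 rfl]
    exact nthElement_eq J rfl b
  · rw [hf1.natArr 3 rfl]; rfl
  have hB : BasisMemory h (stack A u v) M2 := by
    refine ⟨?_, ?_, fun i j => ?_, fun i j => ?_, fun a => ?_, hcols⟩
    · rw [hf2.nat 0 rfl, hf2.nat 1 rfl, hf2.nat 2 rfl]; exact ⟨c0, c1, c2⟩
    · rw [hf2.nat 4 rfl, hf2.nat 5 rfl, hf2.nat 17 rfl, hf2.nat 23 rfl]; exact hc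
    · rw [hf2.natArr 0 rfl, hf1.natArr 0 rfl]
      simp [inputMemory]
    · rw [hf2.realArr 0 rfl, hf1.realArr 0 rfl]
      simp [inputMemory]
    · rw [hf2.natArr 1 rfl, hf1.natArr 1 rfl]
      exact nthElement_eq I rfl a
  refine (findBest_spec hN hM hB).seq fun M3 hf3 ⟨o, h26, ho⟩ => ?_
  have hB3 := hB.frame hf3 rfl
  have hlt := position_lt h
  refine (Terminates.of_loopFree rfl ?_).mono (t := Program.cost _) (by decide) fun _ _ h => h
  rcases o with _ | y
  · refine ⟨none, (isTropShadowVertexValue_none_iff h hN hM).2 fun q =>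
      ho.1 rfl q (hlt q), ?_⟩
    simp [writeOutput, effect, Instr.run, Test.Holds, h26, hB3.dim.2.1, hB3.const.1, optPosition,
      Encodes]
  · obtain ⟨⟨-, hcand⟩, hmin⟩ := ho.2 y rfl
    refine ⟨some (basisLabel rfl rfl y), (isTropShadowVertexValue_some_iff h hN hM y).2
      ⟨hcand, fun q => hmin q (hlt q)⟩, ?_⟩
    have hyn : M3.nat 26 ≠ M3.nat 1 := by
      rw [h26, hB3.dim.2.1]; exact (hlt y).ne
    rcases y with a | b
    · have e26 : M3.nat 26 = a := h26
      have hrow := hB3.rows a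
      have ha : M3.nat 26 < M3.nat 2 := by rw [e26, hB3.dim.2.2]; exact a.2
      simp only [writeOutput, effect, Test.Holds, hyn, ha, if_true, if_false]
      simp [block, effect, Instr.run, Encodes, basisLabel, hB3.const.1, e26, hrow]
    · have e26 : M3.nat 26 = position (I := I) (.inr b) := h26
      have hcol := hB3.cols (.inr b)
      have ha : ¬ M3.nat 26 < M3.nat 2 := by rw [e26, hB3.dim.2.2]; simp [position]
      simp only [writeOutput, effect, Test.Holds, hyn, ha, if_false]
      rw [basisCol_inr] at hcol
      simp [block, effect, Instr.run, Encodes, basisLabel, hB3.const.1, e26, hcol]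

end Driver

end TropShadow

theorem mainTheorem1 :
    (∀ (m n : ℕ) (A : Matrix (Fin m) (Fin n) SignedTrop) (u v : Fin n → SignedTrop),
      StronglyNonDegenerate (stack A u v) →
        ∀ (I : Finset (Fin m)) (J : Finset (Fin n)), IsBasis I J →
          TropRuleWellDefined A u v I J ∧
          ∀ (A' : Matrix (Fin m) (Fin n) Puiseux) (u' v' : Fin n → Puiseux),
            (∀ i j, sval (A' i j) = A i j) → (∀ j, sval (u' j) = u j) →
            (∀ j, sval (v' j) = v j) →
              (∃! y, IsReducedCost A' u' I J y) ∧ (∃! z, IsReducedCost A' v' I J z) ∧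
              ∀ o : Option (Fin m ⊕ Fin n),
                IsTropShadowVertexValue A u v I J o ↔ IsShadowVertexValue A' u' v' I J o) ∧
    (∃ (prog : Program) (C : ℕ),
      ∀ (m n : ℕ) (A : Matrix (Fin m) (Fin n) SignedTrop) (u v : Fin n → SignedTrop),
        StronglyNonDegenerate (stack A u v) →
          ∀ (I : Finset (Fin m)) (J : Finset (Fin n)), IsBasis I J →
            ∃ (t : ℕ) (M' : Memory) (o : Option (Fin m ⊕ Fin n)),
              Exec prog (inputMemory (stack A u v) I J) t M' ∧ t ≤ C * n ^ 4 + C ∧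
                IsTropShadowVertexValue A u v I J o ∧ Encodes M' o) := by
  have hlift : ∀ {m n : ℕ} (T : Matrix (Fin m) (Fin n) SignedTrop), ∃ N, IsLift N T := fun T => by
    choose X hX using exists_sval_eq
    exact ⟨fun i j => X (T i j), fun i j => hX _⟩
  refine ⟨fun m n A u v hM I J h => ⟨?_, fun A' u' v' hA hu hv =>
    classicalRule_eq_tropicalRule h hM (isLift_stack hA hu hv)⟩,
    shadowProgram, 17600, fun m n A u v hM I J h => ?_⟩
  · obtain ⟨N, hN⟩ := hlift (stack A u v)
    exact tropRuleWellDefined_of_lift h hN hM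
  · obtain ⟨N, hN⟩ := hlift (stack A u v)
    obtain ⟨t, M', he, ht, o, ho, henc⟩ := shadowProgram_spec h hN hM
    refine ⟨t, M', o, he, ht.trans ?_, ho, henc⟩
    -- `(n + 1) ^ 4 ≤ 16 * n ^ 4 + 16`, where the second term is for `n = 0`
    rcases Nat.eq_zero_or_pos n with rfl | hn
    · norm_num
    · calc 1100 * (n + 1) ^ 4 ≤ 1100 * (2 * n) ^ 4 := by gcongr; omega
        _ = 17600 * n ^ 4 := by ring
        _ ≤ _ := Nat.le_add_right _ _
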